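/- Work in the Euclidean plane. A polygon is a cyclic sequence of vertices joined by straight edges. It is simple if its vertices are distinct, its open edges are pairwise disjoint, and no vertex lies on an open edge. A quadrilateral is nice if it is convex and all its interior angles lie in $[60^\circ,120^\circ]$. A nice quadrilateral mesh of a simple polygon $P'$ is a planar straight line graph $\Gamma$ (a finite set of points, called vertices, together with finitely many pairwise disjoint open segments that have both endpoints among the vertices and contain no vertex), contained in the closed region bounded by $P'$, that contains $P'$ and all of its vertices, and such that every face of $\Gamma$ (bounded component of the complement of $\Gamma$) is the interior of a nice quadrilateral whose four corners are exactly the vertices of $\Gamma$ on its boundary. The faces are called the elements of the mesh. The mesh extends $P'$ if the only vertices of $\Gamma$ on $P'$ are the vertices of $P'$. A sink is a simple polygon $P$ such that whenever an even number (possibly zero) of new vertices is added to the edges of $P$, the resulting polygon $P'$ has a nice quadrilateral mesh that extends $P'$. (1) Every regular octagon is a sink. (2) There is an absolute constant $C$ such that, if $P'$ is obtained from a regular octagon by adding $M\ge 1$ new vertices to its edges, with $M$ even, then $P'$ has a nice quadrilateral mesh with at most $CM$ elements that extends $P'$. (3) There is an absolute constant $C$ such that the following holds. Let $P$ be the cyclic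 polygon whose vertices are $n$ distinct points of a circle, in counterclockwise order, such that each of the $n$ complementary arcs has angle measure at most $45^\circ$. Let $P'$ be obtained from $P$ by adding $k\ge 0$ distinct new vertices to the edges of $P$, where $n+k$ is even. Then $P'$ has a nice quadrilateral mesh with at most $C(n+k)$ elements that extends $P'$. -/

import Mathlib

/-! The plane is `ℂ`. Polygons are finite cyclic sequences of vertices (`Polygon ℂ n`),
with boundary `P.boundary ℝ`, the union of the closed edges. -/

/-- The bounded connected components of the complement of a planar set `K`. -/
def boundedComponents (K : Set ℂ) : Set (Set ℂ) :=
  {U | Bornology.IsBounded U ∧ ∃ x ∈ Kᶜ, U = connectedComponentIn Kᶜ x}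

/-- The union of `K` with all the bounded components of its complement. -/
def polynomialHull (K : Set ℂ) : Set ℂ := K ∪ ⋃₀ boundedComponents K

namespace Polygon

variable {n : ℕ}

/-- The open edge from the `i`-th vertex to the next one (cyclically). -/
def openEdge (P : Polygon ℂ n) (i : Fin n) : Set ℂ :=
  openSegment ℝ (P i) (P (finRotate n i))

/-- A simple polygon: the vertices are distinct, the open edges are pairwise disjoint,
and no vertex lies on an open edge. -/
def IsSimple (P : Polygon ℂ n) : Prop :=
  3 ≤ n ∧ Function.Injective P.vertices ∧
    (∀ i j, i ≠ j → Disjoint (P.openEdge i) (P.openEdge j)) ∧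
    ∀ i j, P i ∉ P.openEdge j

/-- The interior of a simple polygon: the bounded part of the complement of its boundary. -/
def inside (P : Polygon ℂ n) : Set ℂ := ⋃₀ boundedComponents (P.boundary ℝ)

/-- The simple polygon `P'` is obtained from `P` by adding `k` new vertices to the edges
of `P`: it is the same closed curve, and every vertex of `P` is still a vertex. -/
def IsObtainedByAdding {k : ℕ} (P' : Polygon ℂ (n + k)) (P : Polygon ℂ n) : Prop :=
  P'.IsSimple ∧ P'.boundary ℝ = P.boundary ℝ ∧ Set.range P.vertices ⊆ Set.range P'.vertices

/-- A regular `n`-gon with arbitrary center, size and rotation, listed counterclockwise. -/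
def IsRegular (P : Polygon ℂ n) : Prop :=
  ∃ c v : ℂ, v ≠ 0 ∧
    ∀ j : Fin n, P j = c + v * Complex.exp ((2 * Real.pi * (j : ℕ) / n : ℝ) * Complex.I)

/-- The vertices of `P` are `n` distinct points of the circle with center `c` and radius `r`,
listed counterclockwise, and each of the `n` complementary arcs has angle measure at most `θ`.
The arguments of the vertices are `α 0 < ⋯ < α (n - 1)`, and `α n = α 0 + 2 π` closes up the
circle. -/
def IsCyclicTuple (P : Polygon ℂ n) (c : ℂ) (r θ : ℝ) : Prop :=
  0 < r ∧ ∃ α : Fin (n + 1) → ℝ, StrictMono α ∧ α (Fin.last n) = α 0 + 2 * Real.pi ∧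
    (∀ j : Fin n, α j.succ - α j.castSucc ≤ θ) ∧
    ∀ j : Fin n, P j = c + r * Complex.exp (α j.castSucc * Complex.I)

/-- A convex quadrilateral all of whose interior angles lie in `[90° - θ, 90° + θ]`. -/
def IsNiceQuad (q : Polygon ℂ 4) (θ : ℝ) : Prop :=
  q.IsSimple ∧ Convex ℝ q.inside ∧
    ∀ i : Fin 4, EuclideanGeometry.angle (q i) (q (i + 1)) (q (i + 2)) ∈
      Set.Icc (Real.pi / 2 - θ) (Real.pi / 2 + θ)

end Polygon

/-- A planar straight line graph: a compact planar set with a finite vertex set such that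
removing the vertices leaves a finite disjoint union of open segments with endpoints among
the vertices. -/
structure PSLG where
  carrier : Set ℂ
  verts : Finset ℂ
  isCompact : IsCompact carrier
  verts_subset : (verts : Set ℂ) ⊆ carrier
  exists_edges : ∃ E : Finset (ℂ × ℂ),
    (∀ e ∈ E, e.1 ≠ e.2 ∧ e.1 ∈ verts ∧ e.2 ∈ verts) ∧
    (∀ e ∈ E, ∀ f ∈ E, e ≠ f → Disjoint (openSegment ℝ e.1 e.2) (openSegment ℝ f.1 f.2)) ∧
    carrier \ (verts : Set ℂ) = ⋃ e ∈ E, openSegment ℝ e.1 e.2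

namespace PSLG

variable {n : ℕ}

/-- The faces are the bounded components of the complement. -/
def faces (Γ : PSLG) : Set (Set ℂ) := boundedComponents Γ.carrier

/-- `Γ` is a nice quadrilateral mesh of the interior of `P`: it refines `P`, it stays within
the closed region bounded by `P`, and every face is a nice (`θ = 30°`) convex quadrilateral,
the only vertices of `Γ` on the boundary of the face being the four corners. -/
def IsNiceQuadMesh (Γ : PSLG) (P : Polygon ℂ n) : Prop :=
  Set.range P.vertices ⊆ Γ.verts ∧ P.boundary ℝ ⊆ Γ.carrier ∧
    Γ.carrier ⊆ polynomialHull (P.boundary ℝ) ∧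
    ∀ U ∈ Γ.faces, ∃ q : Polygon ℂ 4, q.IsNiceQuad (Real.pi / 6) ∧ U = q.inside ∧
      (Γ.verts : Set ℂ) ∩ q.boundary ℝ = Set.range q.vertices

/-- The only vertices of the mesh `Γ` on the polygon `P` are the vertices of `P`. -/
def Extends (Γ : PSLG) (P : Polygon ℂ n) : Prop :=
  (Γ.verts : Set ℂ) ∩ P.boundary ℝ = Set.range P.vertices

end PSLG

/-- A sink is a simple polygon such that, whenever an even number of vertices is added to its
edges, the interior of the new polygon has a nice quadrilateral mesh extending it. -/
def Polygon.IsSink {n : ℕ} (P : Polygon ℂ n) : Prop :=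
  P.IsSimple ∧ ∀ k : ℕ, Even k → ∀ P' : Polygon ℂ (n + k), P'.IsObtainedByAdding P →
    ∃ Γ : PSLG, Γ.IsNiceQuadMesh P' ∧ Γ.Extends P'

/-! Everything follows from claim (3): a regular octagon is inscribed in a circle with arcs of
exactly 45°, and `8 + M ≤ 9 * M` turns the linear bound of (3) into that of (2).

Construction. Let `N` be the number of vertices of `P'`; it is even, and at least 8 because the arcs
are at most 45°. Write `N = 2 * (M + 3)`. The mesh is built from the inside outwards. Its core is a
centrally symmetric octagon with extra points on two opposite sides, `N` vertices in all, cut into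
`M` rectangles and two trapezoidal caps (`fillable_strip`); parity is used only here. Around it come
rings of `N` quadrilaterals joining corresponding vertices of two nested `N`-gons (`Fillable.ring`).
One ring makes the octagon equiangular, the next one reaches a large circle (`Fillable.circle`). In
each of 96 further rings the radius grows by the factor 50, so that spokes are almost radial
whatever the inner polygon is, and each vertex turns by at most `π / 48`; after them the arguments
are those of the vertices of `P'` (`Fillable.interpolate`). The figure is rescaled into the interior
of `P'`, and a last ring with exactly radial spokes reaches `P'` (`fillable_radial`). Angles are
controlled by directions: a corner deviates from 90° by the difference between the direction of its
spoke and the normal of its other side, and this is kept at most 30°.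

Validity of the mesh. Planarity is never checked by hand. A filling (`IsFilling`) is an algebraic
statement: the oriented boundaries of the quadrilaterals add up to the boundary of `P'`, tested on
all antisymmetric edge functions. The angle seen from `x` is such a function. It gives `2π` on each
quadrilateral around `x` and `0` on the others, while the boundary of `P'` gives `2π` inside and `0`
outside. So a generic point of the region lies in exactly one quadrilateral, and an outside point in
none: the quadrilaterals tile. The signed indicator of a single edge is another such function; it
shows that every edge lies on `P'` or is cancelled by its reverse, so the tiling is edge to edge
(`IsFilling.edge_eq_or_reverse`). The edges then form a planar straight line graph whose faces are
the tiles. -/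

/-! ### Strictly convex polygons -/

/-- The signed area of the parallelogram spanned by two complex numbers. -/
def cross (a b : ℂ) : ℝ := a.re * b.im - a.im * b.re

theorem continuous_cross_sub (a b c : ℂ) : Continuous fun x : ℂ => cross (b - a) (x - c) := by
  unfold cross
  fun_prop

theorem cross_sub_add_smul (e x a : ℂ) {y z : ℂ} {s t : ℝ} (h : s + t = 1)
    (hx : x = s • y + t • z) : cross e (x - a) = s * cross e (y - a) + t * cross e (z - a) := by
  subst hx
  obtain rfl : s = 1 - t := by linarith
  simp [cross]
  ring

theorem convex_setOf_cross_nonneg (e a : ℂ) : Convex ℝ {x : ℂ | 0 ≤ cross e (x - a)} := by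
  intro y hy z hz s t hs ht hst
  simp only [Set.mem_ofPred_eq] at *
  rw [cross_sub_add_smul e _ a hst rfl]
  have := mul_nonneg hs hy
  have := mul_nonneg ht hz
  linarith

theorem exists_eq_lineMap_of_cross_eq_zero {a b x : ℂ} (hab : a ≠ b)
    (h : cross (b - a) (x - a) = 0) : ∃ t : ℝ, x = (1 - t) • a + t • b := by
  have hne : (b.re - a.re) ^ 2 + (b.im - a.im) ^ 2 ≠ 0 := by
    intro h0
    apply hab
    have h1 : b.re - a.re = 0 := by nlinarith [sq_nonneg (b.re - a.re), sq_nonneg (b.im - a.im)]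
    have h2 : b.im - a.im = 0 := by nlinarith [sq_nonneg (b.re - a.re), sq_nonneg (b.im - a.im)]
    apply Complex.ext <;> linarith
  simp only [cross, Complex.sub_re, Complex.sub_im] at h
  obtain ⟨t, ht⟩ : ∃ t : ℝ, t * ((b.re - a.re) ^ 2 + (b.im - a.im) ^ 2) =
      (x.re - a.re) * (b.re - a.re) + (x.im - a.im) * (b.im - a.im) :=
    ⟨_, div_mul_cancel₀ _ hne⟩
  refine ⟨t, ?_⟩
  apply Complex.ext
  · simp
    apply mul_right_cancel₀ hne
    linear_combination (-(b.im - a.im)) * h - (b.re - a.re) * ht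
  · simp
    apply mul_right_cancel₀ hne
    linear_combination (b.re - a.re) * h - (b.im - a.im) * ht

/-- The barycentric coordinates of `x` are the signed areas of the three subtriangles at `x` divided
by the area of the triangle. -/
theorem mem_convexHull_triangle {a b c x : ℂ} (hD : 0 < cross (b - a) (c - a))
    (h1 : 0 ≤ cross (b - a) (x - a)) (h2 : cross (c - a) (x - a) ≤ 0)
    (h3 : 0 ≤ cross (c - b) (x - b)) {s : Set ℂ} (ha : a ∈ s) (hb : b ∈ s) (hc : c ∈ s) :
    x ∈ convexHull ℝ s := by
  obtain ⟨u, hu⟩ : ∃ u, u * cross (b - a) (c - a) = cross (c - b) (x - b) :=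
    ⟨_, div_mul_cancel₀ _ hD.ne'⟩
  obtain ⟨v, hv⟩ : ∃ v, v * cross (b - a) (c - a) = -cross (c - a) (x - a) :=
    ⟨_, div_mul_cancel₀ _ hD.ne'⟩
  obtain ⟨w, hw⟩ : ∃ w, w * cross (b - a) (c - a) = cross (b - a) (x - a) :=
    ⟨_, div_mul_cancel₀ _ hD.ne'⟩
  have hu0 : 0 ≤ u := nonneg_of_mul_nonneg_left (hu ▸ h3) hD
  have hv0 : 0 ≤ v := nonneg_of_mul_nonneg_left (by linarith) hD
  have hw0 : 0 ≤ w := nonneg_of_mul_nonneg_left (hw ▸ h1) hD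
  have hD' := hD.ne'
  simp only [cross, Complex.sub_re, Complex.sub_im] at hu hv hw hD'
  have hsum : u + v + w = 1 := by
    apply mul_right_cancel₀ hD'
    linear_combination hu + hv + hw
  have key := (convex_convexHull ℝ s).sum_mem (t := Finset.univ) (ι := Fin 3)
    (w := ![u, v, w]) (z := ![a, b, c]) ?_ ?_ ?_
  · convert key
    simp only [Fin.sum_univ_three, Matrix.cons_val]
    apply Complex.ext
    · simp
      apply mul_right_cancel₀ hD'
      linear_combination (-a.re) * hu - b.re * hv - c.re * hw
    · simp
      apply mul_right_cancel₀ hD'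
      linear_combination (-a.im) * hu - b.im * hv - c.im * hw
  · intro i _
    fin_cases i <;> assumption
  · simpa [Fin.sum_univ_three] using hsum
  · intro i _
    fin_cases i
    · exact subset_convexHull ℝ s ha
    · exact subset_convexHull ℝ s hb
    · exact subset_convexHull ℝ s hc

namespace Polygon

variable {n : ℕ}

/-- The linear function that is positive to the left of the `i`-th edge. -/
def side (P : Polygon ℂ n) (i : Fin n) (x : ℂ) : ℝ := cross (P (finRotate n i) - P i) (x - P i)

/-- Every vertex lies strictly to the left of each edge that does not contain it. -/
def IsStrictlyConvex (P : Polygon ℂ n) : Prop :=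
  3 ≤ n ∧ ∀ i j, j ≠ i → j ≠ finRotate n i → 0 < P.side i (P j)

/-- The closed convex region bounded by a convex polygon. -/
def hull (P : Polygon ℂ n) : Set ℂ := convexHull ℝ (Set.range P.vertices)

theorem continuous_side (P : Polygon ℂ n) (i : Fin n) : Continuous (P.side i) :=
  continuous_cross_sub _ _ _

theorem side_left (P : Polygon ℂ n) (i : Fin n) : P.side i (P i) = 0 := by
  simp [side, cross]

theorem side_right (P : Polygon ℂ n) (i : Fin n) : P.side i (P (finRotate n i)) = 0 := by
  simp [side, cross]
  ring

theorem side_combo (P : Polygon ℂ n) (i : Fin n) {y z : ℂ} {s t : ℝ} (h : s + t = 1) :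
    P.side i (s • y + t • z) = s * P.side i y + t * P.side i z :=
  cross_sub_add_smul _ _ _ h rfl

theorem finRotate_ne_self (hn : 2 ≤ n) (i : Fin n) : finRotate n i ≠ i := by
  obtain ⟨m, rfl⟩ : ∃ m, n = m + 2 := ⟨n - 2, by omega⟩
  rw [finRotate_apply]
  simp

theorem finRotate_finRotate_ne_self (hn : 3 ≤ n) (i : Fin n) :
    finRotate n (finRotate n i) ≠ i := by
  obtain ⟨m, rfl⟩ : ∃ m, n = m + 3 := ⟨n - 3, by omega⟩
  rw [finRotate_apply, finRotate_apply, add_assoc]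
  simp only [ne_eq, add_eq_left]
  rw [Fin.ext_iff]
  simp [Fin.val_add, Nat.mod_eq_of_lt (show 2 < m + 2 + 1 by omega)]

theorem isCompact_hull (P : Polygon ℂ n) : IsCompact P.hull :=
  (Set.finite_range _).isCompact_convexHull ℝ

theorem edgeSet_subset_hull (P : Polygon ℂ n) (i : Fin n) : P.edgeSet ℝ i ⊆ P.hull := by
  rw [edgeSet, affineSegment_eq_segment]
  exact segment_subset_convexHull ⟨_, rfl⟩ ⟨_, rfl⟩

theorem side_eq_zero_of_mem_edgeSet {P : Polygon ℂ n} {i : Fin n} {x : ℂ} (hx : x ∈ P.edgeSet ℝ i) :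
    P.side i x = 0 := by
  rw [edgeSet, affineSegment_eq_segment] at hx
  obtain ⟨s, t, hs, ht, hst, rfl⟩ := hx
  rw [side_combo _ _ hst, side_left, side_right]
  simp

namespace IsStrictlyConvex

variable {P : Polygon ℂ n}

theorem side_nonneg (hP : P.IsStrictlyConvex) (i j : Fin n) : 0 ≤ P.side i (P j) := by
  by_cases h1 : j = i
  · rw [h1, side_left]
  by_cases h2 : j = finRotate n i
  · rw [h2, side_right]
  exact (hP.2 i j h1 h2).le

theorem vertex_ne_next (hP : P.IsStrictlyConvex) (i : Fin n) : P i ≠ P (finRotate n i) := by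
  intro h
  have h3 := hP.1
  have := hP.2 i (finRotate n (finRotate n i)) (finRotate_finRotate_ne_self h3 i)
    (finRotate_ne_self (by omega) _)
  rw [side, ← h, sub_self] at this
  simp [cross] at this

/-- For the harder inclusion, fan the polygon into triangles from vertex 0. Turning through the
diagonals, `x` passes from their left to their right between some `j` and `j + 1`, and then it lies
in that triangle. -/
theorem hull_eq (hP : P.IsStrictlyConvex) : P.hull = {x | ∀ i, 0 ≤ P.side i x} := by
  apply Set.Subset.antisymm
  · apply convexHull_min
    · rintro _ ⟨j, rfl⟩ i
      exact hP.side_nonneg i j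
    · intro y hy z hz s t hs ht hst i
      exact convex_setOf_cross_nonneg _ _ (hy i) (hz i) hs ht hst
  · intro x hx
    obtain ⟨m, rfl⟩ : ∃ m, n = m + 3 := ⟨n - 3, by have := hP.1; omega⟩
    obtain ⟨-, h⟩ := hP
    simp only [side, finRotate_apply, Set.mem_ofPred_eq] at h hx
    let ι : ℕ → Fin (m + 3) := fun k => ⟨k % (m + 3), Nat.mod_lt _ (by omega)⟩
    let p : ℕ → ℂ := fun k => P (ι k)
    have hι : ∀ k, ι k + 1 = ι (k + 1) := fun k => by
      simp [ι, Fin.ext_iff, Fin.val_add]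
    have hx' : ∀ k : ℕ, 0 ≤ cross (p (k + 1) - p k) (x - p k) := by
      intro k
      have := hx (ι k)
      rwa [hι] at this
    have hend : p (m + 3) = p 0 := by simp [p, ι]
    have hex : ∃ j, 1 ≤ j ∧ j + 1 ≤ m + 2 ∧ 0 ≤ cross (p j - p 0) (x - p 0) ∧
        cross (p (j + 1) - p 0) (x - p 0) ≤ 0 := by
      by_contra! hcon
      have : ∀ j, j ≤ m + 1 → 0 ≤ cross (p (j + 1) - p 0) (x - p 0) ∧
          (1 ≤ j → 0 < cross (p (j + 1) - p 0) (x - p 0)) := by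
        intro j
        induction j with
        | zero => intro _; exact ⟨hx' 0, by simp⟩
        | succ j ih =>
          intro hj
          have := hcon (j + 1) (by omega) (by omega) (ih (by omega)).1
          exact ⟨this.le, fun _ => this⟩
      -- Without a change of sign `x` is strictly to the left of the last diagonal, which is the
      -- last edge reversed.
      have h1 := (this (m + 1) le_rfl).2 (by omega)
      have h2 := hx' (m + 2)
      rw [show m + 2 + 1 = m + 3 from rfl, hend] at h2
      simp only [cross, Complex.sub_re, Complex.sub_im] at h1 h2
      rw [show m + 1 + 1 = m + 2 from rfl] at h1
      nlinarith
    obtain ⟨j, h1, h2, h3, h4⟩ := hex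
    have hv : ∀ k, k < m + 3 → (ι k).val = k := fun k hk => Nat.mod_eq_of_lt hk
    have hD : 0 < cross (p (j + 1) - p j) (p 0 - p j) := by
      have := h (ι j) (ι 0) ?_ ?_
      · rwa [hι] at this
      · rw [Ne, Fin.ext_iff, hv _ (by omega), hv _ (by omega)]
        omega
      · rw [hι, Ne, Fin.ext_iff, hv _ (by omega), hv _ (by omega)]
        omega
    refine mem_convexHull_triangle (a := p 0) (b := p j) (c := p (j + 1)) ?_ h3 h4 (hx' j)
      ⟨_, rfl⟩ ⟨_, rfl⟩ ⟨_, rfl⟩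
    simp only [cross, Complex.sub_re, Complex.sub_im] at hD ⊢
    linarith

theorem interior_hull (hP : P.IsStrictlyConvex) : interior P.hull = {x | ∀ i, 0 < P.side i x} := by
  rw [hP.hull_eq]
  apply Set.Subset.antisymm
  · intro x hx i
    refine lt_of_le_of_ne (interior_subset hx i) fun h0 => ?_
    set e := P (finRotate n i) - P i with he
    -- A small move along the outward normal `-I * e` would leave the half-plane.
    have hcont : Continuous fun t : ℝ => x - (t : ℂ) * (Complex.I * e) := by fun_prop
    have h1 : ∀ᶠ t : ℝ in nhds 0, x - (t : ℂ) * (Complex.I * e) ∈ {x | ∀ i, 0 ≤ P.side i x} := by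
      have := hcont.tendsto 0
      simp only [Complex.ofReal_zero, zero_mul, sub_zero] at this
      exact this (mem_interior_iff_mem_nhds.1 hx)
    obtain ⟨ε, hε, hball⟩ := Metric.eventually_nhds_iff.1 h1
    have h2 := hball (y := ε / 2) (by simp [abs_of_pos hε]; linarith) i
    have hne : 0 < e.re ^ 2 + e.im ^ 2 := by
      have : e ≠ 0 := sub_ne_zero.2 (hP.vertex_ne_next i).symm
      have := Complex.normSq_pos.2 this
      rw [Complex.normSq_apply] at this
      nlinarith
    simp only [side, ← he, cross, Complex.sub_re, Complex.sub_im, Complex.mul_re, Complex.mul_im,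
      Complex.ofReal_re, Complex.ofReal_im, Complex.I_re, Complex.I_im] at h0 h2
    nlinarith
  · have ho : IsOpen {x | ∀ i, 0 < P.side i x} := by
      simp only [Set.ofPred_forall]
      exact isOpen_iInter_of_finite fun i => isOpen_lt continuous_const (P.continuous_side i)
    exact interior_maximal (fun x hx i => (hx i).le) ho

theorem nonempty_interior (hP : P.IsStrictlyConvex) : (interior P.hull).Nonempty := by
  rw [hP.interior_hull]
  have hn := hP.1
  have hn0 : (0 : ℝ) < n := by exact_mod_cast (by omega : 0 < n)
  -- The centroid of the vertices: each side function averages nonnegative values, one of which is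
  -- positive.
  refine ⟨(n : ℂ)⁻¹ * ∑ j, P j, fun i => ?_⟩
  have : P.side i ((n : ℂ)⁻¹ * ∑ j, P j) = (n : ℝ)⁻¹ * ∑ j, P.side i (P j) := by
    have hc : ((n : ℂ)⁻¹) = (((n : ℝ)⁻¹ : ℝ) : ℂ) := by push_cast; rfl
    rw [hc]
    simp only [side, cross, Complex.sub_re, Complex.sub_im, Complex.re_ofReal_mul,
      Complex.im_ofReal_mul, Complex.re_sum, Complex.im_sum, mul_sub, Finset.sum_sub_distrib,
      Finset.sum_const, Finset.card_univ, Fintype.card_fin, nsmul_eq_mul, ← Finset.mul_sum]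
    field_simp
  rw [this]
  refine mul_pos (inv_pos.2 hn0) (Finset.sum_pos' (fun j _ => hP.side_nonneg i j)
    ⟨finRotate n (finRotate n i), Finset.mem_univ _, hP.2 i _ (finRotate_finRotate_ne_self hn i)
    (finRotate_ne_self (by omega) _)⟩)

/-- Along the line of an edge, the side functions of the two neighbouring edges are affine, vanish
at one endpoint and are positive at the other; they bound the parameter from both sides. -/
theorem mem_segment_of_side_eq_zero (hP : P.IsStrictlyConvex) {x : ℂ} (hx : x ∈ P.hull)
    {i : Fin n} (h : P.side i x = 0) :
    x ∈ segment ℝ (P i) (P (finRotate n i)) := by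
  have hn := hP.1
  rw [hP.hull_eq] at hx
  obtain ⟨t, ht⟩ := exists_eq_lineMap_of_cross_eq_zero (hP.vertex_ne_next i) h
  have h1 : 0 ≤ 1 - t := by
    have := hx (finRotate n i)
    rw [ht, side_combo _ _ (by ring), side_left, mul_zero, add_zero] at this
    refine nonneg_of_mul_nonneg_left this (hP.2 _ _ (finRotate_ne_self (by omega) _).symm
      (finRotate_finRotate_ne_self hn i).symm)
  have h2 : 0 ≤ t := by
    obtain ⟨k, rfl⟩ := (finRotate n).surjective i
    have := hx k
    rw [ht, side_combo _ _ (by ring), side_right, mul_zero, zero_add] at this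
    exact nonneg_of_mul_nonneg_left this (hP.2 _ _ (finRotate_finRotate_ne_self hn k)
      (finRotate_ne_self (by omega) _))
  exact ⟨1 - t, t, h1, h2, by ring, ht.symm⟩

theorem side_pos_of_mem_openEdge (hP : P.IsStrictlyConvex) {i j : Fin n} {x : ℂ}
    (hx : x ∈ P.openEdge i) (hij : j ≠ i) :
    0 < P.side j x := by
  obtain ⟨s, t, hs, ht, hst, rfl⟩ := hx
  rw [side_combo _ _ hst]
  have h1 := mul_nonneg hs.le (hP.side_nonneg j i)
  have h2 := mul_nonneg ht.le (hP.side_nonneg j (finRotate n i))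
  by_cases hi : i = finRotate n j
  · have := mul_pos ht (hP.2 j (finRotate n i)
      (by rw [hi]; exact finRotate_finRotate_ne_self hP.1 j)
      (by rw [hi]; exact finRotate_ne_self (by have := hP.1; omega) _))
    linarith
  · have := mul_pos hs (hP.2 j i hij.symm hi)
    linarith

theorem frontier_hull (hP : P.IsStrictlyConvex) : frontier P.hull = P.boundary ℝ := by
  rw [P.isCompact_hull.isClosed.frontier_eq, hP.interior_hull]
  ext x
  simp only [Set.mem_sdiff, Set.mem_ofPred_eq, not_forall, not_lt, boundary, Set.mem_iUnion]
  constructor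
  · rintro ⟨h1, i, hi⟩
    refine ⟨i, ?_⟩
    rw [edgeSet, affineSegment_eq_segment]
    refine hP.mem_segment_of_side_eq_zero h1 (le_antisymm hi ?_)
    rw [hP.hull_eq] at h1
    exact h1 i
  · rintro ⟨i, hi⟩
    exact ⟨P.edgeSet_subset_hull i hi, i, (side_eq_zero_of_mem_edgeSet hi).le⟩

theorem isSimple (hP : P.IsStrictlyConvex) : P.IsSimple := by
  have hop : ∀ i, P.openEdge i ⊆ P.edgeSet ℝ i := fun i => by
    rw [edgeSet, affineSegment_eq_segment]
    exact openSegment_subset_segment _ _ _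
  refine ⟨hP.1, ?_, ?_, ?_⟩
  · intro i j hij
    by_contra hne
    have hz : P.side i (P j) = 0 := by rw [← hij]; exact side_left P i
    by_cases h : j = finRotate n i
    · exact hP.vertex_ne_next i (h ▸ hij)
    · exact (hP.2 i j (Ne.symm hne) h).ne' hz
  · intro i j hij
    rw [Set.disjoint_left]
    intro x hx hy
    exact (hP.side_pos_of_mem_openEdge hx hij.symm).ne' (side_eq_zero_of_mem_edgeSet (hop j hy))
  · intro i j h
    obtain ⟨k, rfl⟩ := (finRotate n).surjective i
    by_cases hk : j = k
    · subst hk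
      have := hP.side_pos_of_mem_openEdge h
        (finRotate_ne_self (by have := hP.1; omega) j)
      rw [side_left] at this
      exact lt_irrefl _ this
    · have := hP.side_pos_of_mem_openEdge h (Ne.symm hk)
      rw [side_right] at this
      exact lt_irrefl _ this

end IsStrictlyConvex

end Polygon

/-! ### Complements of convex sets -/

theorem isPreconnected_setOf_lt_norm {R : ℝ} (hR : 0 < R) : IsPreconnected {z : ℂ | R < ‖z‖} := by
  have : {z : ℂ | R < ‖z‖} = Complex.exp '' {w | Real.log R < w.re} := by
    ext z
    simp only [Set.mem_ofPred_eq, Set.mem_image]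
    constructor
    · intro hz
      have hz0 : z ≠ 0 := by
        rintro rfl
        simp at hz
        linarith
      exact ⟨Complex.log z, by rw [Complex.log_re]; exact Real.log_lt_log hR hz,
        Complex.exp_log hz0⟩
    · rintro ⟨w, hw, rfl⟩
      rw [Complex.norm_exp]
      exact (Real.log_lt_iff_lt_exp hR).1 hw
  rw [this]
  exact ((convex_halfSpace_re_gt _).isPreconnected).image _ Complex.continuous_exp.continuousOn

/-- Hahn–Banach, with the separating functional written as `cross e`: seen from an outside point,
the set fits in an open half-plane. -/
theorem exists_cross_neg_of_notMem {K : Set ℂ} (hK : IsClosed K) (hc : Convex ℝ K) {x : ℂ}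
    (hx : x ∉ K) : ∃ e : ℂ, e ≠ 0 ∧ ∀ y ∈ K, 0 < cross e (y - x) := by
  obtain ⟨f, u, h1, h2⟩ := geometric_hahn_banach_point_closed hc hK hx
  have hf : ∀ z : ℂ, f z = z.re * f 1 + z.im * f Complex.I := by
    intro z
    conv_lhs => rw [← Complex.re_add_im z]
    rw [map_add, show (z.re : ℂ) = z.re • (1 : ℂ) by simp,
      show (z.im : ℂ) * Complex.I = z.im • Complex.I by simp, map_smul, map_smul]
    simp
  by_cases hne : K.Nonempty
  · have hcr : ∀ y ∈ K, 0 < cross ⟨f Complex.I, -f 1⟩ (y - x) := by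
      intro y hy
      have := h2 y hy
      have h3 : f (y - x) = (y - x).re * f 1 + (y - x).im * f Complex.I := hf _
      rw [map_sub] at h3
      simp only [cross]
      linarith
    refine ⟨_, ?_, hcr⟩
    intro h0
    obtain ⟨y, hy⟩ := hne
    have := hcr y hy
    rw [h0] at this
    simp [cross] at this
  · exact ⟨1, one_ne_zero, fun y hy => (hne ⟨y, hy⟩).elim⟩

/-- Each outside point lies in a half-plane that misses `K`; all these half-planes meet the exterior
of one large disc, which is connected. -/
theorem isPreconnected_compl_of_convex {K : Set ℂ} (hK : IsCompact K) (hc : Convex ℝ K) :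
    IsPreconnected Kᶜ := by
  obtain ⟨R, hR, hKR⟩ := hK.isBounded.exists_pos_norm_le
  have hfar : {z : ℂ | R < ‖z‖} ⊆ Kᶜ := fun z hz hzK => (hKR z hzK).not_gt hz
  refine isPreconnected_of_forall ((R + 1 : ℝ) : ℂ) fun y hy => ?_
  obtain ⟨e, he, hKe⟩ := exists_cross_neg_of_notMem hK.isClosed hc hy
  have hx0 : ((R + 1 : ℝ) : ℂ) ∈ {z : ℂ | R < ‖z‖} := by
    rw [Set.mem_ofPred_eq, Complex.norm_real, Real.norm_of_nonneg (by linarith)]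
    linarith
  have he2 : 0 < e.re * e.re + e.im * e.im := by
    have := Complex.normSq_pos.2 he
    rwa [Complex.normSq_apply] at this
  have hen : 0 < ‖e‖ := norm_pos_iff.2 he
  set t : ℝ := (R + 1 + ‖y‖) / ‖e‖ with ht
  have ht0 : 0 ≤ t := by positivity
  refine ⟨{z : ℂ | R < ‖z‖} ∪ {z | 0 ≤ cross (-e) (z - y)}, ?_, Or.inl hx0, Or.inr ?_, ?_⟩
  · refine Set.union_subset hfar fun z hz hzK => ?_
    have := hKe z hzK
    simp only [Set.mem_ofPred_eq, cross, Complex.neg_re, Complex.neg_im] at hz this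
    linarith
  · simp [cross]
  -- Far from `y` along the normal that points away from `K`; `t` makes the displacement `R + 1 +
  -- ‖y‖`.
  · refine IsPreconnected.union (y - t * (Complex.I * e)) ?_ ?_ (isPreconnected_setOf_lt_norm hR)
      (convex_setOf_cross_nonneg _ _).isPreconnected
    · have h1 : ‖(t : ℂ) * (Complex.I * e)‖ = R + 1 + ‖y‖ := by
        rw [norm_mul, norm_mul, Complex.norm_I, one_mul, Complex.norm_real,
          Real.norm_of_nonneg ht0, ht, div_mul_cancel₀ _ hen.ne']
      have h2 := norm_sub_norm_le ((t : ℂ) * (Complex.I * e)) y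
      rw [norm_sub_rev, h1] at h2
      simp only [Set.mem_ofPred_eq]
      linarith
    · simp [cross]
      nlinarith

/-- Off the frontier there remain two disjoint connected open sets, the interior and the complement
of `K`, and the second is unbounded. -/
theorem boundedComponents_frontier {K : Set ℂ} (hK : IsCompact K) (hc : Convex ℝ K)
    (hne : (interior K).Nonempty) : boundedComponents (frontier K) = {interior K} := by
  have hcompl : (frontier K)ᶜ = interior K ∪ Kᶜ := by
    rw [hK.isClosed.frontier_eq, Set.compl_sdiff, Set.union_comm, Set.union_comm]
  have hdisj : Disjoint (interior K) Kᶜ :=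
    Set.disjoint_compl_right_iff_subset.2 interior_subset
  have hint : ∀ x ∈ interior K, connectedComponentIn (frontier K)ᶜ x = interior K := by
    intro x hx
    have hxF : x ∈ (frontier K)ᶜ := hcompl ▸ Or.inl hx
    apply Set.Subset.antisymm
    · refine isPreconnected_connectedComponentIn.subset_left_of_subset_union isOpen_interior
        hK.isClosed.isOpen_compl hdisj ?_ ⟨x, mem_connectedComponentIn hxF, hx⟩
      rw [← hcompl]
      exact connectedComponentIn_subset _ _
    · exact hc.interior.isPreconnected.subset_connectedComponentIn hx
        (hcompl ▸ Set.subset_union_left)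
  ext U
  simp only [boundedComponents, Set.mem_ofPred_eq, Set.mem_singleton_iff]
  constructor
  · rintro ⟨hb, x, hx, rfl⟩
    have hx' := hx
    rw [hcompl] at hx'
    rcases hx' with hx' | hx'
    · exact hint x hx'
    · have hsub : Kᶜ ⊆ connectedComponentIn (frontier K)ᶜ x :=
        (isPreconnected_compl_of_convex hK hc).subset_connectedComponentIn hx'
          (hcompl ▸ Set.subset_union_right)
      have h1 := (hb.subset hsub).union hK.isBounded
      rw [Set.compl_union_self] at h1
      exact (NormedSpace.unbounded_univ ℝ ℂ h1).elim
  · rintro rfl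
    obtain ⟨x, hx⟩ := hne
    exact ⟨hK.isBounded.subset interior_subset, x, hcompl ▸ Or.inl hx, (hint x hx).symm⟩

theorem polynomialHull_frontier {K : Set ℂ} (hK : IsCompact K) (hc : Convex ℝ K)
    (hne : (interior K).Nonempty) : polynomialHull (frontier K) = K := by
  rw [polynomialHull, boundedComponents_frontier hK hc hne, Set.sUnion_singleton, Set.union_comm,
    ← closure_eq_interior_union_frontier, hK.isClosed.closure_eq]

namespace Polygon.IsStrictlyConvex

variable {n : ℕ} {P : Polygon ℂ n}

theorem inside_eq (hP : P.IsStrictlyConvex) : P.inside = interior P.hull := by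
  rw [inside, ← hP.frontier_hull, boundedComponents_frontier P.isCompact_hull
    (convex_convexHull ℝ _) hP.nonempty_interior, Set.sUnion_singleton]

theorem polynomialHull_boundary (hP : P.IsStrictlyConvex) :
    polynomialHull (P.boundary ℝ) = P.hull := by
  rw [← hP.frontier_hull, polynomialHull_frontier P.isCompact_hull (convex_convexHull ℝ _)
    hP.nonempty_interior]

end Polygon.IsStrictlyConvex

/-! ### Nice quadrilaterals -/

/-- The real inner product of two complex numbers. -/
def dot (a b : ℂ) : ℝ := a.re * b.re + a.im * b.im

namespace Polygon

/-- A counterclockwise quadrilateral all of whose angles lie in `[60°, 120°]`. -/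
def IsNiceCCW (q : Polygon ℂ 4) : Prop :=
  ∀ i, 0 < cross (q (i + 1) - q i) (q (i + 3) - q i) ∧
    √3 * |dot (q (i + 1) - q i) (q (i + 3) - q i)| ≤ cross (q (i + 1) - q i) (q (i + 3) - q i)

/-- For edge `i`, vertex `i + 3` is placed by the corner at `i`, and vertex `i + 2` by the corner at
`i + 1`. -/
theorem IsNiceCCW.isStrictlyConvex {q : Polygon ℂ 4} (hq : q.IsNiceCCW) :
    q.IsStrictlyConvex := by
  refine ⟨by norm_num, fun i j h1 h2 => ?_⟩
  rw [finRotate_apply] at h2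
  rw [side, finRotate_apply]
  have h : j = i + 3 ∨ j = i + 2 := by
    revert i j
    decide
  rcases h with rfl | rfl
  · exact (hq i).1
  · have := (hq (i + 1)).1
    rw [show i + 1 + 1 = i + 2 by rw [add_assoc]; rfl,
      show i + 1 + 3 = i by rw [add_assoc]; exact add_zero i] at this
    simp only [cross, Complex.sub_re, Complex.sub_im] at this ⊢
    linarith

/-- Since `dot² + cross² = ‖p‖² ‖n‖²`, the hypothesis says that the cosine is at most 1/2 in
absolute value. -/
theorem angle_mem_Icc {n p : ℂ} (h0 : 0 < cross n p) (h : √3 * |dot n p| ≤ cross n p) :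
    InnerProductGeometry.angle p n ∈
      Set.Icc (Real.pi / 2 - Real.pi / 6) (Real.pi / 2 + Real.pi / 6) := by
  have hn : n ≠ 0 := by
    rintro rfl
    simp [cross] at h0
  have hp : p ≠ 0 := by
    rintro rfl
    simp [cross] at h0
  have hpos : 0 < ‖p‖ * ‖n‖ := mul_pos (norm_pos_iff.2 hp) (norm_pos_iff.2 hn)
  have hin : inner ℝ p n = dot n p := by
    rw [Complex.inner]
    simp [dot]
  have hsq : (‖p‖ * ‖n‖) ^ 2 = dot n p ^ 2 + cross n p ^ 2 := by
    rw [mul_pow, ← Complex.normSq_eq_norm_sq, ← Complex.normSq_eq_norm_sq, Complex.normSq_apply,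
      Complex.normSq_apply, dot, cross]
    ring
  have h3 : 3 * dot n p ^ 2 ≤ cross n p ^ 2 := by
    have h1 : (√3 * |dot n p|) ^ 2 ≤ cross n p ^ 2 := pow_le_pow_left₀ (by positivity) h 2
    rwa [mul_pow, Real.sq_sqrt (by norm_num), sq_abs] at h1
  have h4 : |dot n p| ≤ ‖p‖ * ‖n‖ / 2 := by
    apply abs_le_of_sq_le_sq _ (by positivity)
    nlinarith
  obtain ⟨h5, h6⟩ := abs_le.1 h4
  have h7 : dot n p / (‖p‖ * ‖n‖) ≤ 1 / 2 := by
    rw [div_le_iff₀ hpos]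
    linarith
  have h8 : -(1 / 2) ≤ dot n p / (‖p‖ * ‖n‖) := by
    rw [le_div_iff₀ hpos]
    linarith
  have h9 : Real.arccos (1 / 2) = Real.pi / 3 := by
    rw [← Real.cos_pi_div_three, Real.arccos_cos] <;> linarith [Real.pi_pos]
  rw [InnerProductGeometry.angle, hin]
  constructor
  · have := Real.arccos_le_arccos h7
    rw [h9] at this
    linarith
  · have := Real.arccos_le_arccos h8
    rw [Real.arccos_neg, h9] at this
    linarith

theorem IsNiceCCW.isNiceQuad {q : Polygon ℂ 4} (hq : q.IsNiceCCW) :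
    q.IsNiceQuad (Real.pi / 6) := by
  have hc := hq.isStrictlyConvex
  refine ⟨hc.isSimple, ?_, fun i => ?_⟩
  · rw [hc.inside_eq]
    exact (convex_convexHull ℝ _).interior
  · have := hq (i + 1)
    rw [show i + 1 + 1 = i + 2 by rw [add_assoc]; rfl,
      show i + 1 + 3 = i by rw [add_assoc]; exact add_zero i] at this
    exact angle_mem_Icc this.1 this.2

end Polygon

/-! ### Winding numbers -/

/-- The oriented angle under which the segment from `a` to `b` is seen from `x`. -/
noncomputable def windAngle (x a b : ℂ) : ℝ :=
  (((b - x) / (a - x)).arg - ((a - x) / (b - x)).arg) / 2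

/-- The argument of a single quotient is not antisymmetric when the quotient is a negative real.
Taking half the difference of two arguments repairs this for all triples, so that the angle can be
tested on chains. -/
theorem windAngle_antisymm (x a b : ℂ) : windAngle x a b = -windAngle x b a := by
  unfold windAngle
  ring

theorem im_div_eq_cross (a b : ℂ) : (b / a).im = cross a b / Complex.normSq a := by
  rw [Complex.div_im, cross]
  ring

theorem windAngle_eq_arg {x a b : ℂ} (h : 0 < cross (a - x) (b - x)) :
    windAngle x a b = ((b - x) / (a - x)).arg ∧ 0 < windAngle x a b ∧ windAngle x a b < Real.pi ∧
      0 < ((b - x) / (a - x)).im := by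
  have ha : a - x ≠ 0 := by
    intro h0
    simp [h0, cross] at h
  have him : 0 < ((b - x) / (a - x)).im := by
    rw [im_div_eq_cross]
    exact div_pos h (Complex.normSq_pos.2 ha)
  have h1 : ((b - x) / (a - x)).arg ≠ Real.pi := by
    intro h0
    exact him.ne' (Complex.arg_eq_pi_iff.1 h0).2
  have h2 : windAngle x a b = ((b - x) / (a - x)).arg := by
    rw [windAngle, ← inv_div (b - x), Complex.arg_inv, if_neg h1]
    ring
  refine ⟨h2, ?_, ?_, him⟩
  · rw [h2]
    refine lt_of_le_of_ne (Complex.arg_nonneg_iff.2 him.le) fun h0 => ?_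
    exact him.ne' (Complex.arg_eq_zero_iff.1 h0.symm).2
  · rw [h2]
    exact lt_of_le_of_ne (Complex.arg_le_pi _) h1

/-- In an open half-plane seen from `x`, arguments relative to `e` lie in `(0, π)`, so their
differences do not wrap around and sums along a closed polygon telescope to zero. -/
theorem windAngle_eq_sub {e x a b : ℂ} (ha : 0 < cross e (a - x)) (hb : 0 < cross e (b - x)) :
    windAngle x a b = ((b - x) / e).arg - ((a - x) / e).arg := by
  have key : ∀ {a b : ℂ}, 0 < cross e (a - x) → 0 < cross e (b - x) →
      ((b - x) / (a - x)).arg = ((b - x) / e).arg - ((a - x) / e).arg := by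
    intro a b ha hb
    have he : e ≠ 0 := by
      rintro rfl
      simp [cross] at ha
    have hpos : ∀ {c : ℂ}, 0 < cross e (c - x) → 0 < ((c - x) / e).im := fun {c} hc => by
      rw [im_div_eq_cross]
      exact div_pos hc (Complex.normSq_pos.2 he)
    have hne : ∀ {c : ℂ}, 0 < cross e (c - x) → (c - x) / e ≠ 0 := fun {c} hc h0 => by
      have := hpos hc
      rw [h0] at this
      simp at this
    have hlt : ∀ {c : ℂ}, 0 < cross e (c - x) → ((c - x) / e).arg < Real.pi := fun {c} hc =>
      lt_of_le_of_ne (Complex.arg_le_pi _) fun h0 =>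
        (hpos hc).ne' (Complex.arg_eq_pi_iff.1 h0).2
    have hge : ∀ {c : ℂ}, 0 < cross e (c - x) → 0 ≤ ((c - x) / e).arg := fun {c} hc =>
      Complex.arg_nonneg_iff.2 (hpos hc).le
    have hdiv : (b - x) / (a - x) = ((b - x) / e) / ((a - x) / e) := by
      rw [div_div_div_cancel_right₀ he]
    rw [hdiv, ← Complex.arg_coe_angle_toReal_eq_arg, Complex.arg_div_coe_angle (hne hb) (hne ha),
      ← Real.Angle.coe_sub, Real.Angle.toReal_coe_eq_self_iff]
    have := hlt ha
    have := hlt hb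
    have := hge ha
    have := hge hb
    constructor <;> linarith
  rw [windAngle, key ha hb, key hb ha]
  ring

theorem exp_windAngle {x a b : ℂ} (h : 0 < cross (a - x) (b - x)) :
    ∃ r : ℝ, 0 < r ∧ (b - x) / (a - x) = r * Complex.exp (windAngle x a b * Complex.I) := by
  obtain ⟨h1, -, -, h2⟩ := windAngle_eq_arg h
  refine ⟨‖(b - x) / (a - x)‖, norm_pos_iff.2 ?_, ?_⟩
  · intro h0
    simp [h0] at h2
  · rw [h1, Complex.norm_mul_exp_arg_mul_I]

theorem prod_exp_windAngle {x : ℂ} {u : ℕ → ℂ} {N : ℕ}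
    (h : ∀ i < N, 0 < cross (u i - x) (u (i + 1) - x)) (h0 : u 0 - x ≠ 0) :
    ∃ r : ℝ, 0 < r ∧ (u N - x) / (u 0 - x) =
      r * Complex.exp ((∑ i ∈ Finset.range N, windAngle x (u i) (u (i + 1)) : ℝ) * Complex.I) := by
  induction N with
  | zero => exact ⟨1, one_pos, by simp [h0]⟩
  | succ N ih =>
    obtain ⟨r, hr, h1⟩ := ih fun i hi => h i (by omega)
    obtain ⟨s, hs, h2⟩ := exp_windAngle (h N (by omega))
    have hN : u N - x ≠ 0 := by
      intro h3
      have := h N (by omega)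
      simp [h3, cross] at this
    refine ⟨r * s, mul_pos hr hs, ?_⟩
    rw [Finset.sum_range_succ, ← div_mul_div_cancel₀ hN, h2, h1]
    push_cast
    rw [add_mul, Complex.exp_add]
    ring

/-- The successive quotients multiply to 1 around a closed polygon, so the exponential of `i` times
the total angle is 1. -/
theorem exists_sum_windAngle_eq {x : ℂ} {u : ℕ → ℂ} {N : ℕ} (hN : u N = u 0) (h0 : u 0 - x ≠ 0)
    (h : ∀ i < N, 0 < cross (u i - x) (u (i + 1) - x)) :
    ∃ k : ℤ, ∑ i ∈ Finset.range N, windAngle x (u i) (u (i + 1)) = k * (2 * Real.pi) := by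
  obtain ⟨r, hr, h1⟩ := prod_exp_windAngle h h0
  rw [hN, div_self h0] at h1
  have hr1 : r = 1 := by
    have := congrArg norm h1
    rw [norm_mul, Complex.norm_exp_ofReal_mul_I, Complex.norm_real, Real.norm_of_nonneg hr.le,
      norm_one, mul_one] at this
    exact this.symm
  rw [hr1, Complex.ofReal_one, one_mul] at h1
  obtain ⟨k, hk⟩ := Complex.exp_eq_one_iff.1 h1.symm
  refine ⟨k, ?_⟩
  have := congrArg Complex.im hk
  simpa using this

theorem sum_windAngle_eq_zero {e x : ℂ} {u : ℕ → ℂ} {N : ℕ} (hN : u N = u 0)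
    (h : ∀ i ≤ N, 0 < cross e (u i - x)) :
    ∑ i ∈ Finset.range N, windAngle x (u i) (u (i + 1)) = 0 := by
  have : ∀ i ∈ Finset.range N, windAngle x (u i) (u (i + 1)) =
      ((u (i + 1) - x) / e).arg - ((u i - x) / e).arg := fun i hi => by
    rw [Finset.mem_range] at hi
    exact windAngle_eq_sub (h i (by omega)) (h (i + 1) (by omega))
  rw [Finset.sum_congr rfl this, Finset.sum_range_sub (fun i => ((u i - x) / e).arg), hN, sub_self]

namespace Polygon

/-- The sum of an edge function over the edges of a quadrilateral. -/
def edgeSum (w : ℂ → ℂ → ℝ) (q : Polygon ℂ 4) : ℝ := ∑ i, w (q i) (q (finRotate 4 i))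

theorem edgeSum_eq (w : ℂ → ℂ → ℝ) (q : Polygon ℂ 4) :
    edgeSum w q = w (q 0) (q 1) + w (q 1) (q 2) + w (q 2) (q 3) + w (q 3) (q 0) := by
  rw [edgeSum, Fin.sum_univ_four]
  rfl

theorem edgeSum_eq_sum_range (w : ℂ → ℂ → ℝ) (q : Polygon ℂ 4) :
    edgeSum w q = ∑ i ∈ Finset.range 4, w (q ⟨i % 4, Nat.mod_lt _ (by norm_num)⟩)
      (q ⟨(i + 1) % 4, Nat.mod_lt _ (by norm_num)⟩) := by
  rw [edgeSum_eq]
  simp only [Finset.sum_range_succ, Finset.sum_range_zero, zero_add]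
  rfl

theorem cross_vertex_sub (q : Polygon ℂ 4) (i : Fin 4) (x : ℂ) :
    cross (q i - x) (q (finRotate 4 i) - x) = q.side i x := by
  simp [side, cross]
  ring

/-- Four angles in `(0, π)` have a sum in `(0, 4π)`, and the only multiple of `2π` there is `2π`. -/
theorem IsStrictlyConvex.edgeSum_windAngle_of_mem {q : Polygon ℂ 4} (hq : q.IsStrictlyConvex)
    {x : ℂ} (hx : x ∈ interior q.hull) : edgeSum (windAngle x) q = 2 * Real.pi := by
  rw [hq.interior_hull] at hx
  have hpos : ∀ i : ℕ, 0 < cross (q ⟨i % 4, Nat.mod_lt _ (by norm_num)⟩ - x)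
      (q ⟨(i + 1) % 4, Nat.mod_lt _ (by norm_num)⟩ - x) := fun i => by
    have := hx ⟨i % 4, Nat.mod_lt _ (by norm_num)⟩
    rw [← cross_vertex_sub, finRotate_apply] at this
    convert this using 4
    simp [Fin.ext_iff, Fin.val_add]
  have h0 : q 0 - x ≠ 0 := by
    intro h0
    have := hpos 0
    change 0 < cross (q 0 - x) (q 1 - x) at this
    simp [h0, cross] at this
  obtain ⟨k, hk⟩ := exists_sum_windAngle_eq
    (u := fun i => q ⟨i % 4, Nat.mod_lt _ (by norm_num)⟩) (N := 4) rfl h0 fun i _ => hpos i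
  rw [edgeSum_eq_sum_range, hk]
  simp only [Finset.sum_range_succ, Finset.sum_range_zero, zero_add] at hk
  have b := fun i => windAngle_eq_arg (hpos i)
  have b0 := (b 0).2
  have b1 := (b 1).2
  have b2 := (b 2).2
  have b3 := (b 3).2
  have hpi := Real.pi_pos
  simp only [Nat.reduceAdd] at hk b0 b1 b2 b3
  have k1 : (0 : ℝ) < k := by
    by_contra! hle
    have := mul_nonpos_of_nonpos_of_nonneg hle (by positivity : (0 : ℝ) ≤ 2 * Real.pi)
    linarith
  have k2 : (k : ℝ) < 2 := by
    by_contra! hle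
    have := mul_le_mul_of_nonneg_right hle (by positivity : (0 : ℝ) ≤ 2 * Real.pi)
    linarith
  have k3 : k = 1 := by
    have : 0 < k := by exact_mod_cast k1
    have : k < 2 := by exact_mod_cast k2
    omega
  rw [k3]
  simp

theorem edgeSum_windAngle_of_notMem {q : Polygon ℂ 4} {x : ℂ} (hx : x ∉ q.hull) :
    edgeSum (windAngle x) q = 0 := by
  obtain ⟨e, -, he⟩ := exists_cross_neg_of_notMem q.isCompact_hull.isClosed
    (convex_convexHull ℝ _) hx
  rw [edgeSum_eq_sum_range]
  exact sum_windAngle_eq_zero (u := fun i => q ⟨i % 4, Nat.mod_lt _ (by norm_num)⟩) rfl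
    fun i _ => he _ (subset_convexHull ℝ _ ⟨_, rfl⟩)

end Polygon

/-! ### Fillings of polygonal regions by quadrilaterals -/

/-- The quadrilaterals `q j` are nice, and their boundary chains add up to the boundary chain of
the closed polygon with vertices `u 0, …, u (N - 1)`. -/
structure IsFilling {ι : Type*} [Fintype ι] (q : ι → Polygon ℂ 4) (u : ℕ → ℂ) (N : ℕ) : Prop where
  nice : ∀ j, (q j).IsNiceCCW
  chain : ∀ w : ℂ → ℂ → ℝ, (∀ a b, w a b = -w b a) →
    ∑ j, (q j).edgeSum w = ∑ i ∈ Finset.range N, w (u i) (u (i + 1))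

/-- The closed polygon with vertices `u 0, …, u (N - 1)` runs once counterclockwise around
the boundary of the convex polygon `P`. -/
structure IsSubdivision {n : ℕ} (P : Polygon ℂ n) (u : ℕ → ℂ) (N : ℕ) : Prop where
  convex : P.IsStrictlyConvex
  closed : u N = u 0
  mem_hull : ∀ i, u i ∈ P.hull
  edge : ∀ i < N, ∃ a, ∃ t : ℝ, 0 < t ∧ ∀ x, cross (u (i + 1) - u i) (x - u i) = t * P.side a x
  cover : ∀ x ∈ P.boundary ℝ, ∃ i < N, x ∈ segment ℝ (u i) (u (i + 1))
  -- One point suffices: the winding number is constant on the interior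
  -- (`IsSubdivision.sum_windAngle_of_mem`).
  wind : ∃ x ∈ interior P.hull,
    ∑ i ∈ Finset.range N, windAngle x (u i) (u (i + 1)) = 2 * Real.pi

namespace IsSubdivision

variable {n N : ℕ} {P : Polygon ℂ n} {u : ℕ → ℂ}

theorem cross_pos (hu : IsSubdivision P u N) {x : ℂ} (hx : x ∈ interior P.hull) {i : ℕ}
    (hi : i < N) : 0 < cross (u i - x) (u (i + 1) - x) := by
  obtain ⟨a, t, ht, h⟩ := hu.edge i hi
  rw [hu.convex.interior_hull] at hx
  have h1 := h x
  have h2 := mul_pos ht (hx a)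
  simp only [cross, Complex.sub_re, Complex.sub_im] at h1 ⊢
  linarith

theorem sum_windAngle_of_mem (hu : IsSubdivision P u N) {x : ℂ} (hx : x ∈ interior P.hull) :
    ∑ i ∈ Finset.range N, windAngle x (u i) (u (i + 1)) = 2 * Real.pi := by
  obtain ⟨y, hy, hwy⟩ := hu.wind
  have hpi := Real.pi_pos
  have hpos : 0 < N := by
    by_contra! h
    obtain rfl : N = 0 := by omega
    simp at hwy
  have hne : ∀ z ∈ interior P.hull, ∀ i < N, u i - z ≠ 0 := fun z hz i hi h0 => by
    have := hu.cross_pos hz hi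
    simp [h0, cross] at this
  have hcont : ContinuousOn (fun z => ∑ i ∈ Finset.range N, windAngle z (u i) (u (i + 1)))
      (interior P.hull) := by
    refine continuousOn_finsetSum _ fun i hi => ?_
    rw [Finset.mem_range] at hi
    have : Set.EqOn (fun z => windAngle z (u i) (u (i + 1)))
        (fun z => ((u (i + 1) - z) / (u i - z)).arg) (interior P.hull) := fun z hz =>
      (windAngle_eq_arg (hu.cross_pos hz hi)).1
    refine ContinuousOn.congr (fun z hz => ContinuousAt.continuousWithinAt ?_) this
    have h1 : ContinuousAt (fun z => (u (i + 1) - z) / (u i - z)) z :=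
      ContinuousAt.div (by fun_prop) (by fun_prop) (hne z hz i hi)
    have h2 := (windAngle_eq_arg (hu.cross_pos hz hi)).2.2.2
    exact ContinuousAt.comp (f := fun z => (u (i + 1) - z) / (u i - z))
      (Complex.continuousAt_arg (Or.inr h2.ne')) h1
  have hint : ∀ z ∈ interior P.hull,
      ∃ k : ℤ, ∑ i ∈ Finset.range N, windAngle z (u i) (u (i + 1)) = k * (2 * Real.pi) :=
    fun z hz => exists_sum_windAngle_eq hu.closed (hne z hz 0 hpos)
      fun i hi => hu.cross_pos hz hi
  have hpre : IsPreconnected (interior P.hull) :=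
    (convex_convexHull ℝ _).interior.isPreconnected
  have himg := (hpre.image _ hcont).ordConnected
  obtain ⟨k, hk⟩ := hint x hx
  by_contra hcon
  have hk1 : k ≠ 1 := by
    rintro rfl
    rw [hk] at hcon
    simp at hcon
  -- The sum is continuous on a connected set and only takes values in `2πℤ`. A second value would
  -- force an intermediate one, `π` or `3π`.
  have hmem : ∀ c : ℝ, c ∈ Set.uIcc (2 * Real.pi) (k * (2 * Real.pi)) → ∃ m : ℤ, c = m * (2 * Real.pi) := by
    intro c hc
    have := himg.uIcc_subset ⟨y, hy, hwy⟩ ⟨x, hx, hk⟩ hc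
    obtain ⟨z, hz, rfl⟩ := this
    exact hint z hz
  rcases lt_or_gt_of_ne hk1 with h | h
  · have h' : (k : ℝ) ≤ 0 := by exact_mod_cast (by omega : k ≤ 0)
    obtain ⟨m, hm⟩ := hmem Real.pi (Set.mem_uIcc.2 (Or.inr ⟨by nlinarith, by linarith⟩))
    have : (2 * m : ℝ) = 1 := by
      have := mul_right_cancel₀ hpi.ne' (show (2 * m : ℝ) * Real.pi = 1 * Real.pi by linarith)
      exact this
    have : (2 * m : ℤ) = 1 := by exact_mod_cast this
    omega
  · have h' : (2 : ℝ) ≤ k := by exact_mod_cast (by omega : 2 ≤ k)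
    obtain ⟨m, hm⟩ := hmem (3 * Real.pi) (Set.mem_uIcc.2 (Or.inl ⟨by linarith, by nlinarith⟩))
    have : (2 * m : ℝ) = 3 := by
      have := mul_right_cancel₀ hpi.ne' (show (2 * m : ℝ) * Real.pi = 3 * Real.pi by linarith)
      exact this
    have : (2 * m : ℤ) = 3 := by exact_mod_cast this
    omega

theorem sum_windAngle_of_notMem (hu : IsSubdivision P u N) {x : ℂ} (hx : x ∉ P.hull) :
    ∑ i ∈ Finset.range N, windAngle x (u i) (u (i + 1)) = 0 := by
  obtain ⟨e, -, he⟩ := exists_cross_neg_of_notMem P.isCompact_hull.isClosed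
    (convex_convexHull ℝ _) hx
  exact sum_windAngle_eq_zero hu.closed fun i _ => he _ (hu.mem_hull i)

end IsSubdivision

theorem Polygon.IsStrictlyConvex.eventually_mem_hull {n : ℕ} {P : Polygon ℂ n}
    (hP : P.IsStrictlyConvex) {i : Fin n} {x : ℂ} (hx : x ∈ P.openEdge i) :
    ∀ᶠ y in nhds x, 0 ≤ P.side i y → y ∈ P.hull := by
  have : ∀ j, ∀ᶠ y in nhds x, j ≠ i → 0 < P.side j y := fun j => by
    by_cases hj : j = i
    · simp [hj]
    · filter_upwards [(P.continuous_side j).continuousAt.eventually_const_lt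
        (hP.side_pos_of_mem_openEdge hx hj)] with y hy _ using hy
  filter_upwards [Filter.eventually_all.2 this] with y hy h0
  rw [hP.hull_eq]
  intro j
  by_cases hj : j = i
  · exact hj ▸ h0
  · exact (hy j hj).le

theorem Polygon.IsStrictlyConvex.closure_interior_hull {n : ℕ} {P : Polygon ℂ n}
    (hP : P.IsStrictlyConvex) : closure (interior P.hull) = P.hull := by
  have hc : Convex ℝ P.hull := convex_convexHull ℝ _
  rw [hc.closure_interior_eq_closure_of_nonempty_interior
    hP.nonempty_interior]
  exact P.isCompact_hull.isClosed.closure_eq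

/-! ### A filling is an edge-to-edge tiling -/

namespace IsFilling

variable {ι : Type*} {q : ι → Polygon ℂ 4} {u : ℕ → ℂ} {n N : ℕ} {P : Polygon ℂ n}

/-- The union of the boundaries of the quadrilaterals. -/
def skeleton (q : ι → Polygon ℂ 4) : Set ℂ := ⋃ j, frontier (q j).hull

theorem isCompact_skeleton [Finite ι] (q : ι → Polygon ℂ 4) : IsCompact (skeleton q) :=
  isCompact_iUnion fun j => (q j).isCompact_hull.of_isClosed_subset isClosed_frontier
    (q j).isCompact_hull.isClosed.frontier_subset

theorem dense_compl_skeleton [Finite ι] (q : ι → Polygon ℂ 4) : Dense (skeleton q)ᶜ := by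
  rw [skeleton, Set.compl_iUnion]
  refine dense_iInter_of_isOpen (fun j => isClosed_frontier.isOpen_compl) fun j => ?_
  rw [← interior_eq_empty_iff_dense_compl]
  exact interior_frontier (q j).isCompact_hull.isClosed

theorem mem_interior_or_notMem {x : ℂ} (hx : x ∉ skeleton q) (j : ι) :
    x ∈ interior (q j).hull ∨ x ∉ (q j).hull := by
  by_contra! h
  refine hx (Set.mem_iUnion.2 ⟨j, ?_⟩)
  rw [(q j).isCompact_hull.isClosed.frontier_eq]
  exact ⟨h.2, h.1⟩

variable [Fintype ι]

theorem strict (hq : IsFilling q u N) (j : ι) : (q j).IsStrictlyConvex :=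
  (hq.nice j).isStrictlyConvex

/-- Each edge is an edge of the polygon or the reverse of another edge. -/
theorem matched (hq : IsFilling q u N) (j : ι) (i : Fin 4) :
    (∃ k < N, u k = q j i ∧ u (k + 1) = q j (finRotate 4 i)) ∨
      ∃ j' i', q j' i' = q j (finRotate 4 i) ∧ q j' (finRotate 4 i') = q j i := by
  classical
  by_contra! hcon
  obtain ⟨h1, h2⟩ := hcon
  have hne := (hq.strict j).vertex_ne_next i
  set A := q j i with hA
  set B := q j (finRotate 4 i) with hB
  -- The signed indicator of the edge from `A` to `B`. If neither alternative holds, it has positive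
  -- sum over the quadrilaterals but nonpositive sum over the polygon.
  let w : ℂ → ℂ → ℝ := fun a b =>
    (if a = A ∧ b = B then 1 else 0) - (if b = A ∧ a = B then 1 else 0)
  have hw := hq.chain w fun a b => by simp [w]
  have hR : ∑ k ∈ Finset.range N, w (u k) (u (k + 1)) ≤ 0 := by
    refine Finset.sum_nonpos fun k hk => ?_
    have : ¬ (u k = A ∧ u (k + 1) = B) := fun h => h1 k (Finset.mem_range.1 hk) h.1 h.2
    simp only [w, if_neg this]
    split_ifs <;> norm_num
  have hnn : ∀ j' i', 0 ≤ w (q j' i') (q j' (finRotate 4 i')) := fun j' i' => by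
    have : ¬ (q j' (finRotate 4 i') = A ∧ q j' i' = B) := fun h => h2 j' i' h.2 h.1
    simp only [w, if_neg this]
    split_ifs <;> norm_num
  have hL : 0 < ∑ j, (q j).edgeSum w := by
    refine Finset.sum_pos' (fun j' _ => Finset.sum_nonneg fun i' _ => hnn j' i')
      ⟨j, Finset.mem_univ _, Finset.sum_pos' (fun i' _ => hnn j i') ⟨i, Finset.mem_univ _, ?_⟩⟩
    have : ¬ (B = A ∧ A = B) := fun h => hne h.2
    simp only [w, ← hA, ← hB, if_neg this]
    norm_num
  linarith

theorem exists_edge (hq : IsFilling q u N) (hu : IsSubdivision P u N) {k : ℕ} (hk : k < N) :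
    ∃ j i, q j i = u k ∧ q j (finRotate 4 i) = u (k + 1) := by
  classical
  by_contra! hcon
  obtain ⟨x, hx⟩ := hu.convex.nonempty_interior
  let w : ℂ → ℂ → ℝ := fun a b =>
    (if a = u k ∧ b = u (k + 1) then 1 else 0) - (if b = u k ∧ a = u (k + 1) then 1 else 0)
  have hw := hq.chain w fun a b => by simp [w]
  -- The polygon never runs through an edge backwards, since an interior point sees all its edges
  -- counterclockwise.
  have hrev : ∀ i < N, ¬ (u (i + 1) = u k ∧ u i = u (k + 1)) := fun i hi h => by
    have h1 := hu.cross_pos hx hi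
    have h2 := hu.cross_pos hx hk
    rw [h.1, h.2] at h1
    simp only [cross] at h1 h2
    linarith
  have hR : 0 < ∑ i ∈ Finset.range N, w (u i) (u (i + 1)) := by
    refine Finset.sum_pos' (fun i hi => ?_) ⟨k, Finset.mem_range.2 hk, ?_⟩
    · simp only [w, if_neg (hrev i (Finset.mem_range.1 hi))]
      split_ifs <;> norm_num
    · simp only [w, if_neg (hrev k hk)]
      simp
  have hL : ∑ j, (q j).edgeSum w ≤ 0 := by
    refine Finset.sum_nonpos fun j _ => Finset.sum_nonpos fun i _ => ?_
    have : ¬ (q j i = u k ∧ q j (finRotate 4 i) = u (k + 1)) := fun h => hcon j i h.1 h.2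
    simp only [w, if_neg this]
    split_ifs <;> norm_num
  linarith

open Classical in
theorem sum_edgeSum_windAngle (hq : IsFilling q u N) {x : ℂ} (hx : x ∉ skeleton q) :
    ∑ i ∈ Finset.range N, windAngle x (u i) (u (i + 1)) =
      (Finset.univ.filter fun j => x ∈ interior (q j).hull).card * (2 * Real.pi) := by
  rw [← hq.chain _ (windAngle_antisymm x), ← nsmul_eq_mul, ← Finset.sum_const,
    Finset.sum_filter]
  refine Finset.sum_congr rfl fun j _ => ?_
  split_ifs with h
  · exact (hq.strict j).edgeSum_windAngle_of_mem h
  · exact Polygon.edgeSum_windAngle_of_notMem ((mem_interior_or_notMem hx j).resolve_left h)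

theorem boundary_subset_skeleton (hq : IsFilling q u N) (hu : IsSubdivision P u N) :
    P.boundary ℝ ⊆ skeleton q := by
  intro x hx
  obtain ⟨k, hk, hxk⟩ := hu.cover x hx
  obtain ⟨j, i, h1, h2⟩ := hq.exists_edge hu hk
  refine Set.mem_iUnion.2 ⟨j, ?_⟩
  rw [(hq.strict j).frontier_hull, Polygon.boundary]
  refine Set.mem_iUnion.2 ⟨i, ?_⟩
  rwa [Polygon.edgeSet, affineSegment_eq_segment, h1, h2]

open Classical in
theorem card_eq_one (hq : IsFilling q u N) (hu : IsSubdivision P u N) {x : ℂ}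
    (hx : x ∉ skeleton q) (hxP : x ∈ P.hull) :
    (Finset.univ.filter fun j => x ∈ interior (q j).hull).card = 1 := by
  have hint : x ∈ interior P.hull := by
    by_contra h
    apply hx
    apply hq.boundary_subset_skeleton hu
    rw [← hu.convex.frontier_hull, P.isCompact_hull.isClosed.frontier_eq]
    exact ⟨hxP, h⟩
  have h1 := hq.sum_edgeSum_windAngle hx
  rw [hu.sum_windAngle_of_mem hint] at h1
  have h2 : ((1 : ℕ) : ℝ) * (2 * Real.pi) =
    (Finset.univ.filter fun j => x ∈ interior (q j).hull).card * (2 * Real.pi) := by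
    rw [← h1]
    simp
  exact_mod_cast (mul_right_cancel₀ (by positivity) h2).symm

open Classical in
theorem card_eq_zero (hq : IsFilling q u N) (hu : IsSubdivision P u N) {x : ℂ}
    (hx : x ∉ skeleton q) (hxP : x ∉ P.hull) :
    (Finset.univ.filter fun j => x ∈ interior (q j).hull).card = 0 := by
  have h1 := hq.sum_edgeSum_windAngle hx
  rw [hu.sum_windAngle_of_notMem hxP] at h1
  have h2 := (mul_eq_zero.1 h1.symm).resolve_right (by positivity)
  exact_mod_cast h2

/-- Points off the skeleton are dense, so an interior outside the region would contain one, and that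
point would be covered zero times. -/
theorem hull_subset (hq : IsFilling q u N) (hu : IsSubdivision P u N) (j : ι) :
    (q j).hull ⊆ P.hull := by
  classical
  rw [← (hq.strict j).closure_interior_hull, ← P.isCompact_hull.isClosed.closure_eq]
  apply closure_minimal _ isClosed_closure
  intro x hx
  have h1 := (dense_compl_skeleton q).open_subset_closure_inter isOpen_interior hx
  refine closure_mono ?_ h1
  rintro y ⟨hy1, hy2⟩
  by_contra hyP
  have := hq.card_eq_zero hu hy2 hyP
  rw [Finset.card_eq_zero, Finset.filter_eq_empty_iff] at this
  exact this (Finset.mem_univ j) hy1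

theorem disjoint_interior (hq : IsFilling q u N) (hu : IsSubdivision P u N) {j k : ι}
    (hjk : j ≠ k) : Disjoint (interior (q j).hull) (interior (q k).hull) := by
  classical
  rw [Set.disjoint_iff_inter_eq_empty]
  by_contra hne
  obtain ⟨x, hx1, hx2⟩ := (dense_compl_skeleton q).inter_open_nonempty _
    (isOpen_interior.inter isOpen_interior) (Set.nonempty_iff_ne_empty.2 hne)
  have h := hq.card_eq_one hu hx2 (hq.hull_subset hu j (interior_subset hx1.1))
  have hcard := Finset.card_le_one.1 h.le j (by simpa using hx1.1) k (by simpa using hx1.2)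
  exact hjk hcard

theorem iUnion_hull (hq : IsFilling q u N) (hu : IsSubdivision P u N) :
    ⋃ j, (q j).hull = P.hull := by
  classical
  apply Set.Subset.antisymm
  · exact Set.iUnion_subset fun j => hq.hull_subset hu j
  · rw [← hu.convex.closure_interior_hull]
    have hcl : IsClosed (⋃ j, (q j).hull) :=
      isClosed_iUnion_of_finite fun j => (q j).isCompact_hull.isClosed
    refine closure_minimal (fun x hx => ?_) hcl
    rw [← hcl.closure_eq]
    refine closure_mono ?_ ((dense_compl_skeleton q).open_subset_closure_inter isOpen_interior hx)
    rintro y ⟨hy1, hy2⟩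
    have h := hq.card_eq_one hu hy2 (interior_subset hy1)
    obtain ⟨j, hj⟩ := Finset.card_pos.1 (h ▸ one_pos)
    exact Set.mem_iUnion.2 ⟨j, interior_subset (Finset.mem_filter.1 hj).2⟩

theorem disjoint_hull (hq : IsFilling q u N) (hu : IsSubdivision P u N) {j k : ι}
    (hjk : j ≠ k) : Disjoint (interior (q j).hull) (q k).hull := by
  rw [← (hq.strict k).closure_interior_hull]
  exact (hq.disjoint_interior hu hjk).closure_right isOpen_interior

/-- Near an interior point of an edge, the left half-disc belongs to `q j`. The right half-disc is
outside `P` or belongs to the quadrilateral with the reversed edge. A third quadrilateral reaching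
that point would overlap one of these two. -/
theorem eq_or_reverse (hq : IsFilling q u N) (hu : IsSubdivision P u N) {j k : ι} {i : Fin 4}
    {x : ℂ} (hx : x ∈ (q j).openEdge i) (hxk : x ∈ (q k).hull) :
    k = j ∨ ∃ i', q k i' = q j (finRotate 4 i) ∧ q k (finRotate 4 i') = q j i := by
  by_contra! hcon
  obtain ⟨hkj, hcon⟩ := hcon
  have hev := (hq.strict j).eventually_mem_hull hx
  rw [← (hq.strict k).closure_interior_hull] at hxk
  rcases hq.matched j i with ⟨m, hm, h1, h2⟩ | ⟨j', i', h1, h2⟩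
  · obtain ⟨a, t, ht, hside⟩ := hu.edge m hm
    obtain ⟨y, hy, hyk⟩ := mem_closure_iff_nhds.1 hxk _ hev
    refine (hq.disjoint_hull hu hkj).le_bot ⟨hyk, hy ?_⟩
    have hyP := hq.hull_subset hu k (interior_subset hyk)
    rw [hu.convex.hull_eq] at hyP
    rw [Polygon.side, ← h1, ← h2, hside]
    exact mul_nonneg ht.le (hyP a)
  · have hx' : x ∈ (q j').openEdge i' := by
      rw [Polygon.openEdge, h1, h2, openSegment_symm]
      exact hx
    have hev' := (hq.strict j').eventually_mem_hull hx'
    obtain ⟨y, ⟨hy, hy'⟩, hyk⟩ := mem_closure_iff_nhds.1 hxk _ (Filter.inter_mem hev hev')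
    have hneg : (q j').side i' y = -(q j).side i y := by
      simp only [Polygon.side, h1, h2, cross, Complex.sub_re, Complex.sub_im]
      ring
    have hkj' : k ≠ j' := by
      rintro rfl
      exact hcon i' h1 h2
    rcases le_total 0 ((q j).side i y) with h0 | h0
    · exact (hq.disjoint_hull hu hkj).le_bot ⟨hyk, hy h0⟩
    · exact (hq.disjoint_hull hu hkj').le_bot ⟨hyk, hy' (by rw [hneg]; linarith)⟩

/-- Two edges are equal, opposite, or meet at most in an endpoint. -/
theorem edge_eq_or_reverse (hq : IsFilling q u N) (hu : IsSubdivision P u N) {j k : ι}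
    {i l : Fin 4} {x : ℂ} (hx : x ∈ (q j).openEdge i) (hxk : x ∈ (q k).edgeSet ℝ l) :
    (q k l = q j i ∧ q k (finRotate 4 l) = q j (finRotate 4 i)) ∨
      (q k l = q j (finRotate 4 i) ∧ q k (finRotate 4 l) = q j i) := by
  have hz := Polygon.side_eq_zero_of_mem_edgeSet hxk
  rcases hq.eq_or_reverse hu hx ((q k).edgeSet_subset_hull l hxk) with rfl | ⟨i', h1, h2⟩
  · left
    by_cases h : l = i
    · subst h
      exact ⟨rfl, rfl⟩
    · exact (((hq.strict k).side_pos_of_mem_openEdge hx h).ne' hz).elim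
  · right
    have hx' : x ∈ (q k).openEdge i' := by
      rw [Polygon.openEdge, h1, h2, openSegment_symm]
      exact hx
    by_cases h : l = i'
    · subst h
      exact ⟨h1, h2⟩
    · exact (((hq.strict k).side_pos_of_mem_openEdge hx' h).ne' hz).elim

theorem vertex_notMem_openEdge (hq : IsFilling q u N) (hu : IsSubdivision P u N) (j k : ι)
    (i l : Fin 4) : q k l ∉ (q j).openEdge i := by
  intro hx
  have hmem : q k l ∈ (q k).edgeSet ℝ l := by
    rw [Polygon.edgeSet, affineSegment_eq_segment]
    exact left_mem_segment _ _ _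
  rcases hq.edge_eq_or_reverse hu hx hmem with h | h
  · rw [h.1] at hx
    exact (hq.strict j).isSimple.2.2.2 _ _ hx
  · rw [h.1] at hx
    exact (hq.strict j).isSimple.2.2.2 _ _ hx

end IsFilling

/-! ### The planar straight line graph of a filling -/

namespace IsFilling

variable {ι : Type*} {q : ι → Polygon ℂ 4} {u : ℕ → ℂ} {n N : ℕ} {P : Polygon ℂ n}
variable [Fintype ι]

open Classical in
/-- The corners of the quadrilaterals. -/
noncomputable def corners (q : ι → Polygon ℂ 4) : Finset ℂ :=
  Finset.univ.image fun p : ι × Fin 4 => q p.1 p.2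

theorem mem_corners {q : ι → Polygon ℂ 4} {x : ℂ} : x ∈ corners q ↔ ∃ j i, q j i = x := by
  simp [corners]

open Classical in
/-- A choice of an orientation for each edge of the quadrilaterals. -/
noncomputable def orientedEdges (q : ι → Polygon ℂ 4) : Finset (ℂ × ℂ) :=
  Finset.univ.image fun p : ι × Fin 4 => Quot.out s(q p.1 p.2, q p.1 (finRotate 4 p.2))

/-- An edge shared by two quadrilaterals occurs in both directions. Passing through `Sym2` counts it
once, so that distinct edges of the graph are disjoint. -/
theorem exists_of_mem_orientedEdges {q : ι → Polygon ℂ 4} {e : ℂ × ℂ} (he : e ∈ orientedEdges q) :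
    ∃ j i, e = Quot.out s(q j i, q j (finRotate 4 i)) ∧
      s(e.1, e.2) = s(q j i, q j (finRotate 4 i)) := by
  simp only [orientedEdges, Finset.mem_image, Finset.mem_univ, true_and, Prod.exists] at he
  obtain ⟨j, i, rfl⟩ := he
  exact ⟨j, i, rfl, Quot.out_eq _⟩

theorem openSegment_eq_of_sym2_eq {a b c d : ℂ} (h : s(a, b) = s(c, d)) :
    openSegment ℝ a b = openSegment ℝ c d := by
  rcases Sym2.eq_iff.1 h with ⟨rfl, rfl⟩ | ⟨rfl, rfl⟩
  · rfl
  · exact openSegment_symm _ _ _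

theorem openEdge_subset_edgeSet (P : Polygon ℂ n) (i : Fin n) : P.openEdge i ⊆ P.edgeSet ℝ i := by
  rw [Polygon.edgeSet, affineSegment_eq_segment]
  exact openSegment_subset_segment _ _ _

theorem mem_skeleton (hq : IsFilling q u N) {x : ℂ} :
    x ∈ skeleton q ↔ ∃ j i, x ∈ (q j).edgeSet ℝ i := by
  simp only [skeleton, Set.mem_iUnion]
  refine exists_congr fun j => ?_
  rw [(hq.strict j).frontier_hull, Polygon.boundary, Set.mem_iUnion]

theorem vertex_mem_edgeSet (P : Polygon ℂ n) (i : Fin n) : P i ∈ P.edgeSet ℝ i := by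
  rw [Polygon.edgeSet, affineSegment_eq_segment]
  exact left_mem_segment _ _ _

theorem mem_vertex_or_mem_openEdge {P : Polygon ℂ n} {i : Fin n} {x : ℂ}
    (hx : x ∈ P.edgeSet ℝ i) : x = P i ∨ x = P (finRotate n i) ∨ x ∈ P.openEdge i := by
  rwa [Polygon.edgeSet, affineSegment_eq_segment, ← insert_endpoints_openSegment,
    Set.mem_insert_iff, Set.mem_insert_iff] at hx

/-- The planar straight line graph formed by the edges of the quadrilaterals. -/
noncomputable def graph (hq : IsFilling q u N) (hu : IsSubdivision P u N) : PSLG where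
  carrier := skeleton q
  verts := corners q
  isCompact := isCompact_skeleton q
  verts_subset := by
    intro x hx
    obtain ⟨j, i, rfl⟩ := mem_corners.1 hx
    exact hq.mem_skeleton.2 ⟨j, i, vertex_mem_edgeSet _ _⟩
  exists_edges := by
    refine ⟨orientedEdges q, ?_, ?_, ?_⟩
    · intro e he
      obtain ⟨j, i, -, h⟩ := exists_of_mem_orientedEdges he
      have hne := (hq.strict j).vertex_ne_next i
      rcases Sym2.eq_iff.1 h with ⟨h1, h2⟩ | ⟨h1, h2⟩
      · exact ⟨by rwa [h1, h2], mem_corners.2 ⟨_, _, h1.symm⟩, mem_corners.2 ⟨_, _, h2.symm⟩⟩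
      · exact ⟨by rw [h1, h2]; exact hne.symm, mem_corners.2 ⟨_, _, h1.symm⟩,
          mem_corners.2 ⟨_, _, h2.symm⟩⟩
    · intro e he f hf hef
      obtain ⟨j, i, h1, h2⟩ := exists_of_mem_orientedEdges he
      obtain ⟨k, l, h3, h4⟩ := exists_of_mem_orientedEdges hf
      rw [Set.disjoint_left]
      intro x hx hy
      apply hef
      rw [openSegment_eq_of_sym2_eq h2] at hx
      rw [openSegment_eq_of_sym2_eq h4] at hy
      rw [h1, h3]
      congr 1
      rcases hq.edge_eq_or_reverse hu (j := j) (i := i) hx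
        (openEdge_subset_edgeSet (q k) l hy) with h | h
      · rw [h.1, h.2]
      · rw [h.1, h.2, Sym2.eq_swap]
    · ext x
      simp only [Set.mem_sdiff, Set.mem_iUnion, SetLike.mem_coe]
      constructor
      · rintro ⟨hx, hv⟩
        obtain ⟨j, i, hji⟩ := hq.mem_skeleton.1 hx
        rcases mem_vertex_or_mem_openEdge hji with h | h | h
        · exact (hv (mem_corners.2 ⟨j, i, h.symm⟩)).elim
        · exact (hv (mem_corners.2 ⟨j, _, h.symm⟩)).elim
        · refine ⟨Quot.out s(q j i, q j (finRotate 4 i)), ?_, ?_⟩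
          · exact Finset.mem_image.2 ⟨(j, i), Finset.mem_univ _, rfl⟩
          · have hz : s((Quot.out s(q j i, q j (finRotate 4 i))).1,
                (Quot.out s(q j i, q j (finRotate 4 i))).2) =
                s(q j i, q j (finRotate 4 i)) := Quot.out_eq _
            rw [openSegment_eq_of_sym2_eq hz]
            exact h
      · rintro ⟨e, he, hx⟩
        obtain ⟨j, i, -, h⟩ := exists_of_mem_orientedEdges he
        rw [openSegment_eq_of_sym2_eq h] at hx
        refine ⟨hq.mem_skeleton.2 ⟨j, i, openEdge_subset_edgeSet _ _ hx⟩, fun hv => ?_⟩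
        obtain ⟨k, l, rfl⟩ := mem_corners.1 hv
        exact hq.vertex_notMem_openEdge hu _ _ _ _ hx

/-- The complement of the skeleton is the disjoint union of the open tiles and the complement of
`P.hull`, the latter connected and unbounded. -/
theorem faces_graph_subset (hq : IsFilling q u N) (hu : IsSubdivision P u N) :
    (hq.graph hu).faces ⊆ Set.range fun j => interior (q j).hull := by
  rintro U ⟨hb, x, hx, rfl⟩
  change x ∈ (skeleton q)ᶜ at hx
  change Bornology.IsBounded (connectedComponentIn (skeleton q)ᶜ x) at hb
  have hhull := hq.iUnion_hull hu
  have hcov : ∀ y ∈ (skeleton q)ᶜ, y ∈ P.hull → ∃ j, y ∈ interior (q j).hull := by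
    intro y hy hyP
    rw [← hhull] at hyP
    obtain ⟨j, hj⟩ := Set.mem_iUnion.1 hyP
    exact ⟨j, (mem_interior_or_notMem hy j).resolve_right (not_not.2 hj)⟩
  have hPs : P.hullᶜ ⊆ (skeleton q)ᶜ := by
    rw [Set.compl_subset_compl, ← hhull]
    exact Set.iUnion_mono fun j => (q j).isCompact_hull.isClosed.frontier_subset
  have hqs : ∀ j, interior (q j).hull ⊆ (skeleton q)ᶜ := by
    intro j y hy hys
    obtain ⟨k, hk⟩ := Set.mem_iUnion.1 hys
    rcases eq_or_ne j k with rfl | hjk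
    · rw [(q j).isCompact_hull.isClosed.frontier_eq] at hk
      exact hk.2 hy
    · exact (hq.disjoint_hull hu hjk).le_bot
        ⟨hy, (q k).isCompact_hull.isClosed.frontier_subset hk⟩
  by_cases hxP : x ∈ P.hull
  · obtain ⟨j, hj⟩ := hcov x hx hxP
    refine ⟨j, ?_⟩
    change interior (q j).hull = connectedComponentIn (skeleton q)ᶜ x
    have hconv : Convex ℝ (q j).hull := convex_convexHull ℝ _
    apply Set.Subset.antisymm
    · exact hconv.interior.isPreconnected.subset_connectedComponentIn hj (hqs j)
    · refine isPreconnected_connectedComponentIn.subset_left_of_subset_union isOpen_interior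
        (v := P.hullᶜ ∪ ⋃ k ≠ j, interior (q k).hull) ?_ ?_ ?_
        ⟨x, mem_connectedComponentIn hx, hj⟩
      · exact P.isCompact_hull.isClosed.isOpen_compl.union
          (isOpen_biUnion fun k _ => isOpen_interior)
      · rw [Set.disjoint_union_right]
        constructor
        · exact Set.disjoint_compl_right_iff_subset.2
            (interior_subset.trans (hq.hull_subset hu j))
        · rw [Set.disjoint_iUnion₂_right]
          exact fun k hk => hq.disjoint_interior hu hk.symm
      · intro y hy
        have hys := connectedComponentIn_subset _ _ hy
        by_cases hyP : y ∈ P.hull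
        · obtain ⟨k, hk⟩ := hcov y hys hyP
          by_cases hkj : k = j
          · exact Or.inl (hkj ▸ hk)
          · exact Or.inr (Or.inr (Set.mem_iUnion₂.2 ⟨k, hkj, hk⟩))
        · exact Or.inr (Or.inl hyP)
  · have hconv : Convex ℝ P.hull := convex_convexHull ℝ _
    have hsub := (isPreconnected_compl_of_convex P.isCompact_hull hconv).subset_connectedComponentIn
      hxP hPs
    have h1 := (hb.subset hsub).union P.isCompact_hull.isBounded
    rw [Set.compl_union_self] at h1
    exact (NormedSpace.unbounded_univ ℝ ℂ h1).elim

theorem encard_faces_graph_le (hq : IsFilling q u N) (hu : IsSubdivision P u N) :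
    (hq.graph hu).faces.encard ≤ (Fintype.card ι : ℕ∞) := by
  refine (Set.encard_le_encard (hq.faces_graph_subset hu)).trans ?_
  rw [← Set.image_univ]
  refine (Set.encard_image_le _ _).trans ?_
  rw [Set.encard_univ, ENat.card_eq_coe_fintype_card]

/-- Each edge of the subdivision is an edge of a quadrilateral, and no corner lies in an open edge,
so the mesh adds no boundary vertex. -/
theorem corners_inter_boundary (hq : IsFilling q u N) (hu : IsSubdivision P u N) :
    (corners q : Set ℂ) ∩ P.boundary ℝ = u '' Set.Iio N := by
  ext x
  constructor
  · rintro ⟨hx, hb⟩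
    obtain ⟨k, hk, hxk⟩ := hu.cover x hb
    obtain ⟨j, i, h1, h2⟩ := hq.exists_edge hu hk
    have hx' : x ∈ (q j).edgeSet ℝ i := by
      rwa [Polygon.edgeSet, affineSegment_eq_segment, h1, h2]
    rcases mem_vertex_or_mem_openEdge hx' with h | h | h
    · exact ⟨k, hk, by rw [h, h1]⟩
    · by_cases hkN : k + 1 < N
      · exact ⟨k + 1, hkN, by rw [h, h2]⟩
      · obtain rfl : N = k + 1 := by omega
        exact ⟨0, by simp, by rw [h, h2, hu.closed]⟩
    · obtain ⟨k', l, rfl⟩ := mem_corners.1 hx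
      exact (hq.vertex_notMem_openEdge hu _ _ _ _ h).elim
  · rintro ⟨k, hk, rfl⟩
    obtain ⟨j, i, h1, h2⟩ := hq.exists_edge hu hk
    refine ⟨mem_corners.2 ⟨j, i, h1⟩, ?_⟩
    rw [← hu.convex.frontier_hull, P.isCompact_hull.isClosed.frontier_eq, hu.convex.interior_hull]
    obtain ⟨a, t, ht, h⟩ := hu.edge k hk
    refine ⟨hu.mem_hull k, fun hpos => ?_⟩
    have h3 := h (u k)
    have h4 := mul_pos ht (hpos a)
    rw [← h3] at h4
    simp [cross] at h4

/-- A filling of a convex polygon by nice quadrilaterals is a nice mesh. -/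
theorem exists_mesh (hq : IsFilling q u N) (hu : IsSubdivision P u N) {m : ℕ}
    {P' : Polygon ℂ m} (hb : P'.boundary ℝ = P.boundary ℝ)
    (hr : Set.range P'.vertices = u '' Set.Iio N) :
    ∃ Γ : PSLG, Γ.IsNiceQuadMesh P' ∧ Γ.Extends P' ∧
      Γ.faces.encard ≤ (Fintype.card ι : ℕ∞) := by
  have hcor := hq.corners_inter_boundary hu
  refine ⟨hq.graph hu, ⟨?_, ?_, ?_, ?_⟩, ?_, hq.encard_faces_graph_le hu⟩
  · rw [hr, ← hcor]
    exact Set.inter_subset_left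
  · rw [hb]
    exact hq.boundary_subset_skeleton hu
  · rw [hb, hu.convex.polynomialHull_boundary, ← hq.iUnion_hull hu]
    exact Set.iUnion_mono fun j => (q j).isCompact_hull.isClosed.frontier_subset
  · intro U hU
    obtain ⟨j, rfl⟩ := hq.faces_graph_subset hu hU
    refine ⟨q j, (hq.nice j).isNiceQuad, (hq.strict j).inside_eq.symm, ?_⟩
    ext x
    constructor
    · rintro ⟨hx, hxb⟩
      obtain ⟨i, hi⟩ := Set.mem_iUnion.1 hxb
      rcases mem_vertex_or_mem_openEdge hi with h | h | h
      · exact ⟨i, h.symm⟩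
      · exact ⟨_, h.symm⟩
      · obtain ⟨k', l, rfl⟩ := mem_corners.1 hx
        exact (hq.vertex_notMem_openEdge hu _ _ _ _ h).elim
    · rintro ⟨i, rfl⟩
      exact ⟨mem_corners.2 ⟨j, i, rfl⟩, Set.mem_iUnion.2 ⟨i, vertex_mem_edgeSet _ _⟩⟩
  · rw [PSLG.Extends, hb, hr]
    exact hcor

end IsFilling

/-! ### Directions -/

/-- `z` is a positive multiple of `exp (i τ)`. -/
def HasDir (z : ℂ) (τ : ℝ) : Prop :=
  ∃ r : ℝ, 0 < r ∧ z.re = r * Real.cos τ ∧ z.im = r * Real.sin τ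

namespace HasDir

variable {z w : ℂ} {τ υ : ℝ}

theorem neg (h : HasDir z τ) : HasDir (-z) (τ + Real.pi) := by
  obtain ⟨r, hr, h1, h2⟩ := h
  exact ⟨r, hr, by simp [h1], by simp [h2]⟩

theorem add_two_pi (h : HasDir z τ) : HasDir z (τ + 2 * Real.pi) := by
  simpa only [HasDir, Real.cos_add_two_pi, Real.sin_add_two_pi] using h

theorem exp_mul (τ : ℝ) {r : ℝ} (hr : 0 < r) : HasDir (r * Complex.exp (τ * Complex.I)) τ :=
  ⟨r, hr, by rw [Complex.re_ofReal_mul, Complex.exp_ofReal_mul_I_re],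
    by rw [Complex.im_ofReal_mul, Complex.exp_ofReal_mul_I_im]⟩

theorem mul (h : HasDir z τ) (h' : HasDir w υ) : HasDir (z * w) (τ + υ) := by
  obtain ⟨r, hr, h1, h2⟩ := h
  obtain ⟨s, hs, h3, h4⟩ := h'
  refine ⟨r * s, mul_pos hr hs, ?_, ?_⟩
  · rw [Complex.mul_re, h1, h2, h3, h4, Real.cos_add]
    ring
  · rw [Complex.mul_im, h1, h2, h3, h4, Real.sin_add]
    ring

/-- This is `|tan δ| ≤ tan 30°`, read off from the nonnegativity of the cosines of `δ ± π / 3`. -/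
theorem sqrt_three_mul_abs_sin_le {δ : ℝ} (h : |δ| ≤ Real.pi / 6) :
    √3 * |Real.sin δ| ≤ Real.cos δ := by
  obtain ⟨h1, h2⟩ := abs_le.1 h
  have hpi := Real.pi_pos
  have h3 : Real.cos (δ + Real.pi / 3) ≥ 0 :=
    Real.cos_nonneg_of_neg_pi_div_two_le_of_le (by linarith) (by linarith)
  have h4 : Real.cos (δ - Real.pi / 3) ≥ 0 :=
    Real.cos_nonneg_of_neg_pi_div_two_le_of_le (by linarith) (by linarith)
  rw [Real.cos_add, Real.cos_pi_div_three, Real.sin_pi_div_three] at h3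
  rw [Real.cos_sub, Real.cos_pi_div_three, Real.sin_pi_div_three] at h4
  rcases abs_cases (Real.sin δ) with ⟨h5, -⟩ | ⟨h5, -⟩ <;> rw [h5] <;> linarith

/-- For two vectors at angle `π / 2 + δ`, the cross and dot products are proportional to `cos δ` and
`-sin δ`. -/
theorem nice_corner {δ : ℝ} (h : HasDir z τ) (h' : HasDir w υ) (hδ : υ = τ + Real.pi / 2 + δ)
    (hδ' : |δ| ≤ Real.pi / 6) : 0 < cross z w ∧ √3 * |dot z w| ≤ cross z w := by
  obtain ⟨r, hr, h1, h2⟩ := h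
  obtain ⟨s, hs, h3, h4⟩ := h'
  have hrs := mul_pos hr hs
  have hc : cross z w = r * s * Real.cos δ := by
    have : Real.cos δ = Real.sin (υ - τ) := by
      rw [hδ, ← Real.sin_add_pi_div_two]
      ring_nf
    rw [this, cross, h1, h2, h3, h4, Real.sin_sub]
    ring
  have hd : dot z w = -(r * s * Real.sin δ) := by
    have : -Real.sin δ = Real.cos (υ - τ) := by
      rw [hδ, ← Real.cos_add_pi_div_two]
      ring_nf
    rw [← mul_neg, this, dot, h1, h2, h3, h4, Real.cos_sub]
    ring
  have hpos : 0 < Real.cos δ := by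
    have := abs_le.1 hδ'
    have hpi := Real.pi_pos
    exact Real.cos_pos_of_mem_Ioo ⟨by linarith, by linarith⟩
  refine ⟨hc ▸ mul_pos hrs hpos, ?_⟩
  rw [hc, hd, abs_neg, abs_mul, abs_of_pos hrs]
  have := mul_le_mul_of_nonneg_left (sqrt_three_mul_abs_sin_le hδ') hrs.le
  linarith

end HasDir

namespace Polygon

/-- A quadrilateral with two roughly radial sides of directions `σ`, `σ'` and two roughly
tangential sides with normal directions `β`, `β'`. -/
theorem isNiceCCW_of_hasDir {v u u' v' : ℂ} {σ σ' β β' : ℝ} (h1 : HasDir (u - v) σ)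
    (h2 : HasDir (u' - v') σ') (h3 : HasDir (v' - v) (β + Real.pi / 2))
    (h4 : HasDir (u' - u) (β' + Real.pi / 2)) (h5 : |β - σ| ≤ Real.pi / 6)
    (h6 : |β - σ'| ≤ Real.pi / 6) (h7 : |β' - σ| ≤ Real.pi / 6) (h8 : |β' - σ'| ≤ Real.pi / 6) :
    (⟨![v, u, u', v']⟩ : Polygon ℂ 4).IsNiceCCW := by
  have n1 : HasDir (v - u) (σ + Real.pi) := by simpa using h1.neg
  have n2 : HasDir (v' - u') (σ' + Real.pi) := by simpa using h2.neg
  have n3 : HasDir (v - v') (β + Real.pi / 2 + Real.pi) := by simpa using h3.neg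
  have n4 : HasDir (u - u') (β' + Real.pi / 2 + Real.pi) := by simpa using h4.neg
  intro i
  fin_cases i
  · exact h1.nice_corner h3 (δ := β - σ) (by ring) h5
  · exact h4.nice_corner n1 (δ := σ - β') (by ring) (by rwa [abs_sub_comm])
  · exact n2.nice_corner n4 (δ := β' - σ') (by ring) h8
  · exact n3.nice_corner h2.add_two_pi (δ := σ' - β) (by ring) (by rwa [abs_sub_comm])

theorem IsNiceCCW.similar {q : Polygon ℂ 4} (hq : q.IsNiceCCW) (c : ℂ) {v : ℂ} (hv : v ≠ 0) :
    (⟨fun i => c + v * q i⟩ : Polygon ℂ 4).IsNiceCCW := by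
  intro i
  have hn : 0 < v.re * v.re + v.im * v.im := by
    have := Complex.normSq_pos.2 hv
    rwa [Complex.normSq_apply] at this
  obtain ⟨h1, h2⟩ := hq i
  have hsub : ∀ a b : ℂ, c + v * a - (c + v * b) = v * (a - b) := fun a b => by ring
  have hc : ∀ a b : ℂ, cross (v * a) (v * b) = (v.re * v.re + v.im * v.im) * cross a b :=
    fun a b => by
      simp only [cross, Complex.mul_re, Complex.mul_im]
      ring
  have hd : ∀ a b : ℂ, dot (v * a) (v * b) = (v.re * v.re + v.im * v.im) * dot a b :=
    fun a b => by
      simp only [dot, Complex.mul_re, Complex.mul_im]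
      ring
  simp only [hsub, hc, hd, abs_mul, abs_of_pos hn]
  refine ⟨mul_pos hn h1, ?_⟩
  have := mul_le_mul_of_nonneg_left h2 hn.le
  linarith

theorem IsNiceCCW.neg {a b c d : ℂ} (h : (⟨![a, b, c, d]⟩ : Polygon ℂ 4).IsNiceCCW) :
    (⟨![-a, -b, -c, -d]⟩ : Polygon ℂ 4).IsNiceCCW := by
  convert h.similar 0 (v := -1) (by simp) using 2
  ext i
  fin_cases i <;> simp

end Polygon

/-! ### Rings of quadrilaterals -/

/-- The closed polygon `u 0, …, u (N - 1)` can be filled with `m` nice quadrilaterals. -/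
def Fillable (u : ℕ → ℂ) (N m : ℕ) : Prop :=
  ∃ (ι : Type) (_ : Fintype ι) (q : ι → Polygon ℂ 4), Fintype.card ι ≤ m ∧ IsFilling q u N

namespace Fillable

variable {u v : ℕ → ℂ} {N m : ℕ}

theorem mono (h : Fillable u N m) {m' : ℕ} (hm : m ≤ m') : Fillable u N m' := by
  obtain ⟨ι, inst, q, hc, hq⟩ := h
  exact ⟨ι, inst, q, hc.trans hm, hq⟩

theorem similar (h : Fillable u N m) (c : ℂ) {a : ℂ} (ha : a ≠ 0) :
    Fillable (fun i => c + a * u i) N m := by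
  obtain ⟨ι, inst, q, hc, hq⟩ := h
  refine ⟨ι, inst, fun j => ⟨fun i => c + a * q j i⟩, hc, fun j => (hq.nice j).similar c ha,
    fun w hw => ?_⟩
  exact hq.chain (fun x y => w (c + a * x) (c + a * y)) fun x y => hw _ _

/-- Add a ring of quadrilaterals around a filled polygon. -/
theorem ring (h : Fillable v N m) (hv : v N = v 0) (hu : u N = u 0)
    (hnice : ∀ i < N, (⟨![v i, u i, u (i + 1), v (i + 1)]⟩ : Polygon ℂ 4).IsNiceCCW) :
    Fillable u N (m + N) := by
  obtain ⟨ι, inst, q, hc, hq⟩ := h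
  refine ⟨ι ⊕ Fin N, inferInstance,
    Sum.elim q fun i => ⟨![v i, u i, u (i + 1), v (i + 1)]⟩, ?_, ?_, fun w hw => ?_⟩
  · simpa using hc
  · rintro (j | i)
    · exact hq.nice j
    · exact hnice i i.2
  · rw [Fintype.sum_sum_type]
    simp only [Sum.elim_inl, Sum.elim_inr]
    rw [hq.chain w hw, Fin.sum_univ_eq_sum_range
      (fun i => (⟨![v i, u i, u (i + 1), v (i + 1)]⟩ : Polygon ℂ 4).edgeSum w) N]
    -- Each quadrilateral contributes its outer edge, minus its inner edge, minus a difference of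
    -- consecutive spokes; the spokes telescope around the ring.
    have h1 : ∀ i, (⟨![v i, u i, u (i + 1), v (i + 1)]⟩ : Polygon ℂ 4).edgeSum w =
        (w (u i) (u (i + 1)) - w (v i) (v (i + 1))) -
          (w (v (i + 1)) (u (i + 1)) - w (v i) (u i)) := fun i => by
      rw [Polygon.edgeSum_eq]
      change w (v i) (u i) + w (u i) (u (i + 1)) + w (u (i + 1)) (v (i + 1)) +
        w (v (i + 1)) (v i) = _
      rw [hw (u (i + 1)) (v (i + 1)), hw (v (i + 1)) (v i)]
      ring
    simp only [h1]
    rw [Finset.sum_sub_distrib, Finset.sum_sub_distrib,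
      Finset.sum_range_sub (fun i => w (v i) (u i)), hu, hv]
    ring

end Fillable

/-! ### Rings between concentric circles -/

theorem exp_sub_exp_hasDir {a b S : ℝ} (hS : 0 < S) (h0 : a < b) (h1 : b - a < 2 * Real.pi) :
    HasDir (S * Complex.exp (b * Complex.I) - S * Complex.exp (a * Complex.I))
      ((a + b) / 2 + Real.pi / 2) := by
  have hs : 0 < Real.sin ((b - a) / 2) := Real.sin_pos_of_pos_of_lt_pi (by linarith) (by linarith)
  refine ⟨2 * S * Real.sin ((b - a) / 2), by positivity, ?_, ?_⟩
  · rw [Complex.sub_re, Complex.re_ofReal_mul, Complex.re_ofReal_mul,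
      Complex.exp_ofReal_mul_I_re, Complex.exp_ofReal_mul_I_re, Real.cos_add_pi_div_two,
      ← mul_sub, Real.cos_sub_cos, add_comm a b]
    ring
  · rw [Complex.sub_im, Complex.im_ofReal_mul, Complex.im_ofReal_mul,
      Complex.exp_ofReal_mul_I_im, Complex.exp_ofReal_mul_I_im, Real.sin_add_pi_div_two,
      ← mul_sub, Real.sin_sub_sin, add_comm a b]
    ring

/-- The sine of the argument is at most `(1 / 50) / (49 / 50) ≤ 1 / 24`, and Jordan's inequality
gives `sin (π / 48) ≥ 1 / 24`. -/
theorem abs_arg_one_sub_le {z : ℂ} (hz : ‖z‖ ≤ 1 / 50) : |(1 - z).arg| ≤ Real.pi / 48 := by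
  have hpi := Real.pi_pos
  have hre := (abs_le.1 ((Complex.abs_re_le_norm z).trans hz)).2
  have him := (Complex.abs_im_le_norm z).trans hz
  have hre' : 0 < (1 - z).re := by
    simp
    linarith
  have hnorm : 49 / 50 ≤ ‖1 - z‖ := by
    have := norm_sub_norm_le 1 z
    rw [norm_one] at this
    linarith
  have hsin : |Real.sin (1 - z).arg| ≤ 1 / 24 := by
    rw [Complex.sin_arg, abs_div, abs_norm, div_le_iff₀ (by linarith)]
    simp
    linarith
  obtain ⟨h1, h2⟩ := abs_lt.1 (Complex.abs_arg_lt_pi_div_two_iff.2 (Or.inl hre'))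
  have hj : (1 : ℝ) / 24 ≤ Real.sin (Real.pi / 48) := by
    have := Real.mul_le_sin (x := Real.pi / 48) (by linarith) (by linarith)
    have h3 : 2 / Real.pi * (Real.pi / 48) = 1 / 24 := by
      field_simp
      norm_num
    linarith
  obtain ⟨h3, h4⟩ := abs_le.1 hsin
  rw [abs_le]
  constructor
  · by_contra! hlt
    have := Real.sin_lt_sin_of_lt_of_le_pi_div_two h1.le (by linarith) hlt
    rw [Real.sin_neg] at this
    linarith
  · by_contra! hlt
    have := Real.sin_lt_sin_of_lt_of_le_pi_div_two (by linarith) h2.le hlt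
    linarith

theorem exists_hasDir_exp_sub {S ψ : ℝ} {v : ℂ} (hS : 0 < S) (hv : ‖v‖ ≤ S / 50) :
    ∃ κ : ℝ, |κ| ≤ Real.pi / 48 ∧ HasDir (S * Complex.exp (ψ * Complex.I) - v) (ψ + κ) := by
  have hE : (S : ℂ) * Complex.exp (ψ * Complex.I) ≠ 0 :=
    mul_ne_zero (by exact_mod_cast hS.ne') (Complex.exp_ne_zero _)
  set z := v / (S * Complex.exp (ψ * Complex.I)) with hz
  have hz1 : ‖z‖ ≤ 1 / 50 := by
    rw [hz, norm_div, norm_mul, Complex.norm_exp_ofReal_mul_I, Complex.norm_real,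
      Real.norm_of_nonneg hS.le, mul_one, div_le_iff₀ hS]
    linarith
  refine ⟨(1 - z).arg, abs_arg_one_sub_le hz1, ?_⟩
  have h1 : (S : ℂ) * Complex.exp (ψ * Complex.I) - v =
      S * Complex.exp (ψ * Complex.I) * (1 - z) := by
    rw [mul_sub, mul_one, hz, mul_div_cancel₀ _ hE]
  rw [h1]
  refine (HasDir.exp_mul ψ hS).mul ?_
  have hne : 1 - z ≠ 0 := by
    intro h0
    rw [← sub_eq_zero.1 h0, norm_one] at hz1
    norm_num at hz1
  refine ⟨‖1 - z‖, norm_pos_iff.2 hne, ?_, ?_⟩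
  · rw [Complex.norm_mul_cos_arg]
  · rw [Complex.norm_mul_sin_arg]

theorem exp_add_two_pi_mul_I (τ : ℝ) :
    Complex.exp (((τ + 2 * Real.pi : ℝ) : ℂ) * Complex.I) = Complex.exp (τ * Complex.I) := by
  rw [Complex.exp_eq_exp_iff_exists_int]
  exact ⟨1, by push_cast; ring⟩

/-- Add a ring between a small polygon and a polygon inscribed in a large circle. -/
theorem Fillable.circle {v : ℕ → ℂ} {N m : ℕ} {S : ℝ} {ψ : ℕ → ℝ} (h : Fillable v N m)
    (hv : v N = v 0) (hψ : ψ N = ψ 0 + 2 * Real.pi) (hS : 0 < S)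
    (hgap : ∀ i < N, ψ i < ψ (i + 1) ∧ ψ (i + 1) - ψ i ≤ Real.pi / 4)
    (hnorm : ∀ i ≤ N, ‖v i‖ ≤ S / 50)
    (hdir : ∀ i < N, ∃ β, HasDir (v (i + 1) - v i) (β + Real.pi / 2) ∧
      |β - ψ i| ≤ 7 * Real.pi / 48 ∧ |β - ψ (i + 1)| ≤ 7 * Real.pi / 48) :
    Fillable (fun i => S * Complex.exp (ψ i * Complex.I)) N (m + N) := by
  refine h.ring hv ?_ fun i hi => ?_
  · rw [hψ, exp_add_two_pi_mul_I]
  · have hpi := Real.pi_pos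
    obtain ⟨β, h1, h2, h3⟩ := hdir i hi
    obtain ⟨g1, g2⟩ := hgap i hi
    obtain ⟨κ, k1, k2⟩ := exists_hasDir_exp_sub (ψ := ψ i) hS (hnorm i hi.le)
    obtain ⟨κ', k3, k4⟩ := exists_hasDir_exp_sub (ψ := ψ (i + 1)) hS (hnorm (i + 1) hi)
    rw [abs_le] at h2 h3 k1 k3
    -- Spokes are within `π / 48` of radial. Inner normals are within `7π / 48` of radial and outer
    -- ones within `π / 8`, so no deviation exceeds `8π / 48 = π / 6`.
    refine Polygon.isNiceCCW_of_hasDir k2 k4 h1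
      (exp_sub_exp_hasDir hS g1 (by linarith)) ?_ ?_ ?_ ?_ <;> rw [abs_le] <;>
      constructor <;> linarith

/-- Rotate the points on a circle to new positions, through finitely many larger circles. -/
theorem Fillable.interpolate {N m : ℕ} {S : ℝ} {ψ θ : ℕ → ℝ} (hS : 0 < S)
    (h : Fillable (fun i => S * Complex.exp (ψ i * Complex.I)) N m)
    (hψ : ψ N = ψ 0 + 2 * Real.pi) (hθ : θ N = θ 0 + 2 * Real.pi)
    (hgap : ∀ i < N, ψ i < ψ (i + 1) ∧ ψ (i + 1) - ψ i ≤ Real.pi / 4)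
    (hgap' : ∀ i < N, θ i < θ (i + 1) ∧ θ (i + 1) - θ i ≤ Real.pi / 4) {R : ℕ}
    (hR : ∀ i ≤ N, |θ i - ψ i| ≤ R * (Real.pi / 48)) :
    ∃ S' : ℝ, 0 < S' ∧ Fillable (fun i => S' * Complex.exp (θ i * Complex.I)) N (m + R * N) := by
  rcases Nat.eq_zero_or_pos R with rfl | hRpos
  · refine ⟨S, hS, ?_⟩
    obtain ⟨ι, inst, q, hc, hq⟩ := h
    refine ⟨ι, inst, q, by omega, hq.nice, fun w hw => (hq.chain w hw).trans ?_⟩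
    have : ∀ i ≤ N, θ i = ψ i := fun i hi => by
      have := hR i hi
      simp only [Nat.cast_zero, zero_mul, abs_nonpos_iff] at this
      linarith
    refine Finset.sum_congr rfl fun i hi => ?_
    rw [Finset.mem_range] at hi
    rw [this i hi.le, this (i + 1) hi]
  have hR0 : (0 : ℝ) < R := by exact_mod_cast hRpos
  have hpi := Real.pi_pos
  -- Linear interpolation keeps the sequence increasing with gaps at most `π / 4`, since both
  -- conditions are convex.
  let φ : ℕ → ℕ → ℝ := fun t i => ψ i + t / R * (θ i - ψ i)
  have key : ∀ t ≤ R, Fillable (fun i => ((S * 50 ^ t : ℝ) : ℂ) *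
      Complex.exp (φ t i * Complex.I)) N (m + t * N) := by
    intro t
    induction t with
    | zero =>
      intro _
      simpa [φ] using h
    | succ t ih =>
      intro ht
      have htR : ((t : ℝ) + 1) / R ≤ 1 := by
        rw [div_le_one hR0]
        exact_mod_cast ht
      have hmono : ∀ a : ℝ, 0 ≤ a → a ≤ 1 → ∀ i < N,
          ψ i + a * (θ i - ψ i) < ψ (i + 1) + a * (θ (i + 1) - ψ (i + 1)) ∧
          ψ (i + 1) + a * (θ (i + 1) - ψ (i + 1)) - (ψ i + a * (θ i - ψ i)) ≤ Real.pi / 4 := by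
        intro a ha0 ha1 i hi
        obtain ⟨g1, g2⟩ := hgap i hi
        obtain ⟨g3, g4⟩ := hgap' i hi
        constructor
        · rcases ha1.lt_or_eq with ha | rfl
          · nlinarith [mul_nonneg ha0 (sub_nonneg.2 g3.le), mul_pos (sub_pos.2 ha) (sub_pos.2 g1)]
          · linarith
        · nlinarith [mul_nonneg ha0 (sub_nonneg.2 g4),
            mul_nonneg (sub_nonneg.2 ha1) (sub_nonneg.2 g2)]
      have hperiod : ∀ a : ℝ, ψ N + a * (θ N - ψ N) =
          ψ 0 + a * (θ 0 - ψ 0) + 2 * Real.pi := fun a => by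
        rw [hψ, hθ]
        ring
      have ht0 : (t : ℝ) / R ≤ 1 := le_trans (by gcongr; linarith) htR
      have hm := hmono (t / R) (by positivity) ht0
      have hm' := hmono (((t + 1 : ℕ) : ℝ) / R) (by positivity) (by push_cast; exact htR)
      have hstep : ∀ i ≤ N, |φ (t + 1) i - φ t i| ≤ Real.pi / 48 := by
        intro i hi
        have h1 : φ (t + 1) i - φ t i = (θ i - ψ i) / R := by
          simp only [φ]
          push_cast
          field_simp
          ring
        rw [h1, abs_div, abs_of_pos hR0, div_le_iff₀ hR0]
        linarith [hR i hi]
      rw [show m + (t + 1) * N = m + t * N + N by ring]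
      refine (ih (by omega)).circle (S := S * 50 ^ (t + 1)) (ψ := φ (t + 1)) ?_ (hperiod _)
        (by positivity) hm' ?_ ?_
      · simp only [φ]
        rw [hperiod, exp_add_two_pi_mul_I]
      · intro i _
        rw [norm_mul, Complex.norm_exp_ofReal_mul_I, Complex.norm_real, mul_one,
          Real.norm_of_nonneg (by positivity), pow_succ]
        linarith
      · intro i hi
        obtain ⟨m1, m2⟩ := hm i hi
        have s1 := abs_le.1 (hstep i hi.le)
        have s2 := abs_le.1 (hstep (i + 1) hi)
        -- The normal of the inner chord is within `π / 8` of the old arguments, which move by at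
        -- most `π / 48`: together `7π / 48`.
        refine ⟨(φ t i + φ t (i + 1)) / 2, exp_sub_exp_hasDir (by positivity) m1 (by linarith),
          ?_, ?_⟩ <;> simp only [φ] at * <;> rw [abs_le] <;> constructor <;> linarith
  refine ⟨S * 50 ^ R, by positivity, ?_⟩
  convert key R le_rfl using 4 with i
  simp only [φ]
  rw [div_self hR0.ne']
  ring_nf

/-! ### A hexagonal strip of quadrilaterals -/

/-- Extend half of a centrally symmetric polygon to the whole polygon. -/
def antiExtend (h : ℕ) (f : ℕ → ℂ) (i : ℕ) : ℂ := if i < h then f i else -f (i - h)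

section antiExtend

variable {h : ℕ} {f g : ℕ → ℂ}

theorem antiExtend_of_le (hf : f h = -f 0) {i : ℕ} (hi : i ≤ h) : antiExtend h f i = f i := by
  rcases hi.lt_or_eq with hi | rfl
  · rw [antiExtend, if_pos hi]
  · rw [antiExtend, if_neg (lt_irrefl _), Nat.sub_self, hf]

theorem antiExtend_add (i : ℕ) : antiExtend h f (h + i) = -f i := by
  rw [antiExtend, if_neg (by omega), Nat.add_sub_cancel_left]

theorem antiExtend_closed (hh : 0 < h) (hf : f h = -f 0) :
    antiExtend h f (2 * h) = antiExtend h f 0 := by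
  rw [two_mul, antiExtend_add, hf, neg_neg, antiExtend_of_le hf hh.le]

theorem forall_antiExtend {p : ℂ → ℂ → ℂ → ℂ → Prop} (hf : f h = -f 0) (hg : g h = -g 0)
    (h1 : ∀ i < h, p (f i) (f (i + 1)) (g i) (g (i + 1)))
    (h2 : ∀ a b c d, p a b c d → p (-a) (-b) (-c) (-d)) {i : ℕ} (hi : i < 2 * h) :
    p (antiExtend h f i) (antiExtend h f (i + 1)) (antiExtend h g i) (antiExtend h g (i + 1)) := by
  rcases lt_or_ge i h with hi' | hi'
  · rw [antiExtend_of_le hf hi'.le, antiExtend_of_le hf hi', antiExtend_of_le hg hi'.le,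
      antiExtend_of_le hg hi']
    exact h1 i hi'
  · obtain ⟨j, rfl⟩ := Nat.exists_eq_add_of_le hi'
    rw [add_assoc, antiExtend_add, antiExtend_add, antiExtend_add, antiExtend_add]
    exact h2 _ _ _ _ (h1 j (by omega))

theorem sum_antiExtend (w : ℂ → ℂ → ℝ) (hf : f h = -f 0) :
    ∑ i ∈ Finset.range (2 * h), w (antiExtend h f i) (antiExtend h f (i + 1)) =
      ∑ i ∈ Finset.range h, w (f i) (f (i + 1)) +
        ∑ i ∈ Finset.range h, w (-f i) (-f (i + 1)) := by
  rw [two_mul, Finset.sum_range_add]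
  congr 1
  · refine Finset.sum_congr rfl fun i hi => ?_
    rw [Finset.mem_range] at hi
    rw [antiExtend_of_le hf hi.le, antiExtend_of_le hf hi]
  · refine Finset.sum_congr rfl fun i _ => ?_
    rw [add_assoc, antiExtend_add, antiExtend_add]

end antiExtend

/-- A centrally symmetric polygon is filled by a strip of quadrilaterals between opposite sides,
with a cap at each end. -/
theorem fillable_strip {M : ℕ} {f : ℕ → ℂ} (hf : f (M + 3) = -f 0)
    (hrect : ∀ i < M, (⟨![-f (M - i), f i, f (i + 1), -f (M - (i + 1))]⟩ :
      Polygon ℂ 4).IsNiceCCW)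
    (hcap : (⟨![f (M + 1), f (M + 2), -f 0, f M]⟩ : Polygon ℂ 4).IsNiceCCW) :
    Fillable (antiExtend (M + 3) f) (2 * (M + 3)) (M + 2) := by
  refine ⟨Fin M ⊕ Bool, inferInstance, Sum.elim
    (fun i => ⟨![-f (M - i), f i, f (i + 1), -f (M - (i + 1))]⟩)
    (fun b => if b then ⟨![f (M + 1), f (M + 2), -f 0, f M]⟩
      else ⟨![-f (M + 1), -f (M + 2), f 0, -f M]⟩), by simp, ?_, fun w hw => ?_⟩
  · rintro (i | _ | _)
    · exact hrect i i.2
    · have := hcap.neg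
      rw [neg_neg] at this
      simpa using this
    · simpa using hcap
  · rw [Fintype.sum_sum_type]
    simp only [Sum.elim_inl, Sum.elim_inr, Fintype.sum_bool, if_true, Bool.false_eq_true, if_false]
    rw [Fin.sum_univ_eq_sum_range
      (fun i => (⟨![-f (M - i), f i, f (i + 1), -f (M - (i + 1))]⟩ : Polygon ℂ 4).edgeSum w) M,
      sum_antiExtend w hf]
    -- The sides across the strip telescope, leaving the first and the last one, which the two caps
    -- cancel.
    have h1 : ∀ i, (⟨![-f (M - i), f i, f (i + 1), -f (M - (i + 1))]⟩ : Polygon ℂ 4).edgeSum w =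
        w (f i) (f (i + 1)) + w (-f (M - (i + 1))) (-f (M - i)) -
          (w (-f (M - (i + 1))) (f (i + 1)) - w (-f (M - i)) (f i)) := fun i => by
      rw [Polygon.edgeSum_eq]
      change w (-f (M - i)) (f i) + w (f i) (f (i + 1)) + w (f (i + 1)) (-f (M - (i + 1))) +
        w (-f (M - (i + 1))) (-f (M - i)) = _
      rw [hw (f (i + 1))]
      ring
    have h2 : (⟨![f (M + 1), f (M + 2), -f 0, f M]⟩ : Polygon ℂ 4).edgeSum w =
        w (f (M + 1)) (f (M + 2)) + w (f (M + 2)) (-f 0) + w (-f 0) (f M) +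
          w (f M) (f (M + 1)) := Polygon.edgeSum_eq _ _
    have h3 : (⟨![-f (M + 1), -f (M + 2), f 0, -f M]⟩ : Polygon ℂ 4).edgeSum w =
        w (-f (M + 1)) (-f (M + 2)) + w (-f (M + 2)) (f 0) + w (f 0) (-f M) +
          w (-f M) (-f (M + 1)) := Polygon.edgeSum_eq _ _
    have h4 : ∑ i ∈ Finset.range M, w (-f (M - (i + 1))) (-f (M - i)) =
        ∑ i ∈ Finset.range M, w (-f i) (-f (i + 1)) := by
      rw [← Finset.sum_range_reflect]
      refine Finset.sum_congr rfl fun i hi => ?_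
      rw [Finset.mem_range] at hi
      rw [show M - (M - 1 - i + 1) = i by omega, show M - (M - 1 - i) = i + 1 by omega]
    simp only [h1, h2, h3]
    rw [Finset.sum_sub_distrib, Finset.sum_add_distrib, h4,
      Finset.sum_range_sub (fun i => w (-f (M - i)) (f i))]
    simp only [Finset.sum_range_succ, Nat.sub_self, Nat.sub_zero, hf, neg_neg]
    rw [hw (f 0) (-f M)]
    ring

/-- Half of a centrally symmetric polygon: a chain of `M + 1` points at the top, then a corner
and its conjugate. -/
def capChain (M : ℕ) (top : ℕ → ℂ) (c : ℂ) (i : ℕ) : ℂ :=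
  if i ≤ M then top i else if i = M + 1 then c else if i = M + 2 then ⟨c.re, -c.im⟩ else -top 0

section capChain

variable {M : ℕ} {top : ℕ → ℂ} {c : ℂ}

theorem capChain_of_le {i : ℕ} (h : i ≤ M) : capChain M top c i = top i := by
  rw [capChain, if_pos h]

theorem capChain_one : capChain M top c (M + 1) = c := by
  simp [capChain]

theorem capChain_two : capChain M top c (M + 2) = ⟨c.re, -c.im⟩ := by
  simp [capChain]

theorem capChain_three : capChain M top c (M + 3) = -top 0 := by
  simp [capChain]

theorem capChain_anti : capChain M top c (M + 3) = -capChain M top c 0 := by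
  rw [capChain_three, capChain_of_le (Nat.zero_le _)]

theorem forall_lt_add_three {p : ℕ → Prop} (h : ∀ i < M, p i) (h0 : p M) (h1 : p (M + 1))
    (h2 : p (M + 2)) : ∀ i < M + 3, p i := by
  intro i hi
  by_cases h3 : i < M
  · exact h i h3
  · obtain rfl | rfl | rfl : i = M ∨ i = M + 1 ∨ i = M + 2 := by omega
    exacts [h0, h1, h2]

end capChain

theorem sqrt_three_mul_self : √3 * √3 = 3 := Real.mul_self_sqrt (by norm_num)

theorem one_lt_sqrt_three : 1 < √3 := by
  rw [Real.lt_sqrt] <;> norm_num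

namespace HasDir

open Real

theorem of_re_neg {x : ℝ} (hx : x < 0) : HasDir ⟨x, 0⟩ (π / 2 + π / 2) :=
  ⟨-x, by linarith, by simp, by simp⟩

theorem of_im_pos {y : ℝ} (hy : 0 < y) : HasDir ⟨0, y⟩ (π / 2) := ⟨y, hy, by simp, by simp⟩

theorem of_im_neg {y : ℝ} (hy : y < 0) : HasDir ⟨0, y⟩ (π + π / 2) := by
  have := (of_im_pos (y := -y) (by linarith)).neg
  rw [add_comm] at this
  convert this using 1
  apply Complex.ext <;> simp

theorem of_sqrt_three_one {t : ℝ} (ht : 0 < t) : HasDir ⟨t * √3, t⟩ (π / 6) :=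
  ⟨2 * t, by linarith, by rw [cos_pi_div_six]; ring, by rw [sin_pi_div_six]; ring⟩

theorem of_neg_sqrt_three_one {t : ℝ} (ht : 0 < t) : HasDir ⟨-(t * √3), t⟩ (π - π / 6) :=
  ⟨2 * t, by linarith, by rw [cos_pi_sub, cos_pi_div_six]; ring,
    by rw [sin_pi_sub, sin_pi_div_six]; ring⟩

theorem of_one_one {t : ℝ} (ht : 0 < t) : HasDir ⟨t, t⟩ (π / 4) := by
  refine ⟨√2 * t, by positivity, ?_, ?_⟩
  · rw [cos_pi_div_four]
    have := Real.mul_self_sqrt (show (0 : ℝ) ≤ 2 by norm_num)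
    linear_combination (-t / 2) * this
  · rw [sin_pi_div_four]
    have := Real.mul_self_sqrt (show (0 : ℝ) ≤ 2 by norm_num)
    linear_combination (-t / 2) * this

theorem conj {x y τ : ℝ} (h : HasDir ⟨x, y⟩ τ) : HasDir ⟨x, -y⟩ (2 * π - τ) := by
  obtain ⟨r, hr, h1, h2⟩ := h
  exact ⟨r, hr, by rw [cos_two_pi_sub]; exact h1, by
    rw [sin_two_pi_sub, mul_neg, neg_inj]
    exact h2⟩

theorem of_arctan (x : ℝ) : HasDir ⟨x, √3⟩ (π / 2 - arctan (x / √3)) := by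
  have hc := cos_arctan_pos (x / √3)
  refine ⟨√3 / cos (arctan (x / √3)), by positivity, ?_, ?_⟩
  · rw [cos_pi_div_two_sub]
    have := tan_arctan (x / √3)
    rw [tan_eq_sin_div_cos] at this
    rw [div_mul_eq_mul_div, mul_div_assoc, this, mul_div_cancel₀]
    positivity
  · rw [sin_pi_div_two_sub, div_mul_cancel₀ _ hc.ne']

end HasDir

theorem arctan_one_div_sqrt_three : Real.arctan (1 / √3) = Real.pi / 6 := by
  rw [← Real.tan_pi_div_six, Real.arctan_tan] <;> linarith [Real.pi_pos]

theorem abs_arctan_div_sqrt_three_le {x : ℝ} (hx : |x| ≤ 1) :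
    |Real.arctan (x / √3)| ≤ Real.pi / 6 := by
  obtain ⟨h1, h2⟩ := abs_le.1 hx
  rw [← arctan_one_div_sqrt_three, abs_le, ← Real.arctan_neg]
  constructor
  · apply Real.arctan_mono
    rw [← neg_div]
    gcongr
  · apply Real.arctan_mono
    gcongr

theorem HasDir.congr {z w : ℂ} {τ υ : ℝ} (h : HasDir z τ) (hz : w = z) (hτ : υ = τ) :
    HasDir w υ := by
  rwa [hz, hτ]

/-- The abscissas of `M + 1` equally spaced points from `1` down to `-1`. -/
noncomputable def abscissa (M i : ℕ) : ℝ := 1 - 2 * i / M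

/-- Half of the octagon bounding the strip of quadrilaterals. -/
noncomputable def innerHalf (M : ℕ) : ℕ → ℂ :=
  capChain M (fun i => ⟨abscissa M i, 2⟩) ⟨-(1 + √3), 1⟩

/-- Half of an equiangular octagon around the strip of quadrilaterals. -/
noncomputable def outerHalf (M : ℕ) : ℕ → ℂ :=
  capChain M (fun i => ⟨2 * abscissa M i, 2 + √3⟩) ⟨-4, √3⟩

section octagon

variable {M : ℕ}

theorem abscissa_zero (M : ℕ) : abscissa M 0 = 1 := by simp [abscissa]

theorem abscissa_self (hM : 0 < M) : abscissa M M = -1 := by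
  have : (M : ℝ) ≠ 0 := by positivity
  rw [abscissa]
  field_simp
  norm_num

theorem abscissa_reflect (hM : 0 < M) {i : ℕ} (hi : i ≤ M) :
    abscissa M (M - i) = -abscissa M i := by
  have : (M : ℝ) ≠ 0 := by positivity
  rw [abscissa, abscissa, Nat.cast_sub hi]
  field_simp
  ring

theorem abscissa_succ (M i : ℕ) : abscissa M (i + 1) = abscissa M i - 2 / M := by
  rw [abscissa, abscissa]
  push_cast
  ring

theorem abs_abscissa_le {i : ℕ} (hi : i ≤ M) : |abscissa M i| ≤ 1 := by
  rcases Nat.eq_zero_or_pos M with rfl | hM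
  · simp [abscissa]
  · have hM' : (0 : ℝ) < M := by exact_mod_cast hM
    have h1 : (2 * i / M : ℝ) ≤ 2 := by
      rw [div_le_iff₀ hM']
      have : (i : ℝ) ≤ M := by exact_mod_cast hi
      linarith
    have h2 : (0 : ℝ) ≤ 2 * i / M := by positivity
    rw [abscissa, abs_le]
    constructor <;> linarith

theorem innerHalf_anti : innerHalf M (M + 3) = -innerHalf M 0 := capChain_anti

theorem outerHalf_anti : outerHalf M (M + 3) = -outerHalf M 0 := capChain_anti

theorem innerHalf_of_le {i : ℕ} (h : i ≤ M) : innerHalf M i = ⟨abscissa M i, 2⟩ :=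
  capChain_of_le h

theorem outerHalf_of_le {i : ℕ} (h : i ≤ M) : outerHalf M i = ⟨2 * abscissa M i, 2 + √3⟩ :=
  capChain_of_le h

theorem innerHalf_one : innerHalf M (M + 1) = ⟨-(1 + √3), 1⟩ := capChain_one

theorem outerHalf_one : outerHalf M (M + 1) = ⟨-4, √3⟩ := capChain_one

theorem innerHalf_two : innerHalf M (M + 2) = ⟨-(1 + √3), -1⟩ := capChain_two

theorem outerHalf_two : outerHalf M (M + 2) = ⟨-4, -√3⟩ := capChain_two

theorem innerHalf_three : innerHalf M (M + 3) = ⟨-1, -2⟩ := by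
  rw [innerHalf, capChain_three, abscissa_zero]
  apply Complex.ext <;> simp

theorem outerHalf_three : outerHalf M (M + 3) = ⟨-2, -(2 + √3)⟩ := by
  rw [outerHalf, capChain_three, abscissa_zero]
  apply Complex.ext
  · simp
  · simp

theorem innerHalf_last (hM : 0 < M) : innerHalf M M = ⟨-1, 2⟩ := by
  rw [innerHalf_of_le le_rfl, abscissa_self hM]

theorem outerHalf_last (hM : 0 < M) : outerHalf M M = ⟨-2, 2 + √3⟩ := by
  rw [outerHalf_of_le le_rfl, abscissa_self hM]
  simp

open Real in
theorem innerHalf_edge_top (hM : 0 < M) {i : ℕ} (hi : i < M) :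
    HasDir (innerHalf M (i + 1) - innerHalf M i) (π / 2 + π / 2) := by
  have hM' : (0 : ℝ) < 2 / M := by positivity
  refine (HasDir.of_re_neg (x := -(2 / M)) (by linarith)).congr ?_ rfl
  rw [innerHalf_of_le hi, innerHalf_of_le hi.le, abscissa_succ]
  apply Complex.ext <;> simp

open Real in
theorem outerHalf_edge_top (hM : 0 < M) {i : ℕ} (hi : i < M) :
    HasDir (outerHalf M (i + 1) - outerHalf M i) (π / 2 + π / 2) := by
  have hM' : (0 : ℝ) < 2 / M := by positivity
  refine (HasDir.of_re_neg (x := -(2 * (2 / M))) (by linarith)).congr ?_ rfl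
  rw [outerHalf_of_le hi, outerHalf_of_le hi.le, abscissa_succ]
  apply Complex.ext
  · simp
    ring
  · simp

open Real in
theorem innerHalf_edge_zero (hM : 0 < M) :
    HasDir (innerHalf M (M + 1) - innerHalf M M) (2 * π / 3 + π / 2) := by
  refine (HasDir.of_sqrt_three_one one_pos).neg.congr ?_ (by ring)
  rw [innerHalf_one, innerHalf_last hM]
  apply Complex.ext
  · simp
  · simp
    norm_num

open Real in
theorem outerHalf_edge_zero (hM : 0 < M) :
    HasDir (outerHalf M (M + 1) - outerHalf M M) (3 * π / 4 + π / 2) := by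
  refine (HasDir.of_one_one (t := 2) two_pos).neg.congr ?_ (by ring)
  rw [outerHalf_one, outerHalf_last hM]
  apply Complex.ext
  · simp
    norm_num
  · simp

open Real in
theorem innerHalf_edge_one :
    HasDir (innerHalf M (M + 2) - innerHalf M (M + 1)) (π + π / 2) := by
  refine (HasDir.of_im_neg (y := -2) (by norm_num)).congr ?_ rfl
  rw [innerHalf_one, innerHalf_two]
  apply Complex.ext
  · simp
  · simp
    norm_num

open Real in
theorem outerHalf_edge_one :
    HasDir (outerHalf M (M + 2) - outerHalf M (M + 1)) (π + π / 2) := by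
  have := one_lt_sqrt_three
  refine (HasDir.of_im_neg (y := -(2 * √3)) (by linarith)).congr ?_ rfl
  rw [outerHalf_one, outerHalf_two]
  apply Complex.ext
  · simp
  · simp
    ring

open Real in
theorem innerHalf_edge_two :
    HasDir (innerHalf M (M + 3) - innerHalf M (M + 2)) (4 * π / 3 + π / 2) := by
  refine (HasDir.of_sqrt_three_one one_pos).conj.congr ?_ (by ring)
  rw [innerHalf_two, innerHalf_three]
  apply Complex.ext
  · simp
  · simp
    norm_num

open Real in
theorem outerHalf_edge_two :
    HasDir (outerHalf M (M + 3) - outerHalf M (M + 2)) (5 * π / 4 + π / 2) := by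
  refine (HasDir.of_one_one (t := 2) two_pos).conj.congr ?_ (by ring)
  rw [outerHalf_two, outerHalf_three]
  apply Complex.ext
  · simp
    norm_num
  · simp

open Real in
theorem spoke_top {i : ℕ} (hi : i ≤ M) :
    HasDir (outerHalf M i - innerHalf M i) (π / 2 - arctan (abscissa M i / √3)) := by
  refine (HasDir.of_arctan _).congr ?_ rfl
  rw [outerHalf_of_le hi, innerHalf_of_le hi]
  apply Complex.ext
  · simp
    ring
  · simp

open Real in
theorem spoke_last (hM : 0 < M) :
    HasDir (outerHalf M M - innerHalf M M) (2 * π / 3) := by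
  refine (spoke_top le_rfl).congr rfl ?_
  rw [abscissa_self hM, neg_div, arctan_neg, arctan_one_div_sqrt_three]
  ring

open Real in
theorem spoke_one : HasDir (outerHalf M (M + 1) - innerHalf M (M + 1)) (5 * π / 6) := by
  have := one_lt_sqrt_three
  refine (HasDir.of_neg_sqrt_three_one (t := √3 - 1) (by linarith)).congr ?_ (by ring)
  rw [outerHalf_one, innerHalf_one]
  apply Complex.ext
  · simp
    linear_combination sqrt_three_mul_self
  · simp

open Real in
theorem spoke_two : HasDir (outerHalf M (M + 2) - innerHalf M (M + 2)) (7 * π / 6) := by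
  have := one_lt_sqrt_three
  refine (HasDir.of_neg_sqrt_three_one (t := √3 - 1) (by linarith)).conj.congr ?_ (by ring)
  rw [outerHalf_two, innerHalf_two]
  apply Complex.ext
  · simp
    linear_combination sqrt_three_mul_self
  · simp
    ring

open Real in
theorem spoke_three : HasDir (outerHalf M (M + 3) - innerHalf M (M + 3)) (4 * π / 3) := by
  refine ((spoke_top (Nat.zero_le M)).neg).congr ?_ ?_
  · rw [outerHalf_anti, innerHalf_anti]
    ring
  · rw [abscissa_zero, arctan_one_div_sqrt_three]
    ring

theorem abs_le_of_eq_mul {x c d : ℝ} (h : x = c * Real.pi) (h1 : |c| ≤ d) :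
    |x| ≤ d * Real.pi := by
  rw [h, abs_mul, abs_of_pos Real.pi_pos]
  exact mul_le_mul_of_nonneg_right h1 Real.pi_pos.le

open Real in
theorem abs_le_pi_div_six {x : ℝ} (c : ℝ) (h : x = c * π) (h1 : |c| ≤ 1 / 6) : |x| ≤ π / 6 := by
  have := abs_le_of_eq_mul h h1
  linarith

open Real in
theorem innerHalf_rect (hM : 0 < M) {i : ℕ} (hi : i < M) :
    (⟨![-innerHalf M (M - i), innerHalf M i, innerHalf M (i + 1),
      -innerHalf M (M - (i + 1))]⟩ : Polygon ℂ 4).IsNiceCCW := by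
  have hv : ∀ j ≤ M, HasDir (innerHalf M j - -innerHalf M (M - j)) (π / 2) := fun j hj => by
    refine (HasDir.of_im_pos (y := 4) (by norm_num)).congr ?_ rfl
    rw [innerHalf_of_le hj, innerHalf_of_le (Nat.sub_le _ _), abscissa_reflect hM hj]
    apply Complex.ext
    · simp
    · simp
      norm_num
  have h0 : |π / 2 - π / 2| ≤ π / 6 := by
    rw [sub_self, abs_zero]
    positivity
  refine Polygon.isNiceCCW_of_hasDir (hv i hi.le) (hv (i + 1) hi) ?_ (innerHalf_edge_top hM hi)
    h0 h0 h0 h0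
  refine (innerHalf_edge_top hM (i := M - (i + 1)) (by omega)).congr ?_ rfl
  rw [show M - (i + 1) + 1 = M - i by omega]
  ring

-- The cap is an isosceles trapezoid with angles 60° and 120°, so every deviation is exactly 30°.
open Real in
theorem innerHalf_cap (hM : 0 < M) :
    (⟨![innerHalf M (M + 1), innerHalf M (M + 2), -innerHalf M 0, innerHalf M M]⟩ :
      Polygon ℂ 4).IsNiceCCW := by
  refine Polygon.isNiceCCW_of_hasDir innerHalf_edge_one (σ' := π + π / 2) ?_ (β := 5 * π / 3) ?_
    (β' := 4 * π / 3) ?_ (abs_le_pi_div_six (1 / 6) (by ring) (by norm_num))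
    (abs_le_pi_div_six (1 / 6) (by ring) (by norm_num))
    (abs_le_pi_div_six (-1 / 6) (by ring) (by norm_num))
    (abs_le_pi_div_six (-1 / 6) (by ring) (by norm_num))
  · refine (HasDir.of_im_neg (y := -4) (by norm_num)).congr ?_ rfl
    rw [← innerHalf_anti, innerHalf_three, innerHalf_last hM]
    apply Complex.ext
    · simp
    · simp
      norm_num
  · refine ((HasDir.of_sqrt_three_one one_pos).add_two_pi).congr ?_ (by ring)
    rw [innerHalf_last hM, innerHalf_one]
    apply Complex.ext
    · simp
    · simp
      norm_num
  · rw [← innerHalf_anti]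
    exact innerHalf_edge_two

-- Along the top the spokes turn from 60° to 120°, and the next ones have directions 150°, 210° and
-- 240°. The normals are 90°, 120°, 180°, 240° on the inner octagon and 90°, 135°, 180°, 225° on the
-- outer one, each within 30° of both adjacent spokes.
open Real in
theorem ring_nice (hM : 0 < M) : ∀ i < M + 3, (⟨![innerHalf M i, outerHalf M i,
    outerHalf M (i + 1), innerHalf M (i + 1)]⟩ : Polygon ℂ 4).IsNiceCCW := by
  refine forall_lt_add_three (fun i hi => ?_) ?_ ?_ ?_
  · have h : ∀ j ≤ M, |π / 2 - (π / 2 - arctan (abscissa M j / √3))| ≤ π / 6 := fun j hj => by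
      rw [sub_sub_cancel]
      exact abs_arctan_div_sqrt_three_le (abs_abscissa_le hj)
    exact Polygon.isNiceCCW_of_hasDir (spoke_top hi.le) (spoke_top hi) (innerHalf_edge_top hM hi)
      (outerHalf_edge_top hM hi) (h i hi.le) (h (i + 1) hi) (h i hi.le) (h (i + 1) hi)
  · exact Polygon.isNiceCCW_of_hasDir (spoke_last hM) spoke_one (innerHalf_edge_zero hM)
      (outerHalf_edge_zero hM) (abs_le_pi_div_six 0 (by ring) (by norm_num))
      (abs_le_pi_div_six (-1 / 6) (by ring) (by norm_num))
      (abs_le_pi_div_six (1 / 12) (by ring) (by norm_num [abs_le]))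
      (abs_le_pi_div_six (-1 / 12) (by ring) (by norm_num [abs_le]))
  · exact Polygon.isNiceCCW_of_hasDir spoke_one spoke_two innerHalf_edge_one outerHalf_edge_one
      (abs_le_pi_div_six (1 / 6) (by ring) (by norm_num))
      (abs_le_pi_div_six (-1 / 6) (by ring) (by norm_num))
      (abs_le_pi_div_six (1 / 6) (by ring) (by norm_num))
      (abs_le_pi_div_six (-1 / 6) (by ring) (by norm_num))
  · exact Polygon.isNiceCCW_of_hasDir spoke_two spoke_three innerHalf_edge_two outerHalf_edge_two
      (abs_le_pi_div_six (1 / 6) (by ring) (by norm_num))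
      (abs_le_pi_div_six 0 (by ring) (by norm_num))
      (abs_le_pi_div_six (1 / 12) (by ring) (by norm_num [abs_le]))
      (abs_le_pi_div_six (-1 / 12) (by ring) (by norm_num [abs_le]))

theorem fillable_outerHalf (hM : 0 < M) :
    Fillable (antiExtend (M + 3) (outerHalf M)) (2 * (M + 3)) (M + 2 + 2 * (M + 3)) := by
  refine (fillable_strip innerHalf_anti (fun i hi => innerHalf_rect hM hi)
    (innerHalf_cap hM)).ring (antiExtend_closed (by omega) innerHalf_anti)
    (antiExtend_closed (by omega) outerHalf_anti) fun i hi => ?_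
  exact forall_antiExtend (p := fun a b c d => (⟨![a, c, d, b]⟩ : Polygon ℂ 4).IsNiceCCW)
    innerHalf_anti outerHalf_anti (ring_nice hM) (fun _ _ _ _ h => h.neg) hi

theorem norm_outerHalf_le {i : ℕ} (hi : i < M + 3) : ‖outerHalf M i‖ ≤ 6 := by
  have hs : √3 ≤ 2 := by
    rw [Real.sqrt_le_left] <;> norm_num
  have hs0 := Real.sqrt_nonneg 3
  have key : ∀ x y : ℝ, |x| + |y| ≤ 6 → ‖(⟨x, y⟩ : ℂ)‖ ≤ 6 := fun x y h =>
    (Complex.norm_le_abs_re_add_abs_im _).trans h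
  refine forall_lt_add_three (p := fun i => ‖outerHalf M i‖ ≤ 6) (fun i hi => ?_) ?_ ?_ ?_ i hi
  · rw [outerHalf_of_le hi.le]
    apply key
    rw [abs_mul, abs_two, abs_of_nonneg (show (0 : ℝ) ≤ 2 + √3 by positivity)]
    linarith [abs_abscissa_le hi.le]
  · rw [outerHalf_of_le le_rfl]
    apply key
    rw [abs_mul, abs_two, abs_of_nonneg (show (0 : ℝ) ≤ 2 + √3 by positivity)]
    linarith [abs_abscissa_le (le_refl M)]
  · rw [outerHalf_one]
    apply key
    rw [abs_neg, abs_of_nonneg hs0]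
    norm_num
    linarith
  · rw [outerHalf_two]
    apply key
    rw [abs_neg, abs_neg, abs_of_nonneg hs0]
    norm_num
    linarith

theorem norm_antiExtend_outerHalf_le (i : ℕ) (hi : i ≤ 2 * (M + 3)) :
    ‖antiExtend (M + 3) (outerHalf M) i‖ ≤ 6 := by
  rcases hi.lt_or_eq with hi | rfl
  · rw [antiExtend]
    split_ifs with h
    · exact norm_outerHalf_le h
    · rw [norm_neg]
      exact norm_outerHalf_le (by omega)
  · rw [antiExtend_closed (by omega) outerHalf_anti, antiExtend, if_pos (by omega)]
    exact norm_outerHalf_le (by omega)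

end octagon

/-! ### Filling inscribed polygons -/

/-- Extend the arguments of half of a centrally symmetric polygon to the whole polygon. -/
noncomputable def shiftExtend (h : ℕ) (g : ℕ → ℝ) (i : ℕ) : ℝ :=
  if i < h then g i else g (i - h) + Real.pi

section shiftExtend

variable {h : ℕ} {g : ℕ → ℝ}

theorem shiftExtend_of_le (hg : g h = g 0 + Real.pi) {i : ℕ} (hi : i ≤ h) :
    shiftExtend h g i = g i := by
  rcases hi.lt_or_eq with hi | rfl
  · rw [shiftExtend, if_pos hi]
  · rw [shiftExtend, if_neg (lt_irrefl _), Nat.sub_self, hg]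

theorem shiftExtend_add (i : ℕ) : shiftExtend h g (h + i) = g i + Real.pi := by
  rw [shiftExtend, if_neg (by omega), Nat.add_sub_cancel_left]

end shiftExtend

/-- Arguments of the points opposite to the vertices of `outerHalf M` on a large circle. -/
noncomputable def halfAngle (M i : ℕ) : ℝ :=
  if i ≤ M then 3 * Real.pi / 8 + Real.pi / 4 * (i / M) else
    if i = M + 1 then 7 * Real.pi / 8 else
      if i = M + 2 then 9 * Real.pi / 8 else 11 * Real.pi / 8

section halfAngle

open Real

variable {M : ℕ}

theorem halfAngle_of_le {i : ℕ} (h : i ≤ M) : halfAngle M i = 3 * π / 8 + π / 4 * (i / M) := by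
  rw [halfAngle, if_pos h]

theorem halfAngle_last (hM : 0 < M) : halfAngle M M = 5 * π / 8 := by
  have : (M : ℝ) ≠ 0 := by positivity
  rw [halfAngle_of_le le_rfl, div_self this]
  ring

theorem halfAngle_one : halfAngle M (M + 1) = 7 * π / 8 := by simp [halfAngle]

theorem halfAngle_two : halfAngle M (M + 2) = 9 * π / 8 := by simp [halfAngle]

theorem halfAngle_three : halfAngle M (M + 3) = 11 * π / 8 := by simp [halfAngle]

theorem halfAngle_zero (M : ℕ) : halfAngle M 0 = 3 * π / 8 := by simp [halfAngle]

theorem halfAngle_anti : halfAngle M (M + 3) = halfAngle M 0 + π := by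
  rw [halfAngle_three, halfAngle_zero]
  ring

theorem halfAngle_gap (hM : 0 < M) : ∀ i < M + 3,
    halfAngle M i < halfAngle M (i + 1) ∧ halfAngle M (i + 1) - halfAngle M i ≤ π / 4 := by
  have hpi := pi_pos
  refine forall_lt_add_three (fun i hi => ?_) ?_ ?_ ?_
  · have hM' : (0 : ℝ) < M := by exact_mod_cast hM
    have h1 : (1 : ℝ) ≤ M := by exact_mod_cast hM
    have h2 : halfAngle M (i + 1) - halfAngle M i = π / 4 * (1 / M) := by
      rw [halfAngle_of_le hi.le, halfAngle_of_le hi]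
      push_cast
      ring
    have h3 : 0 < π / 4 * (1 / M) := by positivity
    have h4 : π / 4 * (1 / M) ≤ π / 4 * 1 := by
      gcongr
      rwa [div_le_one hM']
    constructor <;> linarith
  · rw [halfAngle_one, halfAngle_last hM]
    constructor <;> linarith
  · rw [halfAngle_one, show M + 1 + 1 = M + 2 from rfl, halfAngle_two]
    constructor <;> linarith
  · rw [halfAngle_two, show M + 2 + 1 = M + 3 from rfl, halfAngle_three]
    constructor <;> linarith

theorem halfAngle_mem {i : ℕ} (hi : i ≤ M) :
    3 * π / 8 ≤ halfAngle M i ∧ halfAngle M i ≤ 5 * π / 8 := by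
  have hpi := pi_pos
  rw [halfAngle_of_le hi]
  have h1 : (i / M : ℝ) ≤ 1 := div_le_one_of_le₀ (by exact_mod_cast hi) (Nat.cast_nonneg _)
  have h2 : (0 : ℝ) ≤ i / M := by positivity
  constructor <;> nlinarith

/-- The normals of an equiangular octagon are the midpoints of the eight arcs between the odd
multiples of `π / 8`, so the deviation is at most `π / 8 < 7π / 48`. -/
theorem outerHalf_edge_dir (hM : 0 < M) : ∀ i < M + 3,
    ∃ β, HasDir (outerHalf M (i + 1) - outerHalf M i) (β + π / 2) ∧
      |β - halfAngle M i| ≤ 7 * π / 48 ∧ |β - halfAngle M (i + 1)| ≤ 7 * π / 48 := by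
  have hpi := pi_pos
  refine forall_lt_add_three (fun i hi => ?_) ?_ ?_ ?_
  · have h1 := halfAngle_mem hi.le
    have h2 := halfAngle_mem (M := M) (i := i + 1) hi
    refine ⟨_, outerHalf_edge_top hM hi, ?_, ?_⟩ <;> rw [abs_le] <;> constructor <;> linarith
  · refine ⟨_, outerHalf_edge_zero hM, ?_, ?_⟩
    · rw [halfAngle_last hM, abs_le]
      constructor <;> linarith
    · rw [halfAngle_one, abs_le]
      constructor <;> linarith
  · refine ⟨_, outerHalf_edge_one, ?_, ?_⟩
    · rw [halfAngle_one, abs_le]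
      constructor <;> linarith
    · rw [show M + 1 + 1 = M + 2 from rfl, halfAngle_two, abs_le]
      constructor <;> linarith
  · refine ⟨_, outerHalf_edge_two, ?_, ?_⟩
    · rw [halfAngle_two, abs_le]
      constructor <;> linarith
    · rw [show M + 2 + 1 = M + 3 from rfl, halfAngle_three, abs_le]
      constructor <;> linarith

theorem fillable_halfAngle (hM : 0 < M) :
    Fillable (fun i => (300 : ℝ) * Complex.exp (shiftExtend (M + 3) (halfAngle M) i * Complex.I))
      (2 * (M + 3)) (M + 2 + 2 * (M + 3) + 2 * (M + 3)) ∧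
    shiftExtend (M + 3) (halfAngle M) (2 * (M + 3)) =
      shiftExtend (M + 3) (halfAngle M) 0 + 2 * π ∧
    ∀ i < 2 * (M + 3), shiftExtend (M + 3) (halfAngle M) i <
        shiftExtend (M + 3) (halfAngle M) (i + 1) ∧
      shiftExtend (M + 3) (halfAngle M) (i + 1) - shiftExtend (M + 3) (halfAngle M) i ≤ π / 4 := by
  have hg := halfAngle_anti (M := M)
  have hf := outerHalf_anti (M := M)
  have hper : shiftExtend (M + 3) (halfAngle M) (2 * (M + 3)) =
      shiftExtend (M + 3) (halfAngle M) 0 + 2 * π := by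
    rw [two_mul, shiftExtend_add, hg, shiftExtend_of_le hg (Nat.zero_le _)]
    ring
  have hgap : ∀ i < 2 * (M + 3), shiftExtend (M + 3) (halfAngle M) i <
        shiftExtend (M + 3) (halfAngle M) (i + 1) ∧
      shiftExtend (M + 3) (halfAngle M) (i + 1) - shiftExtend (M + 3) (halfAngle M) i ≤
        π / 4 := by
    intro i hi
    rcases lt_or_ge i (M + 3) with hi' | hi'
    · rw [shiftExtend_of_le hg hi'.le, shiftExtend_of_le hg hi']
      exact halfAngle_gap hM i hi'
    · obtain ⟨j, rfl⟩ := Nat.exists_eq_add_of_le hi'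
      rw [add_assoc (M + 3) j 1, shiftExtend_add, shiftExtend_add]
      have := halfAngle_gap hM j (by omega)
      constructor <;> linarith
  -- The radius 300 is 50 times the bound 6 for the octagon.
  refine ⟨(fillable_outerHalf hM).circle (antiExtend_closed (by omega) hf) hper (by norm_num)
    hgap (fun i hi => (norm_antiExtend_outerHalf_le i hi).trans (by norm_num)) fun i hi => ?_,
    hper, hgap⟩
  rcases lt_or_ge i (M + 3) with hi' | hi'
  · rw [shiftExtend_of_le hg hi'.le, shiftExtend_of_le hg hi', antiExtend_of_le hf hi'.le,
      antiExtend_of_le hf hi']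
    exact outerHalf_edge_dir hM i hi'
  · obtain ⟨j, rfl⟩ := Nat.exists_eq_add_of_le hi'
    rw [add_assoc (M + 3) j 1, shiftExtend_add, shiftExtend_add, antiExtend_add, antiExtend_add]
    obtain ⟨β, h1, h2, h3⟩ := outerHalf_edge_dir hM j (by omega)
    refine ⟨β + π, h1.neg.congr (by ring) (by ring), ?_, ?_⟩
    · rwa [add_sub_add_right_eq_sub]
    · rwa [add_sub_add_right_eq_sub]

theorem mem_Icc_of_forall_lt_succ {θ : ℕ → ℝ} {N : ℕ} (h : ∀ i < N, θ i < θ (i + 1)) :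
    ∀ i ≤ N, θ 0 ≤ θ i ∧ θ i ≤ θ N := by
  have key : ∀ i j, i ≤ j → j ≤ N → θ i ≤ θ j := by
    intro i j hij
    induction j, hij using Nat.le_induction with
    | base => intro _; exact le_rfl
    | succ j _ ih => exact fun hj => (ih (by omega)).trans (h j hj).le
  exact fun i hi => ⟨key 0 i (Nat.zero_le _) hi, key i N hi le_rfl⟩

/-- A polygon inscribed in the unit circle with an even number of vertices and small gaps can be
filled with nice quadrilaterals. -/
theorem fillable_unit_circle {N : ℕ} (hN : Even N) (hN8 : 8 ≤ N) {θ : ℕ → ℝ}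
    (hθ : θ N = θ 0 + 2 * π) (hgap : ∀ i < N, θ i < θ (i + 1) ∧ θ (i + 1) - θ i ≤ π / 4) :
    Fillable (fun i => Complex.exp (θ i * Complex.I)) N (99 * N) := by
  obtain ⟨k, hk⟩ := hN
  obtain ⟨M, rfl⟩ : ∃ M, k = M + 3 := ⟨k - 3, by omega⟩
  rw [← two_mul] at hk
  subst hk
  have hM : 0 < M := by omega
  obtain ⟨h1, h2, h3⟩ := fillable_halfAngle hM
  set ψ := shiftExtend (M + 3) (halfAngle M) with hψ
  -- Rotating by `a` makes both sequences start together. Both then stay within one turn, so they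
  -- differ by at most `2π = 96 * (π / 48)`; the rotation is undone at the end, together with the
  -- scaling.
  set a : ℝ := ψ 0 - θ 0 with ha
  have hbd := mem_Icc_of_forall_lt_succ fun i hi => (hgap i hi).1
  have hbd' := mem_Icc_of_forall_lt_succ fun i hi => (h3 i hi).1
  obtain ⟨S, hS, hfill⟩ := h1.interpolate (θ := fun i => θ i + a) (by norm_num) h2
    (by simp only [hθ]; ring) h3
    (fun i hi => by
      have := hgap i hi
      constructor <;> linarith) (R := 96) (fun i hi => by
      have b1 := hbd i hi
      have b2 := hbd' i hi
      rw [abs_le]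
      push_cast
      constructor <;> linarith)
  have hne : ((S : ℂ) * Complex.exp (a * Complex.I))⁻¹ ≠ 0 :=
    inv_ne_zero (mul_ne_zero (by exact_mod_cast hS.ne') (Complex.exp_ne_zero _))
  have := hfill.similar 0 hne
  refine Fillable.mono (m := M + 2 + 2 * (M + 3) + 2 * (M + 3) + 96 * (2 * (M + 3))) ?_ (by omega)
  convert this using 2 with i
  rw [zero_add]
  push_cast
  rw [add_mul, Complex.exp_add]
  have : (S : ℂ) ≠ 0 := by exact_mod_cast hS.ne'
  have := Complex.exp_ne_zero (a * Complex.I)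
  field_simp

/-- Fill a polygon whose edges are roughly orthogonal to the rays from the origin. -/
theorem fillable_radial {N : ℕ} (hN : Even N) (hN8 : 8 ≤ N) {θ ρ : ℕ → ℝ} {u : ℕ → ℂ} {s : ℝ}
    (hθ : θ N = θ 0 + 2 * π) (hgap : ∀ i < N, θ i < θ (i + 1) ∧ θ (i + 1) - θ i ≤ π / 4)
    (hs : 0 < s) (hρ : ∀ i ≤ N, s < ρ i)
    (hu : ∀ i ≤ N, u i = ρ i * Complex.exp (θ i * Complex.I)) (hclosed : u N = u 0)
    (hdir : ∀ i < N, ∃ β, HasDir (u (i + 1) - u i) (β + π / 2) ∧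
      |β - θ i| ≤ π / 6 ∧ |β - θ (i + 1)| ≤ π / 6) : Fillable u N (100 * N) := by
  have hpi := pi_pos
  have h1 := (fillable_unit_circle hN hN8 hθ hgap).similar 0 (a := s) (by exact_mod_cast hs.ne')
  simp only [zero_add] at h1
  rw [show 100 * N = 99 * N + N by ring]
  refine h1.ring (by rw [hθ, exp_add_two_pi_mul_I]) hclosed fun i hi => ?_
  obtain ⟨β, d1, d2, d3⟩ := hdir i hi
  obtain ⟨g1, g2⟩ := hgap i hi
  have hsp : ∀ j ≤ N, HasDir (u j - s * Complex.exp (θ j * Complex.I)) (θ j) := fun j hj => by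
    refine (HasDir.exp_mul (θ j) (sub_pos.2 (hρ j hj))).congr ?_ rfl
    rw [hu j hj]
    push_cast
    ring
  refine Polygon.isNiceCCW_of_hasDir (hsp i hi.le) (hsp (i + 1) hi)
    (exp_sub_exp_hasDir hs g1 (by linarith)) d1 ?_ ?_ d2 d3 <;> rw [abs_le] <;>
    constructor <;> linarith

end halfAngle

/-! ### Cyclic polygons -/

/-- A strictly increasing sequence of arguments that closes up after one turn, in steps of at most
`45°`. -/
structure IsAngleSequence (A : ℕ → ℝ) (n : ℕ) : Prop where
  closed : A n = A 0 + 2 * Real.pi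
  gap : ∀ i < n, A i < A (i + 1) ∧ A (i + 1) - A i ≤ Real.pi / 4

/-- The point with argument `τ` on the line through the points with arguments `a`, `b` of the
circle of radius `r`. -/
noncomputable def chordPoint (r a b τ : ℝ) : ℂ :=
  ((r * Real.cos ((b - a) / 2) / Real.cos (τ - (a + b) / 2) : ℝ) : ℂ) * Complex.exp (τ * Complex.I)

open Real

/-! ### Points of a chord parametrised by argument -/

section chord

variable {r a b τ τ' : ℝ}

theorem cos_chord_pos (hab : b - a ≤ π / 4) (h1 : a ≤ τ) (h2 : τ ≤ b) :
    0 < cos (τ - (a + b) / 2) := by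
  have := pi_pos
  exact cos_pos_of_mem_Ioo ⟨by linarith, by linarith⟩

theorem half_lt_cos_chord (hab0 : a ≤ b) (hab : b - a ≤ π / 4) : 1 / 2 < cos ((b - a) / 2) := by
  have := pi_pos
  rw [← cos_pi_div_three]
  exact cos_lt_cos_of_nonneg_of_le_pi (by linarith) (by linarith) (by linarith)

theorem chordPoint_left (h : cos ((b - a) / 2) ≠ 0) :
    chordPoint r a b a = r * Complex.exp (a * Complex.I) := by
  rw [chordPoint, show a - (a + b) / 2 = -((b - a) / 2) by ring, cos_neg, mul_div_cancel_right₀ _ h]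

theorem chordPoint_right (h : cos ((b - a) / 2) ≠ 0) :
    chordPoint r a b b = r * Complex.exp (b * Complex.I) := by
  rw [chordPoint, show b - (a + b) / 2 = (b - a) / 2 by ring, mul_div_cancel_right₀ _ h]

/-- After rotation by the mean argument the chord lies on a vertical line, where height is
proportional to the tangent of the argument. Hence the tangent is an affine parameter on the chord.
-/
theorem chordPoint_eq (h : cos (τ - (a + b) / 2) ≠ 0) :
    chordPoint r a b τ = ((r * cos ((b - a) / 2) : ℝ) : ℂ) *
      (1 + tan (τ - (a + b) / 2) * Complex.I) * Complex.exp (((a + b) / 2 : ℝ) * Complex.I) := by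
  have h1 : Complex.exp (τ * Complex.I) = Complex.exp (((τ - (a + b) / 2 : ℝ) : ℂ) * Complex.I) *
      Complex.exp (((a + b) / 2 : ℝ) * Complex.I) := by
    rw [← Complex.exp_add]
    congr 1
    push_cast
    ring
  have h2 : ((cos (τ - (a + b) / 2) : ℝ) : ℂ) ≠ 0 := by exact_mod_cast h
  rw [chordPoint, h1, Complex.exp_mul_I, ← Complex.ofReal_cos, ← Complex.ofReal_sin, ← mul_assoc,
    tan_eq_sin_div_cos]
  congr 1
  push_cast at h2 ⊢
  generalize Complex.cos ((τ : ℂ) - (a + b) / 2) = z at h2 ⊢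
  field_simp

theorem chordPoint_sub (h : cos (τ - (a + b) / 2) ≠ 0) (h' : cos (τ' - (a + b) / 2) ≠ 0) :
    chordPoint r a b τ' - chordPoint r a b τ =
      ((r * cos ((b - a) / 2) * (tan (τ' - (a + b) / 2) - tan (τ - (a + b) / 2)) : ℝ) : ℂ) *
        Complex.exp (((a + b) / 2 + π / 2 : ℝ) * Complex.I) := by
  have h1 : Complex.exp (((a + b) / 2 + π / 2 : ℝ) * Complex.I) =
      Complex.I * Complex.exp (((a + b) / 2 : ℝ) * Complex.I) := by
    rw [Complex.ofReal_add, add_mul, Complex.exp_add, mul_comm]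
    congr 1
    rw [Complex.ofReal_div, Complex.ofReal_ofNat, Complex.exp_pi_div_two_mul_I]
  rw [chordPoint_eq h, chordPoint_eq h', h1]
  push_cast
  ring

theorem tan_chord_lt (hab : b - a ≤ π / 4) (h1 : a ≤ τ) (h2 : τ < τ') (h3 : τ' ≤ b) :
    tan (τ - (a + b) / 2) < tan (τ' - (a + b) / 2) := by
  have := pi_pos
  exact tan_lt_tan_of_lt_of_lt_pi_div_two (by linarith) (by linarith) (by linarith)

theorem chordPoint_sub_eq_smul (hab : b - a ≤ π / 4) {σ σ' : ℝ} (h1 : a ≤ τ)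
    (h2 : τ < τ') (h3 : τ' ≤ b) (h4 : a ≤ σ) (h5 : σ < σ') (h6 : σ' ≤ b) :
    ∃ t : ℝ, 0 < t ∧ chordPoint r a b τ' - chordPoint r a b τ =
      t * (chordPoint r a b σ' - chordPoint r a b σ) := by
  have t1 := tan_chord_lt hab h1 h2 h3
  have t2 := tan_chord_lt hab h4 h5 h6
  refine ⟨(tan (τ' - (a + b) / 2) - tan (τ - (a + b) / 2)) /
    (tan (σ' - (a + b) / 2) - tan (σ - (a + b) / 2)), div_pos (by linarith) (by linarith), ?_⟩
  have hne : ((tan (σ' - (a + b) / 2) - tan (σ - (a + b) / 2) : ℝ) : ℂ) ≠ 0 := by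
    exact_mod_cast (sub_pos.2 t2).ne'
  rw [chordPoint_sub (cos_chord_pos hab h1 (by linarith)).ne'
    (cos_chord_pos hab (by linarith) h3).ne', chordPoint_sub (cos_chord_pos hab h4 (by linarith)).ne'
    (cos_chord_pos hab (by linarith) h6).ne', Complex.ofReal_mul, Complex.ofReal_mul (_ * _),
    Complex.ofReal_div]
  generalize ((tan (σ' - (a + b) / 2) - tan (σ - (a + b) / 2) : ℝ) : ℂ) = z at hne ⊢
  field_simp

theorem chordPoint_hasDir (hr : 0 < r) (hab : b - a ≤ π / 4) (h1 : a ≤ τ)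
    (h2 : τ < τ') (h3 : τ' ≤ b) :
    HasDir (chordPoint r a b τ' - chordPoint r a b τ) ((a + b) / 2 + π / 2) := by
  rw [chordPoint_sub (cos_chord_pos hab h1 (by linarith)).ne'
    (cos_chord_pos hab (by linarith) h3).ne']
  apply HasDir.exp_mul
  have t1 := tan_chord_lt hab h1 h2 h3
  have t2 := half_lt_cos_chord (a := a) (b := b) (by linarith) hab
  exact mul_pos (mul_pos hr (by linarith)) (by linarith)

theorem mem_segment_chordPoint (hab : b - a ≤ π / 4) {σ : ℝ} (h1 : a ≤ τ)
    (h2 : τ < τ') (h3 : τ' ≤ b) (h4 : τ ≤ σ) (h5 : σ ≤ τ') :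
    chordPoint r a b σ ∈ segment ℝ (chordPoint r a b τ) (chordPoint r a b τ') := by
  have t1 := tan_chord_lt hab h1 h2 h3
  have hmono : ∀ {x y : ℝ}, a ≤ x → x ≤ y → y ≤ b →
      tan (x - (a + b) / 2) ≤ tan (y - (a + b) / 2) := fun {x y} hx hxy hy => by
    rcases hxy.lt_or_eq with hxy | rfl
    · exact (tan_chord_lt hab hx hxy hy).le
    · exact le_rfl
  have t2 := hmono h1 h4 (h5.trans h3)
  have t3 := hmono (h1.trans h4) h5 h3
  have hpos := sub_pos.2 t1
  set t := (tan (σ - (a + b) / 2) - tan (τ - (a + b) / 2)) /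
    (tan (τ' - (a + b) / 2) - tan (τ - (a + b) / 2)) with ht
  have ht' : t * (tan (τ' - (a + b) / 2) - tan (τ - (a + b) / 2)) =
    tan (σ - (a + b) / 2) - tan (τ - (a + b) / 2) := div_mul_cancel₀ _ hpos.ne'
  refine ⟨1 - t, t, ?_, div_nonneg (by linarith) hpos.le, by ring, ?_⟩
  · rw [sub_nonneg, ht, div_le_one hpos]
    linarith
  · have c1 := cos_chord_pos hab h1 (h2.le.trans h3)
    have c2 := cos_chord_pos hab (h1.trans h2.le) h3
    have c3 := cos_chord_pos hab (h1.trans h4) (h5.trans h3)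
    have e1 : chordPoint r a b σ - chordPoint r a b τ =
        t * (chordPoint r a b τ' - chordPoint r a b τ) := by
      rw [chordPoint_sub c1.ne' c3.ne', chordPoint_sub c1.ne' c2.ne', ← mul_assoc,
        ← Complex.ofReal_mul, ← ht']
      congr 2
      ring
    rw [Complex.real_smul, Complex.real_smul]
    push_cast
    linear_combination -e1

theorem exists_chordPoint_of_mem_segment (hab0 : a < b) (hab : b - a ≤ π / 4) {x : ℂ}
    (hx : x ∈ segment ℝ (r * Complex.exp (a * Complex.I)) (r * Complex.exp (b * Complex.I))) :
    ∃ τ, a ≤ τ ∧ τ ≤ b ∧ x = chordPoint r a b τ := by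
  have hpi := pi_pos
  obtain ⟨s, t, hs, ht, hst, rfl⟩ := hx
  have hc := half_lt_cos_chord hab0.le hab
  have hT : 0 ≤ tan ((b - a) / 2) := tan_nonneg_of_nonneg_of_le_pi_div_two (by linarith)
    (by linarith)
  have harc : arctan (tan ((b - a) / 2)) = (b - a) / 2 :=
    arctan_tan (by linarith) (by linarith)
  have h1 : arctan ((t - s) * tan ((b - a) / 2)) ≤ (b - a) / 2 := by
    rw [← harc]
    apply arctan_mono
    rw [harc]
    nlinarith
  have h2 : -((b - a) / 2) ≤ arctan ((t - s) * tan ((b - a) / 2)) := by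
    rw [← harc, ← arctan_neg]
    apply arctan_mono
    rw [harc]
    nlinarith
  refine ⟨(a + b) / 2 + arctan ((t - s) * tan ((b - a) / 2)), by linarith, by linarith, ?_⟩
  have hb : ((b - a) / 2) = b - (a + b) / 2 := by ring
  have ha : a - (a + b) / 2 = -((b - a) / 2) := by ring
  have hτ : (a + b) / 2 + arctan ((t - s) * tan ((b - a) / 2)) - (a + b) / 2 =
    arctan ((t - s) * tan ((b - a) / 2)) := by ring
  rw [← chordPoint_left (r := r) (b := b) (a := a) (by linarith),
    ← chordPoint_right (r := r) (b := b) (a := a) (by linarith)]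
  rw [chordPoint_eq (τ := a) (by rw [ha, cos_neg]; linarith),
    chordPoint_eq (τ := b) (by rw [← hb]; linarith),
    chordPoint_eq (by rw [hτ]; exact (cos_arctan_pos _).ne'), hτ, tan_arctan, ha, tan_neg, ← hb,
    Complex.real_smul, Complex.real_smul]
  obtain rfl : s = 1 - t := by linarith
  push_cast
  ring

end chord

/-- The vertices of `P` are the points with arguments `A 0, …, A (n - 1)` on a circle. -/
structure IsInscribed {n : ℕ} (P : Polygon ℂ n) (c : ℂ) (r : ℝ) (A : ℕ → ℝ) : Prop where
  seq : IsAngleSequence A n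
  pos : 0 < r
  vertex : ∀ i : Fin n, P i = c + r * Complex.exp (A i * Complex.I)

theorem Polygon.IsCyclicTuple.exists_isInscribed {n : ℕ} {P : Polygon ℂ n} {c : ℂ} {r : ℝ}
    (h : P.IsCyclicTuple c r (π / 4)) : ∃ A, IsInscribed P c r A := by
  obtain ⟨hr, α, hmono, hlast, hgap, hv⟩ := h
  -- Indices beyond `n` repeat the last argument; only those up to `n` matter.
  refine ⟨fun k => α ⟨min k n, by omega⟩, ⟨?_, fun i hi => ?_⟩, hr, fun i => ?_⟩
  · simpa [Fin.last] using hlast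
  · have h1 : (⟨min i n, by omega⟩ : Fin (n + 1)) = Fin.castSucc ⟨i, hi⟩ := by
      simp [hi.le]
    have h2 : (⟨min (i + 1) n, by omega⟩ : Fin (n + 1)) = Fin.succ ⟨i, hi⟩ := by
      simp [Fin.ext_iff]
      omega
    rw [h1, h2]
    exact ⟨hmono (Fin.castSucc_lt_succ), hgap _⟩
  · have h1 : (⟨min i n, by omega⟩ : Fin (n + 1)) = Fin.castSucc i := by
      simp [Fin.ext_iff, i.2.le]
    rw [hv i, h1]

theorem IsAngleSequence.eight_le {A : ℕ → ℝ} {n : ℕ} (h : IsAngleSequence A n) : 8 ≤ n := by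
  have hpi := pi_pos
  have h1 : A n - A 0 ≤ n * (π / 4) := by
    rw [← Finset.sum_range_sub]
    refine (Finset.sum_le_sum (fun i hi => (h.gap i (Finset.mem_range.1 hi)).2)).trans ?_
    simp
  rw [h.closed] at h1
  by_contra! hn
  have : (n : ℝ) ≤ 7 := by exact_mod_cast (by omega : n ≤ 7)
  nlinarith

theorem IsAngleSequence.mono {A : ℕ → ℝ} {n : ℕ} (h : IsAngleSequence A n) {i j : ℕ}
    (hij : i ≤ j) (hj : j ≤ n) : A i ≤ A j := by
  induction j, hij using Nat.le_induction with
  | base => exact le_rfl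
  | succ j _ ih => exact (ih (by omega)).trans (h.gap j hj).1.le

theorem exists_between_succ {A : ℕ → ℝ} {n : ℕ} {τ : ℝ}
    (h0 : A 0 ≤ τ) (h1 : τ < A n) : ∃ i < n, A i ≤ τ ∧ τ < A (i + 1) := by
  by_contra! hcon
  have : ∀ i ≤ n, A i ≤ τ := by
    intro i
    induction i with
    | zero => exact fun _ => h0
    | succ i ih => exact fun hi => hcon i hi (ih (by omega))
  exact (this n le_rfl).not_gt h1

theorem IsAngleSequence.eq_of_between {A : ℕ → ℝ} {n : ℕ} (h : IsAngleSequence A n) {τ : ℝ}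
    {i j : ℕ} (hi : i < n) (hj : j < n) (h1 : A i ≤ τ) (h2 : τ < A (i + 1)) (h3 : A j ≤ τ)
    (h4 : τ < A (j + 1)) : i = j := by
  rcases lt_trichotomy i j with hij | hij | hij
  · have := h.mono hij hj.le
    linarith
  · exact hij
  · have := h.mono hij hi.le
    linarith

namespace IsInscribed

variable {n : ℕ} {P : Polygon ℂ n} {c : ℂ} {r : ℝ} {A : ℕ → ℝ}

theorem next (h : IsInscribed P c r A) (i : Fin n) :
    P (finRotate n i) = c + r * Complex.exp (A (i + 1) * Complex.I) := by
  rw [h.vertex]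
  have h8 := h.seq.eight_le
  obtain ⟨m, rfl⟩ : ∃ m, n = m + 1 := ⟨n - 1, by omega⟩
  by_cases hi : (i : ℕ) = m
  · have : finRotate (m + 1) i = 0 := by
      rw [finRotate_apply, Fin.ext_iff, Fin.val_add]
      simp [hi]
    rw [this, hi, h.seq.closed, exp_add_two_pi_mul_I]
    rfl
  · have : (finRotate (m + 1) i : ℕ) = i + 1 := by
      rw [finRotate_apply, Fin.val_add_one_of_lt]
      rw [Fin.lt_def, Fin.val_last]
      omega
    rw [this]

/-- The first factor is the length of the chord, the second the signed distance to its line. -/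
theorem side_polar (h : IsInscribed P c r A) (i : Fin n) (ρ τ : ℝ) :
    P.side i (c + ρ * Complex.exp (τ * Complex.I)) = 2 * r * sin ((A (i + 1) - A i) / 2) *
      (r * cos ((A (i + 1) - A i) / 2) - ρ * cos (τ - (A i + A (i + 1)) / 2)) := by
  rw [Polygon.side, h.next, h.vertex]
  generalize A (i + 1) = b
  generalize A i = a
  have e1 : cross (c + r * Complex.exp (b * Complex.I) - (c + r * Complex.exp (a * Complex.I)))
      (c + ρ * Complex.exp (τ * Complex.I) - (c + r * Complex.exp (a * Complex.I))) =
      r * (r * sin (b - a) - ρ * (sin (τ - a) - sin (τ - b))) := by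
    simp only [cross, Complex.sub_re, Complex.sub_im, Complex.add_re, Complex.add_im,
      Complex.re_ofReal_mul, Complex.im_ofReal_mul, Complex.exp_ofReal_mul_I_re,
      Complex.exp_ofReal_mul_I_im, sin_sub]
    ring
  rw [e1, sin_sub_sin, show b - a = 2 * ((b - a) / 2) by ring, sin_two_mul,
    show (τ - a - (τ - b)) / 2 = (b - a) / 2 by ring,
    show (τ - a + (τ - b)) / 2 = τ - (a + b) / 2 by ring,
    show 2 * ((b - a) / 2) / 2 = (b - a) / 2 by ring]
  ring

theorem sin_gap_pos (h : IsInscribed P c r A) (i : Fin n) : 0 < sin ((A (i + 1) - A i) / 2) := by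
  have hpi := pi_pos
  obtain ⟨h1, h2⟩ := h.seq.gap i i.2
  exact sin_pos_of_pos_of_lt_pi (by linarith) (by linarith)

theorem cos_gap (h : IsInscribed P c r A) (i : Fin n) : 1 / 2 < cos ((A (i + 1) - A i) / 2) := by
  obtain ⟨h1, h2⟩ := h.seq.gap i i.2
  exact half_lt_cos_chord h1.le h2

theorem isStrictlyConvex (h : IsInscribed P c r A) : P.IsStrictlyConvex := by
  have hpi := pi_pos
  have h8 := h.seq.eight_le
  refine ⟨by omega, fun i j hji hjn => ?_⟩
  have hr := h.pos
  rw [h.vertex j, h.side_polar]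
  have hs := h.sin_gap_pos i
  obtain ⟨g1, g2⟩ := h.seq.gap i i.2
  have hcl := h.seq.closed
  have key : cos (A j - (A i + A (i + 1)) / 2) < cos ((A (i + 1) - A i) / 2) := by
    rw [← sub_neg, cos_sub_cos]
    have hne : (j : ℕ) ≠ i := fun e => hji (Fin.ext e)
    have hz : ∀ x y : ℝ, 0 < sin x * sin y → -2 * sin x * sin y < 0 := fun x y h => by linarith
    -- The two half-differences of arguments lie both in `(-π, 0)` or both in `(0, π)`, so their
    -- sines have the same sign.
    apply hz
    rcases lt_or_gt_of_ne hne with hlt | hgt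
    · have b1 : A j < A i := (h.seq.gap j j.2).1.trans_le (h.seq.mono hlt i.2.le)
      have b2 : A (i + 1) - A j < 2 * π := by
        rcases Nat.eq_zero_or_pos (j : ℕ) with hj0 | hj0
        · have : (i : ℕ) + 1 < n := by
            by_contra hcon
            have hin : (i : ℕ) + 1 = n := by have := i.2; omega
            apply hjn
            obtain ⟨m, rfl⟩ : ∃ m, n = m + 1 := ⟨n - 1, by omega⟩
            rw [finRotate_apply, Fin.ext_iff, Fin.val_add, hj0]
            simp [hin]
          have b3 := (h.seq.gap (i + 1) this).1.trans_le (h.seq.mono this le_rfl)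
          rw [hj0]
          linarith
        · have b3 := (h.seq.gap 0 (by omega)).1.trans_le (h.seq.mono hj0 j.2.le)
          have b4 := h.seq.mono (show (i : ℕ) + 1 ≤ n from i.2) le_rfl
          linarith
      rw [← neg_mul_neg, ← sin_neg, ← sin_neg]
      exact mul_pos (sin_pos_of_pos_of_lt_pi (by linarith) (by linarith))
        (sin_pos_of_pos_of_lt_pi (by linarith) (by linarith))
    · have hgt' : (i : ℕ) + 1 < j := by
        rcases Nat.lt_or_ge (i + 1) j with h | h
        · exact h
        · exfalso
          have hij : (j : ℕ) = i + 1 := by omega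
          apply hjn
          obtain ⟨m, rfl⟩ : ∃ m, n = m + 1 := ⟨n - 1, by omega⟩
          rw [finRotate_apply, Fin.ext_iff, Fin.val_add_one_of_lt, hij]
          rw [Fin.lt_def, Fin.val_last]
          have := j.2
          omega
      have b1 : A (i + 1) < A j :=
        (h.seq.gap (i + 1) (by omega)).1.trans_le (h.seq.mono hgt' j.2.le)
      have b2 : A j < A n := (h.seq.gap j j.2).1.trans_le (h.seq.mono j.2 le_rfl)
      have b3 := h.seq.mono (Nat.zero_le i) i.2.le
      exact mul_pos (sin_pos_of_pos_of_lt_pi (by linarith) (by linarith))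
        (sin_pos_of_pos_of_lt_pi (by linarith) (by linarith))
  have := mul_pos hr (sub_pos.2 key)
  refine mul_pos (by positivity) (by linarith)

theorem center_mem_interior (h : IsInscribed P c r A) : c ∈ interior P.hull := by
  rw [h.isStrictlyConvex.interior_hull]
  intro i
  have h1 := h.side_polar i 0 0
  rw [Complex.ofReal_zero, zero_mul, add_zero, zero_mul, sub_zero] at h1
  rw [h1]
  have := h.pos
  have := h.sin_gap_pos i
  have := h.cos_gap i
  positivity

/-- Every boundary point is a point with an argument in the range of its edge. -/
theorem exists_chordPoint (h : IsInscribed P c r A) {x : ℂ} (hx : x ∈ P.boundary ℝ) :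
    ∃ i < n, ∃ τ, A i ≤ τ ∧ τ < A (i + 1) ∧ x = c + chordPoint r (A i) (A (i + 1)) τ := by
  obtain ⟨i, hi⟩ := Set.mem_iUnion.1 hx
  rw [Polygon.edgeSet, affineSegment_eq_segment, h.next, h.vertex, segment_eq_image'] at hi
  obtain ⟨g1, g2⟩ := h.seq.gap i i.2
  have hx' : x - c ∈ segment ℝ (r * Complex.exp (A i * Complex.I))
      (r * Complex.exp (A (i + 1) * Complex.I)) := by
    rw [segment_eq_image']
    obtain ⟨t, ht, rfl⟩ := hi
    refine ⟨t, ht, ?_⟩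
    simp only [Complex.real_smul]
    ring
  obtain ⟨τ, t1, t2, t3⟩ := exists_chordPoint_of_mem_segment g1 g2 hx'
  -- The ranges of arguments are half-open: the end of an edge is assigned to the next edge,
  -- cyclically.
  rcases t2.lt_or_eq with t2 | t2
  · exact ⟨i, i.2, τ, t1, t2, by rw [← t3]; ring⟩
  · have hc := h.cos_gap i
    rw [t2, chordPoint_right (by linarith)] at t3
    have hx : x = c + r * Complex.exp (A (i + 1) * Complex.I) := by
      rw [← t3]
      ring
    rcases Nat.lt_or_ge (i + 1) n with hin | hin
    · refine ⟨i + 1, hin, A (i + 1), le_rfl, (h.seq.gap _ hin).1, ?_⟩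
      have := h.cos_gap ⟨i + 1, hin⟩
      simp only at this
      rw [chordPoint_left (by linarith), hx]
    · have hin' : (i : ℕ) + 1 = n := by have := i.2; omega
      have hn0 : 0 < n := by omega
      refine ⟨0, hn0, A 0, le_rfl, (h.seq.gap _ hn0).1, ?_⟩
      have := h.cos_gap ⟨0, hn0⟩
      simp only at this
      rw [chordPoint_left (by linarith), hx, hin', h.seq.closed, exp_add_two_pi_mul_I]

end IsInscribed

/-- The points `u 0, …, u (N - 1)` of the boundary of an inscribed polygon `P` include the vertices
and are listed by increasing arguments `θ`. -/
structure IsSortedBoundary {n : ℕ} (P : Polygon ℂ n) (c : ℂ) (r : ℝ) (A : ℕ → ℝ) (u : ℕ → ℂ)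
    (θ : ℕ → ℝ) (N : ℕ) : Prop where
  inscribed : IsInscribed P c r A
  closed : u N = u 0
  angle_zero : θ 0 = A 0
  angle_closed : θ N = θ 0 + 2 * π
  mono : ∀ k < N, θ k < θ (k + 1)
  edge : ∀ k < N, ∃ i < n, A i ≤ θ k ∧ θ (k + 1) ≤ A (i + 1) ∧
    u k = c + chordPoint r (A i) (A (i + 1)) (θ k) ∧
    u (k + 1) = c + chordPoint r (A i) (A (i + 1)) (θ (k + 1))

theorem eq_of_exp_eq {x y a : ℝ} (hx : a ≤ x) (hx' : x < a + 2 * π) (hy : a ≤ y)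
    (hy' : y < a + 2 * π) {ρ σ : ℝ} (hρ : 0 < ρ) (hσ : 0 < σ)
    (h : ρ * Complex.exp (x * Complex.I) = σ * Complex.exp (y * Complex.I)) : x = y := by
  have hn : ρ = σ := by
    have := congrArg norm h
    rwa [norm_mul, norm_mul, Complex.norm_exp_ofReal_mul_I, Complex.norm_exp_ofReal_mul_I,
      Complex.norm_real, Complex.norm_real, Real.norm_of_nonneg hρ.le, Real.norm_of_nonneg hσ.le,
      mul_one, mul_one] at this
  rw [hn] at h
  have h2 := mul_left_cancel₀ (by exact_mod_cast hσ.ne') h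
  obtain ⟨k, hk⟩ := Complex.exp_eq_exp_iff_exists_int.1 h2
  have hk' : x = y + k * (2 * π) := by
    have := congrArg Complex.im hk
    simpa using this
  have hpi := pi_pos
  have k1 : (k : ℝ) < 1 := by
    by_contra! hle
    nlinarith
  have k2 : (-1 : ℝ) < k := by
    by_contra! hle
    nlinarith
  have k3 : k = 0 := by
    have : k < 1 := by exact_mod_cast k1
    have : -1 < k := by exact_mod_cast k2
    omega
  rw [hk', k3]
  simp

/-! ### Sorting the vertices on the boundary by argument -/

namespace IsInscribed

variable {n : ℕ} {P : Polygon ℂ n} {c : ℂ} {r : ℝ} {A : ℕ → ℝ}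

theorem chordPoint_start (h : IsInscribed P c r A) {i : ℕ} (hi : i < n) :
    chordPoint r (A i) (A (i + 1)) (A i) = r * Complex.exp (A i * Complex.I) := by
  have := h.cos_gap ⟨i, hi⟩
  simp only at this
  exact chordPoint_left (by linarith)

theorem chordPoint_end (h : IsInscribed P c r A) {i : ℕ} (hi : i < n) :
    chordPoint r (A i) (A (i + 1)) (A (i + 1)) = r * Complex.exp (A (i + 1) * Complex.I) := by
  have := h.cos_gap ⟨i, hi⟩
  simp only at this
  exact chordPoint_right (by linarith)

theorem exists_sortedBoundary (h : IsInscribed P c r A) (V : Finset ℂ)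
    (hV : (V : Set ℂ) ⊆ P.boundary ℝ) (hP : ∀ i, P i ∈ V) :
    ∃ u θ, IsSortedBoundary P c r A u θ V.card ∧ u '' Set.Iio V.card = V ∧
      ∀ k, V.card ≤ k → u k = u 0 := by
  classical
  have hn8 := h.seq.eight_le
  have hcl := h.seq.closed
  choose! I hI T hT1 hT2 hT3 using fun x (hx : x ∈ P.boundary ℝ) => h.exists_chordPoint hx
  have hT0 : ∀ v ∈ V, A 0 ≤ T v ∧ T v < A n := fun v hv =>
    ⟨(h.seq.mono (Nat.zero_le _) (hI v (hV hv)).le).trans (hT1 v (hV hv)),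
      (hT2 v (hV hv)).trans_le (h.seq.mono (hI v (hV hv)) le_rfl)⟩
  have hinj : Set.InjOn T V := fun v hv w hw hvw => by
    have hIe : I v = I w := h.seq.eq_of_between (hI v (hV hv)) (hI w (hV hw)) (hT1 v (hV hv))
      (hT2 v (hV hv)) (hvw ▸ hT1 w (hV hw)) (hvw ▸ hT2 w (hV hw))
    rw [hT3 v (hV hv), hT3 w (hV hw), hIe, hvw]
  have hcard : (V.image T).card = V.card := Finset.card_image_of_injOn hinj
  set N := V.card with hN
  -- The corner arguments are among those sorted, so two consecutive points always lie on a common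
  -- edge.
  have hmemA : ∀ i < n, A i ∈ V.image T := by
    intro i hi
    refine Finset.mem_image.2 ⟨P ⟨i, hi⟩, hP _, ?_⟩
    have hb := hV (hP ⟨i, hi⟩)
    have e : chordPoint r _ _ _ = r * Complex.exp (A i * Complex.I) :=
      add_left_cancel ((hT3 _ hb).symm.trans (h.vertex ⟨i, hi⟩))
    rw [chordPoint] at e
    have t0 := hT0 _ (hP ⟨i, hi⟩)
    have g := h.seq.gap _ (hI _ hb)
    have c1 := half_lt_cos_chord g.1.le g.2
    have c2 := cos_chord_pos g.2 (hT1 _ hb) (hT2 _ hb).le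
    have c3 := div_pos (mul_pos h.pos (one_half_pos.trans c1)) c2
    refine eq_of_exp_eq (a := A 0) t0.1 (by linarith [t0.2]) (h.seq.mono (Nat.zero_le _) hi.le) ?_
      c3 h.pos e
    rw [← hcl]
    exact (h.seq.gap i hi).1.trans_le (h.seq.mono hi le_rfl)
  set emb := (V.image T).orderEmbOfFin hcard with hemb
  have hembmem : ∀ k, emb k ∈ V.image T := fun k => Finset.orderEmbOfFin_mem _ _ _
  have hsurj : ∀ x ∈ V.image T, ∃ k, emb k = x := fun x hx => by
    have := Finset.range_orderEmbOfFin (V.image T) hcard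
    have hx' : x ∈ Set.range emb := by
      rw [hemb, this]
      exact hx
    exact hx'
  have hv : ∀ k : Fin N, ∃ v ∈ V, T v = emb k := fun k => Finset.mem_image.1 (hembmem k)
  choose w hwV hwT using hv
  have hNpos : 0 < N := Finset.card_pos.2 ⟨_, hP ⟨0, by omega⟩⟩
  -- At `N` the argument has gained a full turn while the point is again the first one. Beyond `N`
  -- the point stays constant, because `IsSubdivision.mem_hull` concerns all indices.
  let θ : ℕ → ℝ := fun k => if hk : k < N then emb ⟨k, hk⟩ else A 0 + 2 * π
  let u : ℕ → ℂ := fun k => if hk : k < N then w ⟨k, hk⟩ else w ⟨0, hNpos⟩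
  have hθ : ∀ k (hk : k < N), θ k = emb ⟨k, hk⟩ := fun k hk => dif_pos hk
  have hu : ∀ k (hk : k < N), u k = w ⟨k, hk⟩ := fun k hk => dif_pos hk
  have hθN : θ N = A 0 + 2 * π := dif_neg (lt_irrefl _)
  have huN : u N = w ⟨0, hNpos⟩ := dif_neg (lt_irrefl _)
  have hθ0 : θ 0 = A 0 := by
    rw [hθ 0 hNpos]
    apply le_antisymm
    · obtain ⟨k, hk⟩ := hsurj _ (hmemA 0 (by omega))
      rw [← hk]
      exact emb.monotone (Fin.mk_le_of_le_val (Nat.zero_le _))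
    · rw [← hwT]
      exact (hT0 _ (hwV _)).1
  have huT : ∀ k < N, u k ∈ V ∧ T (u k) = θ k := fun k hk => by
    rw [hu k hk, hθ k hk]
    exact ⟨hwV _, hwT _⟩
  refine ⟨u, θ, ⟨h, ?_, hθ0, by rw [hθN, hθ0], ?_, ?_⟩, ?_, fun k hk => ?_⟩
  · rw [huN, hu 0 hNpos]
  · intro k hk
    rcases Nat.lt_or_ge (k + 1) N with hk1 | hk1
    · rw [hθ k hk, hθ _ hk1]
      exact emb.strictMono (Fin.mk_lt_mk.2 (Nat.lt_succ_self k))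
    · rw [show k + 1 = N by omega, hθN, ← hcl, ← (huT k hk).2]
      exact (hT0 _ (huT k hk).1).2
  · intro k hk
    obtain ⟨huV, huk⟩ := huT k hk
    have hub := hV huV
    have hi := hI _ hub
    have ht1 := hT1 _ hub
    have ht2 := hT2 _ hub
    have ht3 := hT3 _ hub
    set i := I (u k) with hi_def
    rw [huk] at ht1 ht2 ht3
    have hnext : i + 1 < n → θ (k + 1) ≤ A (i + 1) ∧ k + 1 < N := by
      intro hi1
      obtain ⟨l, hl⟩ := hsurj _ (hmemA (i + 1) hi1)
      rw [hθ k hk, ← hl] at ht2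
      have hkl : k < l := by
        have := emb.lt_iff_lt.1 ht2
        exact this
      have hk1 : k + 1 < N := by omega
      refine ⟨?_, hk1⟩
      rw [hθ _ hk1, ← hl]
      exact emb.monotone (Fin.mk_le_of_le_val hkl)
    rcases Nat.lt_or_ge (k + 1) N with hk1 | hk1
    · obtain ⟨huV', huk'⟩ := huT (k + 1) hk1
      have hub' := hV huV'
      have hle : θ (k + 1) ≤ A (i + 1) := by
        rcases Nat.lt_or_ge (i + 1) n with hi1 | hi1
        · exact (hnext hi1).1
        · have : i + 1 = n := by omega
          rw [this, ← huk']
          exact (hT0 _ huV').2.le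
      refine ⟨i, hi, ht1, hle, ht3, ?_⟩
      have e1 := hT1 _ hub'
      have e2 := hT2 _ hub'
      have e3 := hT3 _ hub'
      have hI' := hI _ hub'
      rw [huk'] at e1 e2 e3
      have hlt : θ k < θ (k + 1) := by
        rw [hθ k hk, hθ _ hk1]
        exact emb.strictMono (Fin.mk_lt_mk.2 (Nat.lt_succ_self k))
      rcases hle.lt_or_eq with hlt' | heq
      · have : I (u (k + 1)) = i :=
          h.seq.eq_of_between hI' hi e1 e2 (ht1.trans hlt.le) hlt'
        rwa [this] at e3
      -- The next point is the corner at the end of edge `i`; it was assigned to edge `i + 1` and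
      -- has to be rewritten as an endpoint of edge `i`.
      · have hi1 : i + 1 < n := by
          by_contra hcon
          have hin : i + 1 = n := by omega
          have := (hT0 _ huV').2
          rw [huk', heq, hin] at this
          exact lt_irrefl _ this
        have : I (u (k + 1)) = i + 1 :=
          h.seq.eq_of_between hI' hi1 e1 e2 heq.ge (heq ▸ (h.seq.gap _ hi1).1)
        rw [this, heq, h.chordPoint_start hi1] at e3
        rw [heq, h.chordPoint_end hi]
        exact e3
    · have hkN : k + 1 = N := by omega
      have hi1 : i + 1 = n := by
        by_contra hcon
        have := (hnext (by omega)).2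
        omega
      refine ⟨i, hi, ht1, ?_, ht3, ?_⟩
      · rw [hkN, hθN, hi1, hcl]
      · obtain ⟨huV', huk'⟩ := huT 0 hNpos
        have hub' := hV huV'
        have e3 := hT3 _ hub'
        have hI0 : I (u 0) = 0 := by
          refine h.seq.eq_of_between (hI _ hub') (by omega) (hT1 _ hub') (hT2 _ hub') ?_ ?_
          · rw [huk', hθ0]
          · rw [huk', hθ0]
            exact (h.seq.gap 0 (by omega)).1
        rw [hI0, huk', hθ0, h.chordPoint_start (by omega)] at e3
        have hend := h.chordPoint_end hi
        rw [hkN, hθN, huN, ← hu 0 hNpos, e3, ← hcl, ← hi1, hend, hi1, hcl, exp_add_two_pi_mul_I]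
  · ext v
    constructor
    · rintro ⟨k, hk, rfl⟩
      exact (huT k hk).1
    · intro hvV
      obtain ⟨k, hk⟩ := hsurj (T v) (Finset.mem_image_of_mem T hvV)
      refine ⟨k, k.2, hinj (huT k k.2).1 hvV ?_⟩
      rw [(huT k k.2).2, hθ k k.2, hk]
  · rw [hu 0 hNpos]
    exact dif_neg hk.not_gt

end IsInscribed

/-! ### Filling an inscribed polygon with added vertices -/

namespace IsSortedBoundary

variable {n N : ℕ} {P : Polygon ℂ n} {c : ℂ} {r : ℝ} {A θ : ℕ → ℝ} {u : ℕ → ℂ}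

theorem gap (h : IsSortedBoundary P c r A u θ N) {k : ℕ} (hk : k < N) :
    θ k < θ (k + 1) ∧ θ (k + 1) - θ k ≤ π / 4 := by
  obtain ⟨i, hi, h1, h2, -, -⟩ := h.edge k hk
  have := h.inscribed.seq.gap i hi
  exact ⟨h.mono k hk, by linarith⟩

/-- A boundary point is at least as far from the center as its chord, at distance `r` times the
cosine of half an arc of at most 45°. This leaves room for the circle of radius `r / 2` inside. -/
theorem polar (h : IsSortedBoundary P c r A u θ N) {k : ℕ} (hk : k < N) :
    ∃ ρ : ℝ, r / 2 < ρ ∧ u k = c + ρ * Complex.exp (θ k * Complex.I) := by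
  obtain ⟨i, hi, h1, h2, h3, -⟩ := h.edge k hk
  refine ⟨_, ?_, h3⟩
  have g := h.inscribed.seq.gap i hi
  have hr := h.inscribed.pos
  have c1 := half_lt_cos_chord g.1.le g.2
  have c2 := cos_chord_pos g.2 h1 ((h.mono k hk).le.trans h2)
  rw [lt_div_iff₀ c2]
  have c3 := cos_le_one (θ k - (A i + A (i + 1)) / 2)
  nlinarith

theorem polar_le (h : IsSortedBoundary P c r A u θ N) {k : ℕ} (hk : k ≤ N) (hN : 0 < N) :
    ∃ ρ : ℝ, r / 2 < ρ ∧ u k = c + ρ * Complex.exp (θ k * Complex.I) := by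
  rcases hk.lt_or_eq with hk | rfl
  · exact h.polar hk
  · obtain ⟨ρ, h1, h2⟩ := h.polar hN
    exact ⟨ρ, h1, by rw [h.closed, h.angle_closed, exp_add_two_pi_mul_I, h2]⟩

theorem fillable (h : IsSortedBoundary P c r A u θ N) (hN : Even N) (hN8 : 8 ≤ N) :
    Fillable u N (100 * N) := by
  have hpi := pi_pos
  choose! ρ hρ hu using fun k (hk : k ≤ N) => h.polar_le hk (by omega)
  have hr := h.inscribed.pos
  have key : Fillable (fun k => u k - c) N (100 * N) := by
    refine fillable_radial hN hN8 h.angle_closed (fun k hk => h.gap hk) (s := r / 2) (ρ := ρ)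
      (by linarith) hρ (fun k hk => by rw [hu k hk]; ring) (by rw [h.closed]) fun k hk => ?_
    obtain ⟨i, hi, h1, h2, h3, h4⟩ := h.edge k hk
    have g := h.inscribed.seq.gap i hi
    have hm := h.mono k hk
    -- The normal of the edge is the middle of its arc, hence within `π / 8` of both arguments.
    refine ⟨(A i + A (i + 1)) / 2, ?_, ?_, ?_⟩
    · refine (chordPoint_hasDir hr g.2 h1 hm h2).congr ?_ rfl
      rw [h3, h4]
      ring
    · rw [abs_le]
      constructor <;> linarith
    · rw [abs_le]
      constructor <;> linarith
  have := key.similar c (a := 1) one_ne_zero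
  simpa using this

theorem isSubdivision (h : IsSortedBoundary P c r A u θ N) (hN : 0 < N)
    (hub : ∀ k < N, u k ∈ P.boundary ℝ) (hout : ∀ k, N ≤ k → u k = u 0) :
    IsSubdivision P u N := by
  have hpi := pi_pos
  have hins := h.inscribed
  have hr := hins.pos
  refine ⟨hins.isStrictlyConvex, h.closed, ?_, ?_, ?_, ⟨c, hins.center_mem_interior, ?_⟩⟩
  · have hsub : P.boundary ℝ ⊆ P.hull := Set.iUnion_subset fun i => P.edgeSet_subset_hull i
    intro k
    rcases lt_or_ge k N with hk | hk
    · exact hsub (hub k hk)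
    · rw [hout k hk]
      exact hsub (hub 0 hN)
  · intro k hk
    obtain ⟨i, hi, h1, h2, h3, h4⟩ := h.edge k hk
    have g := hins.seq.gap i hi
    obtain ⟨t, ht, e⟩ := chordPoint_sub_eq_smul (r := r) g.2 h1 (h.mono k hk) h2 le_rfl g.1 le_rfl
    have hc := half_lt_cos_chord g.1.le g.2
    rw [hins.chordPoint_start hi, hins.chordPoint_end hi] at e
    obtain ⟨s, -, e'⟩ : ∃ s : ℝ, 0 ≤ s ∧ u k - P ⟨i, hi⟩ =
        s * (P (finRotate n ⟨i, hi⟩) - P ⟨i, hi⟩) := by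
      rw [hins.next, hins.vertex, h3]
      rcases h1.lt_or_eq with h1' | h1'
      · obtain ⟨s, hs, e'⟩ := chordPoint_sub_eq_smul (r := r) g.2 le_rfl h1'
          ((h.mono k hk).le.trans h2) le_rfl g.1 le_rfl
        rw [hins.chordPoint_start hi, hins.chordPoint_end hi] at e'
        exact ⟨s, hs.le, by linear_combination e'⟩
      · refine ⟨0, le_rfl, ?_⟩
        rw [← h1', hins.chordPoint_start hi]
        simp
    refine ⟨⟨i, hi⟩, t, ht, fun x => ?_⟩
    have e2 : u (k + 1) - u k = t * (P (finRotate n ⟨i, hi⟩) - P ⟨i, hi⟩) := by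
      rw [hins.next, hins.vertex, h3, h4]
      linear_combination e
    have e3 : x - u k = (x - P ⟨i, hi⟩) - s * (P (finRotate n ⟨i, hi⟩) - P ⟨i, hi⟩) := by
      rw [← e']
      ring
    rw [e2, e3, Polygon.side]
    simp only [cross, Complex.sub_re, Complex.sub_im, Complex.re_ofReal_mul,
      Complex.im_ofReal_mul]
    ring
  · intro x hx
    obtain ⟨i, hi, τ, h1, h2, rfl⟩ := hins.exists_chordPoint hx
    have t0 : θ 0 ≤ τ := by
      rw [h.angle_zero]
      exact (hins.seq.mono (Nat.zero_le _) hi.le).trans h1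
    have t1 : τ < θ N := by
      rw [h.angle_closed, h.angle_zero, ← hins.seq.closed]
      exact h2.trans_le (hins.seq.mono hi le_rfl)
    obtain ⟨k, hk, k1, k2⟩ := exists_between_succ t0 t1
    refine ⟨k, hk, ?_⟩
    obtain ⟨i', hi', e1, e2, e3, e4⟩ := h.edge k hk
    obtain rfl := hins.seq.eq_of_between hi hi' h1 h2 (e1.trans k1) (k2.trans_le e2)
    have g := hins.seq.gap i hi
    have := mem_segment_chordPoint (r := r) g.2 e1 (h.mono k hk) e2 k1 k2.le
    rw [e3, e4]
    rw [segment_eq_image'] at this ⊢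
    obtain ⟨t, ht, e⟩ := this
    exact ⟨t, ht, by simp only [← e, Complex.real_smul]; ring⟩
  -- From the center each edge subtends the increment of the argument, and the increments add up to
  -- one turn.
  · have hstep : ∀ k ∈ Finset.range N, windAngle c (u k) (u (k + 1)) = θ (k + 1) - θ k := by
      intro k hk
      rw [Finset.mem_range] at hk
      obtain ⟨ρ, r1, e1⟩ := h.polar_le hk.le hN
      obtain ⟨ρ', r2, e2⟩ := h.polar_le (k := k + 1) hk hN
      obtain ⟨g1, g2⟩ := h.gap hk
      have p1 : 0 < ρ := by linarith
      have p2 : 0 < ρ' := by linarith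
      have d1 : u k - c = ρ * Complex.exp (θ k * Complex.I) := by
        rw [e1]
        ring
      have d2 : u (k + 1) - c = ρ' * Complex.exp (θ (k + 1) * Complex.I) := by
        rw [e2]
        ring
      have hcross : cross (u k - c) (u (k + 1) - c) = ρ * ρ' * sin (θ (k + 1) - θ k) := by
        rw [d1, d2]
        simp only [cross, Complex.re_ofReal_mul, Complex.im_ofReal_mul,
          Complex.exp_ofReal_mul_I_re, Complex.exp_ofReal_mul_I_im, sin_sub]
        ring
      have hsin : 0 < sin (θ (k + 1) - θ k) :=
        sin_pos_of_pos_of_lt_pi (by linarith) (by linarith)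
      rw [(windAngle_eq_arg (by rw [hcross]; positivity)).1, d1, d2]
      have hdiv : (ρ' : ℂ) * Complex.exp (θ (k + 1) * Complex.I) /
          (ρ * Complex.exp (θ k * Complex.I)) = ((ρ' / ρ : ℝ) : ℂ) *
            Complex.exp ((θ (k + 1) - θ k : ℝ) * Complex.I) := by
        rw [mul_div_mul_comm, ← Complex.exp_sub]
        push_cast
        congr 2
        ring
      rw [hdiv, Complex.arg_real_mul _ (div_pos p2 p1), Complex.exp_mul_I,
        Complex.arg_cos_add_sin_mul_I ⟨by linarith, by linarith⟩]
    rw [Finset.sum_congr rfl hstep, Finset.sum_range_sub, h.angle_closed]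
    ring

end IsSortedBoundary

/-! ### Meshes of cyclic polygons and of the regular octagon -/

namespace IsInscribed

variable {n k : ℕ} {P : Polygon ℂ n} {c : ℂ} {r : ℝ} {A : ℕ → ℝ}

theorem exists_mesh (h : IsInscribed P c r A) (hnk : Even (n + k)) {P' : Polygon ℂ (n + k)}
    (hP' : P'.IsObtainedByAdding P) :
    ∃ Γ : PSLG, Γ.IsNiceQuadMesh P' ∧ Γ.Extends P' ∧
      Γ.faces.encard ≤ ((100 * (n + k) : ℕ) : ℕ∞) := by
  classical
  obtain ⟨hs, hb, hr⟩ := hP'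
  have hV : ((Finset.univ.image P'.vertices : Finset ℂ) : Set ℂ) = Set.range P'.vertices := by
    simp
  have hcard : (Finset.univ.image P'.vertices).card = n + k := by
    rw [Finset.card_image_of_injective _ hs.2.1, Finset.card_univ, Fintype.card_fin]
  have hsub : Set.range P'.vertices ⊆ P.boundary ℝ := by
    rw [← hb]
    rintro _ ⟨i, rfl⟩
    exact Set.mem_iUnion.2 ⟨i, IsFilling.vertex_mem_edgeSet _ _⟩
  obtain ⟨u, θ, hu, himage, hout⟩ := h.exists_sortedBoundary (Finset.univ.image P'.vertices)
    (hV ▸ hsub) fun i => by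
      rw [← Finset.mem_coe, hV]
      exact hr ⟨i, rfl⟩
  rw [hV] at himage
  rw [hcard] at hu himage hout
  have hn8 := h.seq.eight_le
  obtain ⟨ι, _, q, hι, hq⟩ := hu.fillable hnk (by omega)
  have hub : ∀ j < n + k, u j ∈ P.boundary ℝ := fun j hj => hsub (himage ▸ ⟨j, hj, rfl⟩)
  obtain ⟨Γ, h1, h2, h3⟩ :=
    hq.exists_mesh (hu.isSubdivision (by omega) hub hout) hb himage.symm
  exact ⟨Γ, h1, h2, h3.trans (by exact_mod_cast hι)⟩

end IsInscribed

theorem Polygon.IsRegular.isCyclicTuple {P : Polygon ℂ 8} (h : P.IsRegular) :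
    ∃ c r, P.IsCyclicTuple c r (π / 4) := by
  obtain ⟨c, v, hv, hP⟩ := h
  have hpi := pi_pos
  refine ⟨c, ‖v‖, norm_pos_iff.2 hv, fun j => v.arg + 2 * π * (j : ℕ) / 8, fun i j hij => ?_, ?_,
    fun j => ?_, fun j => ?_⟩
  · have : ((i : ℕ) : ℝ) < (j : ℕ) := by exact_mod_cast hij
    dsimp only
    gcongr
  · simp
  · simp only [Fin.val_succ, Fin.val_castSucc]
    push_cast
    linarith
  · conv_lhs => rw [hP, ← Complex.norm_mul_exp_arg_mul_I v]
    rw [mul_assoc, ← Complex.exp_add, ← add_mul]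
    push_cast
    rfl

theorem mainTheorem5 :
    (∀ P : Polygon ℂ 8, P.IsRegular → P.IsSink) ∧
    (∃ C : ℕ, ∀ P : Polygon ℂ 8, P.IsRegular →
      ∀ M : ℕ, 1 ≤ M → Even M → ∀ P' : Polygon ℂ (8 + M), P'.IsObtainedByAdding P →
        ∃ Γ : PSLG, Γ.IsNiceQuadMesh P' ∧ Γ.Extends P' ∧
          Γ.faces.encard ≤ ((C * M : ℕ) : ℕ∞)) ∧
    (∃ C : ℕ, ∀ (n k : ℕ) (P : Polygon ℂ n) (c : ℂ) (r : ℝ),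
      P.IsCyclicTuple c r (Real.pi / 4) → Even (n + k) →
      ∀ P' : Polygon ℂ (n + k), P'.IsObtainedByAdding P →
        ∃ Γ : PSLG, Γ.IsNiceQuadMesh P' ∧ Γ.Extends P' ∧
          Γ.faces.encard ≤ ((C * (n + k) : ℕ) : ℕ∞)) := by
  have octagon : ∀ P : Polygon ℂ 8, P.IsRegular → ∃ c r A, IsInscribed P c r A := fun P hP => by
    obtain ⟨c, r, h⟩ := hP.isCyclicTuple
    obtain ⟨A, hA⟩ := h.exists_isInscribed
    exact ⟨c, r, A, hA⟩
  -- `900 = 100 * 9`, because `8 + M ≤ 9 * M` when `M ≥ 1`.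
  refine ⟨fun P hP => ?_, ⟨900, fun P hP M hM hM2 P' hP' => ?_⟩, ⟨100, ?_⟩⟩
  · obtain ⟨c, r, A, hA⟩ := octagon P hP
    refine ⟨hA.isStrictlyConvex.isSimple, fun k hk P' hP' => ?_⟩
    obtain ⟨Γ, h1, h2, -⟩ := hA.exists_mesh ((by decide : Even 8).add hk) hP'
    exact ⟨Γ, h1, h2⟩
  · obtain ⟨c, r, A, hA⟩ := octagon P hP
    obtain ⟨Γ, h1, h2, h3⟩ := hA.exists_mesh ((by decide : Even 8).add hM2) hP'
    exact ⟨Γ, h1, h2, h3.trans (Nat.cast_le.2 (by omega))⟩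
  · intro n k P c r h hnk P' hP'
    obtain ⟨A, hA⟩ := h.exists_isInscribed
    exact hA.exists_mesh hnk hP'
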